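/- **Posterior LDP in CNNs.** Fix integers $L\ge 1$ (hidden layers), $P$ (inputs), spatial dimensions $N_0,\dots,N_{L+1}$, mask sizes $M_0,\dots,M_L$, numbers $C_0$, $C_{L+1}$ of input and output channels, precisions $\lambda_0,\dots,\lambda_L>0$, an activation function $\sigma:\mathbb R\to\mathbb R$, patch extractors $R^{(i,\ell)}:\mathbb R^{N_\ell}\to\mathbb R^{M_\ell}$ ($0\le\ell\le L$, $1\le i\le N_{\ell+1}$) and inputs $\mathbf x_\mu=[x_{\mu,c,i}]\in\mathbb R^{C_0\times N_0}$, $\mu=1,\dots,P$. For $n\ge1$ let $C_1(n),\dots,C_L(n)$ be channel numbers with $C_\ell(n)/n\to\alpha_\ell\in(0,\infty)$ as $n\to\infty$, and put $C_0(n)=C_0$, $C_{L+1}(n)=C_{L+1}$. The network is $$h^{(1)}_{c,i}(\mathbf x)=\frac1{\sqrt{M_0C_0}}\sum_{c'=1}^{C_0}\sum_{m=1}^{M_0}W^{(0)}_{m,c',c}R^{(i,0)}_m(x_{c',:}),\qquad h^{(\ell+1)}_{c,i}(\mathbf x)=\frac1{\sqrt{M_\ell C_\ell(n)}}\sum_{c'=1}^{C_\ell(n)}\sum_{m=1}^{M_\ell}W^{(\ell)}_{m,c',c}\,\sigma\big(R^{(i,\ell)}_m(h^{(\ell)}_{c',:}(\mathbf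 x))\big)$$ for $1\le \ell\le L$, $1\le c\le C_{\ell+1}(n)$, $1\le i\le N_{\ell+1}$. Under the prior the weights are independent with $W^{(\ell)}_{m,c',c}\sim\mathcal N(0,\lambda_\ell^{-1})$. *Assumptions.* $\sigma$ is continuous and $|\sigma(s)-\sigma(t)|\le L_\sigma|s-t|+\rho_\sigma(s)+\rho_\sigma(t)$ for all $s,t\in\mathbb R$, with a constant $L_\sigma\ge0$ and a locally bounded $\rho_\sigma$ with $\rho_\sigma(s)=o(|s|)$ as $|s|\to\infty$. For all $1\le\ell\le L$ and $i$, $R^{(i,\ell)}$ is continuous and $\|R^{(i,\ell)}(z)-R^{(i,\ell)}(z')\|\le L_R\|z-z'\|+\rho_R(z)+\rho_R(z')$ for all $z,z'\in\mathbb R^{N_\ell}$, with a constant $L_R\ge 0$ and a function $\rho_R$ with $\rho_R(z)=o(\|z\|)$ as $\|z\|\to\infty$ ($L_R$ and $\rho_R$ may depend on $\ell$ and $i$). *Notation.* Let $D_\ell=N_\ell P$ and let $\mathcal S_D^+$ be the set of symmetric positive semidefinite $D\times D$ matrices; matrices of size $D_\ell$ are indexed by pairs $(i,\mu)$. For $z\in\mathbb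 R^{N_\ell\times P}$ let $$[G^{(\ell)}(z)]_{i,\mu;j,\nu}=\frac1{\lambda_\ell M_\ell}\sum_{m=1}^{M_\ell}\sigma\big(R^{(i,\ell)}_m(z_{:,\mu})\big)\,\sigma\big(R^{(j,\ell)}_m(z_{:,\nu})\big),\qquad \mathbf K^{(1)}_{i,\mu;j,\nu}=\frac1{\lambda_0C_0M_0}\sum_{c=1}^{C_0}\sum_{m=1}^{M_0}R^{(i,0)}_m(x_{\mu,c,:})R^{(j,0)}_m(x_{\nu,c,:}),$$ and, for $1\le\ell\le L$, $\mathbf K^{(\ell+1,n)}=\frac1{C_\ell(n)}\sum_{c=1}^{C_\ell(n)}G^{(\ell)}\big([h^{(\ell)}_{c,i}(\mathbf x_\mu)]_{i,\mu}\big)\in\mathcal S^+_{D_{\ell+1}}$. For $Q_1\in\mathcal S^+_{D_\ell}$, $Q_2\in\mathcal S^+_{D_{\ell+1}}$ let $$I_\ell(Q_2\mid Q_1)=\sup_{Q_0}\Big\{\operatorname{tr}(Q_0^\top Q_2)-\log\int e^{\operatorname{tr}(Q_0^\top G^{(\ell)}(z))}\,\mathcal N(dz\mid \mathbf 0,Q_1)\Big\},$$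 the supremum being over symmetric $D_{\ell+1}\times D_{\ell+1}$ matrices $Q_0$ (the integral may be $+\infty$), and $$I_{2,\dots,L+1}(Q_2,\dots,Q_{L+1})=\alpha_1I_1(Q_2\mid\mathbf K^{(1)})+\sum_{\ell=2}^L\alpha_\ell I_\ell(Q_{\ell+1}\mid Q_\ell),\qquad I_{L+1}(Q)=\inf_{Q_2,\dots,Q_L}I_{2,\dots,L+1}(Q_2,\dots,Q_L,Q),$$ with $Q_\ell\in\mathcal S^+_{D_\ell}$. Let $\mathcal Q_n$ be the law of $\mathbf K^{(L+1,n)}$ under the prior. For $\beta>0$ and labels $\mathbf y=(\mathbf y_1,\dots,\mathbf y_P)$, $\mathbf y_\mu\in\mathbb R^{C_{L+1}\times N_{L+1}}$, let $\mathcal Q_n(\cdot\mid\mathbf y)$ be the law of $\mathbf K^{(L+1,n)}$ under the posterior distribution of the weights, that is, under the probability measure whose density with respect to the prior is proportional to the Gaussian likelihood $(\beta/2\pi)^{C_{L+1}D_{L+1}/2}\exp\big(-\frac\beta2\sum_{\mu=1}^P\|h^{(L+1)}(\mathbf x_\mu)-\mathbf y_\mu\|^2\big)$. *Claim.* $(\mathcal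 Q_n)_{n\ge1}$ satisfies a large deviation principle on $\mathcal S^+_{D_{L+1}}$ with speed $n$ and rate function $I_{L+1}$; and, for every $\beta>0$ and every $\mathbf y$, $(\mathcal Q_n(\cdot\mid\mathbf y))_{n\ge1}$ satisfies a large deviation principle with speed $n$ and the same rate function $I_{L+1}$. Here a sequence of measures $\mu_n$ satisfies a large deviation principle with speed $n$ and rate function $I$ if $I$ is lower semicontinuous with values in $(-\infty,+\infty]$, $\liminf_n\frac1n\log\mu_n(O)\ge-\inf_OI$ for every open $O$, and $\limsup_n\frac1n\log\mu_n(F)\le-\inf_FI$ for every closed $F$. -/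

import Mathlib

open MeasureTheory ProbabilityTheory Filter Topology

/-! ### Large deviation principles -/

/-- The sequence of measures `μ` satisfies a large deviation principle with speed `n` and
rate function `I`, where a rate function is lower semicontinuous with values in `(-∞, +∞]`. -/
structure SatisfiesLDP {X : Type*} [TopologicalSpace X] [MeasurableSpace X]
    (μ : ℕ → Measure X) (I : X → EReal) : Prop where
  ne_bot : ∀ x, I x ≠ ⊥
  lsc : LowerSemicontinuous I
  lower : ∀ O : Set X, IsOpen O →
    -(⨅ x ∈ O, I x) ≤ liminf (fun n : ℕ => (((n : ℝ)⁻¹ : ℝ) : EReal) * ENNReal.log (μ n O)) atTop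
  upper : ∀ F : Set X, IsClosed F →
    limsup (fun n : ℕ => (((n : ℝ)⁻¹ : ℝ) : EReal) * ENNReal.log (μ n F)) atTop ≤ -(⨅ x ∈ F, I x)

/-! ### Positive semidefinite matrices -/

/-- The closed cone of symmetric positive semidefinite real matrices indexed by `ι`, with the
topology of a subspace of the space of all matrices. -/
abbrev PSD (ι : Type*) : Type _ := {Q : Matrix ι ι ℝ // Q.PosSemidef}

instance PSD.instMeasurableSpace (ι : Type*) : MeasurableSpace (PSD ι) := borel _

instance PSD.instBorelSpace (ι : Type*) : BorelSpace (PSD ι) := ⟨rfl⟩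

/-- The matrix `r⁻¹ ∑ₖ vₖ vₖᵀ`, which is positive semidefinite since `r ≥ 0`. -/
noncomputable def PSD.gram {ι κ : Type*} [Finite ι] [Fintype κ] (r : NNReal) (v : κ → ι → ℝ) :
    PSD ι :=
  ⟨Matrix.of fun a b => (r : ℝ)⁻¹ * ∑ k, v k a * v k b, by
    have h : (Matrix.of fun a b => (r : ℝ)⁻¹ * ∑ k, v k a * v k b : Matrix ι ι ℝ)
        = (r : ℝ)⁻¹ • ∑ k, Matrix.vecMulVec (v k) (star (v k)) := by
      ext a b
      simp [Matrix.sum_apply, Matrix.vecMulVec_apply]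
    rw [h]
    exact (Matrix.posSemidef_sum _ fun k _ => Matrix.posSemidef_vecMulVec_self_star (v k)).smul
      (inv_nonneg.mpr r.2)⟩

/-- The arithmetic mean of finitely many positive semidefinite matrices. -/
noncomputable def PSD.mean {ι : Type*} {C : ℕ} (A : Fin C → PSD ι) : PSD ι :=
  ⟨(C : ℝ)⁻¹ • ∑ c, (A c).1,
    (Matrix.posSemidef_sum _ fun c _ => (A c).2).smul (inv_nonneg.mpr (Nat.cast_nonneg C))⟩

/-! ### Convolutional networks -/

/-- The part of the description of a convolutional network that does not involve the numbers of
channels. Only the layers `ℓ ≤ L` (and `N (L + 1)`) are used.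
* `L` is the number of hidden layers;
* `N ℓ` is the spatial dimension of layer `ℓ`;
* `M ℓ` is the size of the mask at layer `ℓ`;
* `σ` is the activation function;
* `R ℓ i` is the patch extractor of the receptive field of neuron `i` of layer `ℓ + 1`;
* `lam ℓ` is the prior precision of the weights of layer `ℓ`. -/
structure CNN where
  L : ℕ
  N : ℕ → ℕ
  M : ℕ → ℕ
  σ : ℝ → ℝ
  R : ∀ ℓ : ℕ, Fin (N (ℓ + 1)) → EuclideanSpace ℝ (Fin (N ℓ)) → EuclideanSpace ℝ (Fin (M ℓ))
  lam : ℕ → NNReal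

namespace CNN

/-- The weights `W ℓ m c' c`, `0 ≤ ℓ ≤ L`, of the network with `C ℓ` channels in layer `ℓ`. -/
abbrev Weights (A : CNN) (C : ℕ → ℕ) : Type :=
  ∀ ℓ : Fin (A.L + 1), Fin (A.M ℓ) → Fin (C ℓ) → Fin (C (ℓ + 1)) → ℝ

/-- The Gaussian prior: the weights are independent, those of layer `ℓ` with law
`N(0, (lam ℓ)⁻¹)`. -/
noncomputable def prior (A : CNN) (C : ℕ → ℕ) : Measure (A.Weights C) :=
  Measure.pi fun ℓ => Measure.pi fun _ => Measure.pi fun _ => Measure.pi fun _ =>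
    gaussianReal 0 (A.lam ℓ)⁻¹

/-- The pre-activations: `A.preact W x ℓ h c i` is `h^{(ℓ+1)}_{c,i}(x)`. -/
noncomputable def preact (A : CNN) {C : ℕ → ℕ} (W : A.Weights C)
    (x : Fin (C 0) → EuclideanSpace ℝ (Fin (A.N 0))) :
    ∀ ℓ : ℕ, ℓ < A.L + 1 → Fin (C (ℓ + 1)) → EuclideanSpace ℝ (Fin (A.N (ℓ + 1)))
  | 0, h => fun c => WithLp.toLp 2 fun i =>
      (√((A.M 0 : ℝ) * C 0))⁻¹ * ∑ c', ∑ m, W ⟨0, h⟩ m c' c * A.R 0 i (x c') m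
  | ℓ + 1, h => fun c => WithLp.toLp 2 fun i =>
      (√((A.M (ℓ + 1) : ℝ) * C (ℓ + 1)))⁻¹ * ∑ c', ∑ m,
        W ⟨ℓ + 1, h⟩ m c' c *
          A.σ (A.R (ℓ + 1) i (A.preact W x ℓ (Nat.lt_of_succ_lt h) c') m)

/-- The index set of the covariance of layer `ℓ` for `P` inputs: pairs `(i, μ)` of a spatial
position and an input. -/
abbrev Idx (A : CNN) (P ℓ : ℕ) : Type := Fin (A.N ℓ) × Fin P

/-- The slice `z_{:,μ}` of a tensor `z`. -/
def slice (A : CNN) {P ℓ : ℕ} (z : EuclideanSpace ℝ (A.Idx P ℓ)) (μ : Fin P) :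
    EuclideanSpace ℝ (Fin (A.N ℓ)) :=
  WithLp.toLp 2 fun i => z (i, μ)

/-- The function `G^{(ℓ)}`, with entries
`G^{(ℓ)}(z)_{(i,μ),(j,ν)} = (lam ℓ * M ℓ)⁻¹ ∑ₘ σ(R^{(i,ℓ)}_m(z_{:,μ})) σ(R^{(j,ℓ)}_m(z_{:,ν}))`. -/
noncomputable def G (A : CNN) {P : ℕ} (ℓ : ℕ) (z : EuclideanSpace ℝ (A.Idx P ℓ)) :
    PSD (A.Idx P (ℓ + 1)) :=
  PSD.gram (A.lam ℓ * A.M ℓ) fun (m : Fin (A.M ℓ)) (a : A.Idx P (ℓ + 1)) =>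
    A.σ (A.R ℓ a.1 (A.slice z a.2) m)

/-- The deterministic covariance `K^{(1)}` of the first layer. -/
noncomputable def inputCov (A : CNN) {P C₀ : ℕ}
    (x : Fin P → Fin C₀ → EuclideanSpace ℝ (Fin (A.N 0))) : PSD (A.Idx P 1) :=
  PSD.mean fun c : Fin C₀ =>
    PSD.gram (A.lam 0 * A.M 0) fun (m : Fin (A.M 0)) (a : A.Idx P 1) => A.R 0 a.1 (x a.2 c) m

/-- The conditional covariance of layer `ℓ + 1` as a function of the weights:
`A.condCov W x ℓ h` is `K^{(ℓ+1)}`. -/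
noncomputable def condCov (A : CNN) {C : ℕ → ℕ} (W : A.Weights C) {P : ℕ}
    (x : Fin P → Fin (C 0) → EuclideanSpace ℝ (Fin (A.N 0))) :
    ∀ ℓ : ℕ, ℓ < A.L + 1 → PSD (A.Idx P (ℓ + 1))
  | 0, _ => A.inputCov x
  | ℓ + 1, h => PSD.mean fun c : Fin (C (ℓ + 1)) =>
      A.G (ℓ + 1) (WithLp.toLp 2 fun a : A.Idx P (ℓ + 1) =>
        A.preact W (x a.2) ℓ (Nat.lt_of_succ_lt h) c a.1)

/-- The covariance `K^{(L+1)}` of the last layer. -/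
noncomputable def lastCov (A : CNN) {C : ℕ → ℕ} {P : ℕ}
    (x : Fin P → Fin (C 0) → EuclideanSpace ℝ (Fin (A.N 0))) (W : A.Weights C) :
    PSD (A.Idx P (A.L + 1)) :=
  A.condCov W x A.L (Nat.lt_succ_self _)

/-- The Gaussian likelihood, with precision `β`, of the labels `y` given the outputs of the
network with weights `W` at the inputs `x`. -/
noncomputable def likelihood (A : CNN) {C : ℕ → ℕ} {P : ℕ}
    (x : Fin P → Fin (C 0) → EuclideanSpace ℝ (Fin (A.N 0))) (β : ℝ)
    (y : Fin P → Fin (C (A.L + 1)) → EuclideanSpace ℝ (Fin (A.N (A.L + 1))))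
    (W : A.Weights C) : ℝ :=
  (β / (2 * Real.pi)) ^ (((C (A.L + 1) * A.N (A.L + 1) * P : ℕ) : ℝ) / 2) *
    Real.exp (-(β / 2) * ∑ μ, ∑ c, ‖A.preact W (x μ) A.L (Nat.lt_succ_self _) c - y μ c‖ ^ 2)

/-- The posterior distribution of the weights given the labels `y`, by Bayes' formula. -/
noncomputable def posterior (A : CNN) {C : ℕ → ℕ} {P : ℕ}
    (x : Fin P → Fin (C 0) → EuclideanSpace ℝ (Fin (A.N 0))) (β : ℝ)
    (y : Fin P → Fin (C (A.L + 1)) → EuclideanSpace ℝ (Fin (A.N (A.L + 1)))) :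
    Measure (A.Weights C) :=
  (∫⁻ W, ENNReal.ofReal (A.likelihood x β y W) ∂(A.prior C))⁻¹ •
    (A.prior C).withDensity fun W => ENNReal.ofReal (A.likelihood x β y W)

/-- The law of `K^{(L+1)}` under the prior. -/
noncomputable def priorLaw (A : CNN) {C : ℕ → ℕ} {P : ℕ}
    (x : Fin P → Fin (C 0) → EuclideanSpace ℝ (Fin (A.N 0))) :
    Measure (PSD (A.Idx P (A.L + 1))) :=
  (A.prior C).map (A.lastCov x)

/-- The law of `K^{(L+1)}` under the posterior. -/
noncomputable def posteriorLaw (A : CNN) {C : ℕ → ℕ} {P : ℕ}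
    (x : Fin P → Fin (C 0) → EuclideanSpace ℝ (Fin (A.N 0))) (β : ℝ)
    (y : Fin P → Fin (C (A.L + 1)) → EuclideanSpace ℝ (Fin (A.N (A.L + 1)))) :
    Measure (PSD (A.Idx P (A.L + 1))) :=
  (A.posterior x β y).map (A.lastCov x)

/-! ### The rate function -/

/-- The conditional rate function
`I_ℓ(Q₂ | Q₁) = sup_{Q₀} {tr(Q₀ᵀ Q₂) - log ∫ exp(tr(Q₀ᵀ G^{(ℓ)}(z))) N(dz | 0, Q₁)}`,
the supremum being over symmetric matrices and the integral being allowed to be `+∞`. -/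
noncomputable def condRate (A : CNN) {P : ℕ} (ℓ : ℕ) (Q₂ : PSD (A.Idx P (ℓ + 1)))
    (Q₁ : PSD (A.Idx P ℓ)) : EReal :=
  ⨆ Q₀ : {Q : Matrix (A.Idx P (ℓ + 1)) (A.Idx P (ℓ + 1)) ℝ // Q.IsSymm},
    ((Q₀.1.transpose * Q₂.1).trace : EReal) -
      ENNReal.log (∫⁻ z, ENNReal.ofReal (Real.exp ((Q₀.1.transpose * (A.G ℓ z).1).trace))
        ∂(multivariateGaussian 0 Q₁.1))

/-- The joint rate function `∑_{ℓ=1}^{L} α_ℓ I_ℓ(Q_{ℓ+1} | Q_ℓ)`; it only depends on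
`Q_1, …, Q_{L+1}`. -/
noncomputable def jointRate (A : CNN) {P : ℕ} (α : ℕ → ℝ) (Q : ∀ ℓ : ℕ, PSD (A.Idx P ℓ)) :
    EReal :=
  ∑ ℓ ∈ Finset.Icc 1 A.L, (α ℓ : EReal) * A.condRate ℓ (Q (ℓ + 1)) (Q ℓ)

/-- The rate function `I_{L+1}`: the infimum of the joint rate function over `Q_2, …, Q_L`, with
`Q_1 = K^{(1)}` and `Q_{L+1} = Q`. -/
noncomputable def lastRate (A : CNN) {P C₀ : ℕ} (α : ℕ → ℝ)
    (x : Fin P → Fin C₀ → EuclideanSpace ℝ (Fin (A.N 0))) (Q : PSD (A.Idx P (A.L + 1))) : EReal :=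
  ⨅ (q : ∀ ℓ : ℕ, PSD (A.Idx P ℓ)) (_ : q 1 = A.inputCov x) (_ : q (A.L + 1) = Q),
    A.jointRate α q

end CNN

/-! ### The regularity assumption -/

/-- `‖f x - f y‖ ≤ K ‖x - y‖ + ρ x + ρ y` for some constant `K ≥ 0`, where `ρ x = o(‖x‖)` as
`‖x‖ → ∞`. -/
def AsympLipschitz {E F : Type*} [NormedAddCommGroup E] [NormedAddCommGroup F] (f : E → F)
    (ρ : E → ℝ) : Prop :=
  (∃ K : ℝ, 0 ≤ K ∧ ∀ x y, ‖f x - f y‖ ≤ K * ‖x - y‖ + ρ x + ρ y) ∧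
    ρ =o[Bornology.cobounded E] (fun x => ‖x‖)

/-- `ρ` is bounded near every point. -/
def LocallyBdd {E : Type*} [TopologicalSpace E] (ρ : E → ℝ) : Prop :=
  ∀ x, ∃ B : ℝ, ∀ᶠ y in 𝓝 x, |ρ y| ≤ B

set_option linter.unusedSectionVars false

/-! ### The exponential with values in `[0, ∞]` -/

/-- The real exponential with values in `ENNReal`. -/
noncomputable def eexp (r : ℝ) : ENNReal := ENNReal.ofReal (Real.exp r)

lemma eexp_add (a b : ℝ) : eexp (a + b) = eexp a * eexp b := by
  rw [eexp, eexp, eexp, Real.exp_add, ENNReal.ofReal_mul (Real.exp_pos a).le]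

@[simp] lemma eexp_zero : eexp 0 = 1 := by simp [eexp]

lemma eexp_ne_top (a : ℝ) : eexp a ≠ ⊤ := ENNReal.ofReal_ne_top

lemma eexp_pos (a : ℝ) : 0 < eexp a := ENNReal.ofReal_pos.2 (Real.exp_pos a)

lemma eexp_ne_zero (a : ℝ) : eexp a ≠ 0 := (eexp_pos a).ne'

lemma eexp_le {a b : ℝ} : eexp a ≤ eexp b ↔ a ≤ b := by
  rw [eexp, eexp, ENNReal.ofReal_le_ofReal_iff (Real.exp_pos b).le, Real.exp_le_exp]

lemma eexp_lt {a b : ℝ} : eexp a < eexp b ↔ a < b := lt_iff_lt_of_le_iff_le eexp_le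

lemma eexp_nat_mul (n : ℕ) (a : ℝ) : eexp (n * a) = eexp a ^ n := by
  rw [eexp, eexp, Real.exp_nat_mul, ENNReal.ofReal_pow (Real.exp_pos a).le]

lemma eexp_rpow (a t : ℝ) : eexp a ^ t = eexp (a * t) := by
  rw [eexp, ENNReal.ofReal_rpow_of_pos (Real.exp_pos a), ← Real.exp_mul, eexp]

lemma log_eexp (a : ℝ) : ENNReal.log (eexp a) = a := by
  rw [eexp, ENNReal.log_ofReal_of_pos (Real.exp_pos a), Real.log_exp]

lemma continuous_eexp : Continuous eexp := ENNReal.continuous_ofReal.comp Real.continuous_exp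

lemma measurable_eexp : Measurable eexp := continuous_eexp.measurable

@[fun_prop]
lemma Measurable.eexp {Ω : Type*} [MeasurableSpace Ω] {f : Ω → ℝ} (hf : Measurable f) :
    Measurable fun ω => eexp (f ω) := measurable_eexp.comp hf

/-! ### Convolution powers -/

section ConvPow

variable {E : Type*} [NormedAddCommGroup E] [MeasurableSpace E] [BorelSpace E]
  [SecondCountableTopology E]

/-- The `m`-fold convolution power of a measure. -/
noncomputable def convPow (μ : Measure E) : ℕ → Measure E
  | 0 => Measure.dirac 0
  | m + 1 => convPow μ m ∗ μ

instance convPow.isFiniteMeasure (μ : Measure E) [IsFiniteMeasure μ] (m : ℕ) :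
    IsFiniteMeasure (convPow μ m) := by
  induction m with
  | zero => rw [convPow]; infer_instance
  | succ m ih => rw [convPow]; infer_instance

instance convPow.isProbabilityMeasure (μ : Measure E) [IsProbabilityMeasure μ] (m : ℕ) :
    IsProbabilityMeasure (convPow μ m) := by
  induction m with
  | zero => rw [convPow]; infer_instance
  | succ m ih => rw [convPow]; infer_instance

lemma convPow_add (μ : Measure E) [IsFiniteMeasure μ] (m k : ℕ) :
    convPow μ (m + k) = convPow μ m ∗ convPow μ k := by
  induction k with
  | zero => simp [convPow]
  | succ k ih => rw [← add_assoc, convPow, convPow, ih, Measure.conv_assoc]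

/-- Independence of the two summands. This inequality is what makes ball probabilities of
convolution powers supermultiplicative. -/
lemma mul_le_conv (μ ν : Measure E) [SFinite ν] {s t u : Set E}
    (hu : MeasurableSet u) (h : ∀ a ∈ s, ∀ b ∈ t, a + b ∈ u) : μ s * ν t ≤ (μ ∗ ν) u := by
  rw [Measure.conv, Measure.map_apply measurable_add hu, ← Measure.prod_prod]
  exact measure_mono fun p hp => h _ hp.1 _ hp.2

lemma convPow_mono {μ ν : Measure E} [IsFiniteMeasure μ] [IsFiniteMeasure ν] (h : μ ≤ ν) (m : ℕ) :
    convPow μ m ≤ convPow ν m := by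
  induction m with
  | zero => exact le_rfl
  | succ m ih =>
    rw [convPow, convPow, Measure.conv, Measure.conv]
    refine Measure.map_mono ?_ measurable_add
    exact Measure.prod_mono ih h

lemma convPow_apply_compl_closedBall {μ : Measure E} [IsFiniteMeasure μ] {r : ℝ}
    (h : μ (Metric.closedBall 0 r)ᶜ = 0) (m : ℕ) :
    convPow μ m (Metric.closedBall 0 (m * r))ᶜ = 0 := by
  induction m with
  | zero => simp [convPow]
  | succ m ih =>
    rw [convPow, Measure.conv, Measure.map_apply measurable_add
      Metric.isClosed_closedBall.measurableSet.compl]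
    refine measure_mono_null (t := ((Metric.closedBall 0 (m * r))ᶜ ×ˢ Set.univ) ∪
      (Set.univ ×ˢ (Metric.closedBall 0 r)ᶜ)) ?_ ?_
    · rintro ⟨a, b⟩ hab
      by_contra hcon
      simp only [Set.mem_union, Set.mem_prod, Set.mem_compl_iff, Metric.mem_closedBall,
        dist_zero_right, Set.mem_univ, and_true, true_and, not_or, not_not,
        Set.mem_preimage] at hcon hab
      refine hab ((norm_add_le a b).trans ?_)
      push_cast
      linarith [hcon.1, hcon.2]
    · refine measure_union_null ?_ ?_ <;> rw [Measure.prod_prod] <;> simp [ih, h]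

lemma lintegral_eexp_convPow [NormedSpace ℝ E] (μ : Measure E) [IsFiniteMeasure μ]
    (l : E →L[ℝ] ℝ) (m : ℕ) :
    ∫⁻ s, eexp (l s) ∂(convPow μ m) = (∫⁻ s, eexp (l s) ∂μ) ^ m := by
  have hl : Measurable fun s => eexp (l s) := by fun_prop
  induction m with
  | zero => simp [convPow, lintegral_dirac' _ hl]
  | succ m ih =>
    rw [convPow, Measure.lintegral_conv hl]
    simp_rw [map_add, eexp_add]
    simp_rw [lintegral_const_mul _ hl]
    rw [lintegral_mul_const _ hl, ih, pow_succ]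

lemma map_sum_pi {Z : Type*} [MeasurableSpace Z] (γ : Measure Z) [IsProbabilityMeasure γ]
    {f : Z → E} (hf : Measurable f) (m : ℕ) :
    (Measure.pi fun _ : Fin m => γ).map (fun z => ∑ i, f (z i)) = convPow (γ.map f) m := by
  have := Measure.isProbabilityMeasure_map (μ := γ) hf.aemeasurable
  induction m with
  | zero => 
    rw [convPow]
    simp only [Finset.univ_eq_empty, Finset.sum_empty]
    simp
  | succ m ih =>
    have hS : Measurable fun z : Fin m → Z => ∑ i, f (z i) :=
      Finset.measurable_sum _ fun i _ => hf.comp (measurable_pi_apply i)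
    have hmp := measurePreserving_piFinSuccAbove (fun _ : Fin (m + 1) => γ) (Fin.last m)
    rw [convPow, ← ih, Measure.conv_comm, Measure.conv, Measure.map_prod_map _ _ hf hS,
      Measure.map_map measurable_add (hf.prodMap hS)]
    refine Eq.trans ?_ (congrArg _ hmp.map_eq)
    rw [Measure.map_map (measurable_add.comp (hf.prodMap hS)) hmp.measurable]
    congr 1
    ext z
    simp [Fin.sum_univ_castSucc, MeasurableEquiv.piFinSuccAbove, add_comm, Fin.init]

/-! ### Cramér's lower bound -/

variable [NormedSpace ℝ E]

/-- If each of `q` successive blocks of length `k` has its mean within `r` of `x`, then so does the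
whole sample. -/
lemma pow_le_convPow (μ : Measure E) [IsFiniteMeasure μ] (x : E) (r : ℝ) (k q : ℕ) :
    convPow μ k (Metric.closedBall ((k : ℝ) • x) (k * r)) ^ q ≤
      convPow μ (q * k) (Metric.closedBall (((q * k : ℕ) : ℝ) • x) ((q * k : ℕ) * r)) := by
  induction q with
  | zero => simp [convPow]
  | succ q ih =>
    rw [pow_succ, add_mul, one_mul, convPow_add]
    refine (mul_le_mul_left ih _).trans
      (mul_le_conv _ _ Metric.isClosed_closedBall.measurableSet ?_)
    intro a ha b hb
    rw [mem_closedBall_iff_norm] at *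
    calc ‖a + b - ((q * k + k : ℕ) : ℝ) • x‖
        = ‖(a - ((q * k : ℕ) : ℝ) • x) + (b - (k : ℝ) • x)‖ := by
          congr 1; push_cast; module
      _ ≤ ((q * k : ℕ) : ℝ) * r + k * r := (norm_add_le _ _).trans (add_le_add ha hb)
      _ = _ := by push_cast; ring

/-- The set of pairs `(x, a)` such that the mean of `m` independent copies is close to `x` with
probability at least about `exp (-m a)` for some `m ≥ 1`. -/
def entropyEpigraph (μ : Measure E) : Set (E × ℝ) :=
  {p | ∀ δ > 0, ∀ a > p.2, ∃ m : ℕ, 1 ≤ m ∧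
    eexp (-(m * a)) ≤ convPow μ m (Metric.closedBall ((m : ℝ) • p.1) (m * δ))}

/-- Finitely many probability measures are jointly tight, so one radius serves all remainders of a
division by `k`. Any constant below 1 would do in place of `eexp (-1)`. -/
lemma exists_half_le_convPow (μ : Measure E) [IsProbabilityMeasure μ] (k : ℕ) :
    ∃ R : ℝ, 0 ≤ R ∧ ∀ r < k, eexp (-1) ≤ convPow μ r (Metric.closedBall 0 R) := by
  have h (r : ℕ) : ∀ᶠ n : ℕ in atTop, eexp (-1) ≤ convPow μ r (Metric.closedBall 0 (n : ℝ)) := by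
    have ht := tendsto_measure_iUnion_atTop (μ := convPow μ r)
      (s := fun n : ℕ => Metric.closedBall (0 : E) (n : ℝ))
      (fun a b hab => Metric.closedBall_subset_closedBall (by exact_mod_cast hab))
    rw [Metric.iUnion_closedBall_nat, measure_univ] at ht
    refine (ht.eventually (lt_mem_nhds ?_)).mono fun _ h => h.le
    rw [← eexp_zero, eexp_lt]
    norm_num
  obtain ⟨n, hn⟩ := ((Filter.eventually_all_finset (Finset.range k)).2 fun r _ => h r).exists
  exact ⟨n, n.cast_nonneg, fun r hr => hn r (Finset.mem_range.2 hr)⟩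

/-- A single good sample size `k` produces all large ones: write m = qk + r, use `q` good blocks,
and let the remaining `r` steps stay in a fixed ball at the price of a bounded factor. -/
lemma eventually_of_mem_entropyEpigraph {μ : Measure E} [IsProbabilityMeasure μ] {x : E} {a₀ : ℝ}
    (h : (x, a₀) ∈ entropyEpigraph μ) {δ a : ℝ} (hδ : 0 < δ) (ha : a₀ < a) :
    ∀ᶠ m : ℕ in atTop,
      eexp (-(m * a)) ≤ convPow μ m (Metric.closedBall ((m : ℝ) • x) (m * δ)) := by
  obtain ⟨b, hab, hba⟩ := exists_between ha
  obtain ⟨k, hk, hp⟩ := h (δ / 2) (by positivity) b hab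
  obtain ⟨R, hR, hRk⟩ := exists_half_le_convPow μ k
  -- `h1` fits the displacement due to the remainder into m δ/2. `h2` pays for the factor `eexp
  -- (-1)` and for r|b| ≤ k|b| out of m(a - b).
  have h1 : ∀ᶠ m : ℕ in atTop, (R + k * ‖x‖) / (δ / 2) ≤ m :=
    tendsto_natCast_atTop_atTop.eventually_ge_atTop _
  have h2 : ∀ᶠ m : ℕ in atTop, (1 + k * |b|) / (a - b) ≤ m :=
    tendsto_natCast_atTop_atTop.eventually_ge_atTop _
  filter_upwards [h1, h2] with m h1 h2
  rw [div_le_iff₀ (by positivity)] at h1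
  rw [div_le_iff₀ (by linarith)] at h2
  set q := m / k
  set r := m % k
  have hm : q * k + r = m := Nat.div_add_mod' m k
  have hr : r < k := Nat.mod_lt _ hk
  have hmR : (q * k : ℝ) + r = m := by exact_mod_cast hm
  have hrk : (r : ℝ) ≤ k := by exact_mod_cast hr.le
  have hr0 : (0 : ℝ) ≤ r := r.cast_nonneg
  calc eexp (-(m * a)) ≤ eexp (q * -(k * b) + -1) := by
        rw [eexp_le]
        have : r * -b ≤ k * |b| := by
          calc r * -b ≤ r * |b| := by gcongr; exact neg_le_abs b
            _ ≤ k * |b| := by gcongr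
        have hb : (m : ℝ) * b = q * (k * b) + r * b := by rw [← hmR]; ring
        linarith
    _ = eexp (-(k * b)) ^ q * eexp (-1) := by rw [eexp_add, eexp_nat_mul]
    _ ≤ convPow μ (q * k) (Metric.closedBall (((q * k : ℕ) : ℝ) • x) ((q * k : ℕ) * (δ / 2))) *
        convPow μ r (Metric.closedBall 0 R) :=
        mul_le_mul' ((pow_le_pow_left' hp q).trans (pow_le_convPow μ x _ k q)) (hRk r hr)
    _ ≤ convPow μ (q * k + r) (Metric.closedBall ((m : ℝ) • x) (m * δ)) := by
        rw [convPow_add]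
        refine mul_le_conv _ _ Metric.isClosed_closedBall.measurableSet fun s hs t ht => ?_
        rw [mem_closedBall_iff_norm] at *
        rw [sub_zero] at ht
        calc ‖s + t - (m : ℝ) • x‖ = ‖(s - ((q * k : ℕ) : ℝ) • x) + t - (r : ℝ) • x‖ := by
              congr 1; rw [← hmR]; push_cast; module
          _ ≤ ‖s - ((q * k : ℕ) : ℝ) • x‖ + ‖t‖ + ‖(r : ℝ) • x‖ :=
              (norm_sub_le _ _).trans (add_le_add_left (norm_add_le _ _) _)
          _ ≤ ((q * k : ℕ) : ℝ) * (δ / 2) + R + k * ‖x‖ := by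
              gcongr
              rw [norm_smul, Real.norm_natCast]
              gcongr
          _ ≤ m * δ := by
              have : ((q * k : ℕ) : ℝ) * (δ / 2) ≤ m * (δ / 2) := by
                gcongr; linarith
              linarith
    _ = _ := by rw [hm]

lemma nonneg_of_mem_entropyEpigraph {μ : Measure E} [IsProbabilityMeasure μ] {x : E} {a : ℝ}
    (h : (x, a) ∈ entropyEpigraph μ) : 0 ≤ a := by
  refine le_of_forall_gt_imp_ge_of_dense fun b hb => ?_
  obtain ⟨m, hm, hp⟩ := h 1 one_pos b hb
  have := hp.trans prob_le_one
  rw [← eexp_zero, eexp_le] at this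
  have hm' : (1 : ℝ) ≤ m := by exact_mod_cast hm
  nlinarith

lemma mem_entropyEpigraph_mono {μ : Measure E} {x : E} {a b : ℝ}
    (h : (x, a) ∈ entropyEpigraph μ) (hab : a ≤ b) : (x, b) ∈ entropyEpigraph μ :=
  fun δ hδ c hc => h δ hδ c (lt_of_le_of_lt hab hc)

lemma isClosed_entropyEpigraph (μ : Measure E) : IsClosed (entropyEpigraph μ) := by
  refine isClosed_of_closure_subset fun p hp δ hδ a ha => ?_
  obtain ⟨q, hq, hpq⟩ := Metric.mem_closure_iff.1 hp (min (δ / 2) (a - p.2))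
    (lt_min (by positivity) (sub_pos.2 ha))
  rw [Prod.dist_eq, max_lt_iff, lt_min_iff, lt_min_iff, Real.dist_eq] at hpq
  obtain ⟨m, hm, h⟩ := hq (δ / 2) (by positivity) a (by linarith [abs_lt.1 hpq.2.2])
  refine ⟨m, hm, h.trans (measure_mono (Metric.closedBall_subset_closedBall' ?_))⟩
  rw [dist_smul₀, Real.norm_natCast, dist_comm]
  have : (m : ℝ) * dist p.1 q.1 ≤ m * (δ / 2) := by gcongr; exact hpq.1.1.le
  linarith

/-- Concatenate ⌊tN⌋ blocks with mean near `x` and N - ⌊tN⌋ blocks with mean near `y`. Rounding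
misplaces at most one block, which is harmless once `N` is large compared with ‖x - y‖ and |a - b|.
-/
lemma convex_entropyEpigraph (μ : Measure E) [IsProbabilityMeasure μ] :
    Convex ℝ (entropyEpigraph μ) := by
  rintro ⟨x, a⟩ hx ⟨y, b⟩ hy t s ht hs hts δ hδ c' hc'
  simp only [Prod.smul_mk, Prod.mk_add_mk, smul_eq_mul] at hc' ⊢
  obtain ⟨N, hN⟩ := exists_nat_ge (max 1 (max (‖x - y‖ / (δ / 2))
    (|a - b| / ((c' - (t * a + s * b)) / 2))))
  set ε := c' - (t * a + s * b) with hε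
  have hε0 : 0 < ε := by linarith
  rw [max_le_iff, max_le_iff, div_le_iff₀ (by positivity), div_le_iff₀ (by positivity)] at hN
  obtain ⟨hN1, hN2, hN3⟩ := hN
  obtain ⟨m, ⟨hmx, hmy⟩, hm⟩ := (((eventually_of_mem_entropyEpigraph hx (half_pos hδ)
    (show a < a + ε / 2 by linarith)).and (eventually_of_mem_entropyEpigraph hy (half_pos hδ)
    (show b < b + ε / 2 by linarith))).and (eventually_ge_atTop 1)).exists
  set p := ⌊t * N⌋₊
  have htN : 0 ≤ t * N := by positivity
  have hp1 : (p : ℝ) ≤ t * N := Nat.floor_le htN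
  have hp2 : t * N < p + 1 := Nat.lt_floor_add_one _
  have hpN : p ≤ N := by
    have : (p : ℝ) ≤ N := hp1.trans (by nlinarith)
    exact_mod_cast this
  obtain ⟨q, hq⟩ := Nat.exists_eq_add_of_le hpN
  have hqR : (N : ℝ) = p + q := by exact_mod_cast hq
  have hs' : s = 1 - t := by linarith
  have habs : |(p : ℝ) - t * N| ≤ 1 := by rw [abs_le]; constructor <;> linarith
  refine ⟨p * m + q * m, ?_, ?_⟩
  · have : 1 ≤ N := by exact_mod_cast hN1
    calc 1 ≤ N * m := Nat.mul_pos this hm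
      _ = _ := by rw [hq, add_mul]
  have key : eexp (-(m * (a + ε / 2))) ^ p * eexp (-(m * (b + ε / 2))) ^ q ≤
      convPow μ (p * m) (Metric.closedBall (((p * m : ℕ) : ℝ) • x) ((p * m : ℕ) * (δ / 2))) *
      convPow μ (q * m) (Metric.closedBall (((q * m : ℕ) : ℝ) • y) ((q * m : ℕ) * (δ / 2))) :=
    mul_le_mul' ((pow_le_pow_left' hmx p).trans (pow_le_convPow μ x _ m p))
      ((pow_le_pow_left' hmy q).trans (pow_le_convPow μ y _ m q))
  refine le_trans ?_ (key.trans ?_)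
  · rw [← eexp_nat_mul, ← eexp_nat_mul, ← eexp_add, eexp_le]
    have h1 : ((p : ℝ) - t * N) * (a - b) ≤ N * (ε / 2) :=
      calc ((p : ℝ) - t * N) * (a - b) ≤ |(p : ℝ) - t * N| * |a - b| := by
            rw [← abs_mul]; exact le_abs_self _
        _ ≤ 1 * |a - b| := by gcongr
        _ ≤ _ := by rw [one_mul]; exact hN3
    have h2 : (p : ℝ) * a + q * b + N * (ε / 2) ≤ N * c' := by
      have hc : c' = t * a + s * b + ε := by rw [hε]; ring
      rw [hc, hs']
      have : (q : ℝ) = N - p := by linarith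
      rw [this]
      linarith
    have h3 := mul_le_mul_of_nonneg_left h2 (Nat.cast_nonneg (α := ℝ) m)
    rw [hqR] at h3
    push_cast
    linarith
  · rw [convPow_add]
    refine mul_le_conv _ _ Metric.isClosed_closedBall.measurableSet fun u hu v hv => ?_
    rw [mem_closedBall_iff_norm] at *
    calc ‖u + v - ((p * m + q * m : ℕ) : ℝ) • (t • x + s • y)‖
        = ‖(u - ((p * m : ℕ) : ℝ) • x) + (v - ((q * m : ℕ) : ℝ) • y) +
            ((m : ℝ) * ((p : ℝ) - t * N)) • (x - y)‖ := by
          congr 1; rw [hs', hqR]; push_cast; module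
      _ ≤ ((p * m : ℕ) : ℝ) * (δ / 2) + ((q * m : ℕ) : ℝ) * (δ / 2) +
            m * |(p : ℝ) - t * N| * ‖x - y‖ := by
          refine (norm_add_le _ _).trans (add_le_add ((norm_add_le _ _).trans
            (add_le_add hu hv)) ?_)
          rw [norm_smul, norm_mul, Real.norm_natCast, Real.norm_eq_abs]
      _ ≤ ((p * m : ℕ) : ℝ) * (δ / 2) + ((q * m : ℕ) : ℝ) * (δ / 2) +
            m * 1 * (N * (δ / 2)) := by gcongr
      _ = _ := by rw [hqR]; push_cast; ring

end ConvPow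

/-! ### Convex duality between entropy and the moment generating function -/

lemma ENNReal.le_of_forall_pow_le_mul {x y c : ENNReal} (hy0 : y ≠ 0) (hy : y ≠ ⊤) (hc : c ≠ ⊤)
    (h : ∀ m : ℕ, 1 ≤ m → x ^ m ≤ c * y ^ m) : x ≤ y := by
  by_contra! hlt
  have h1 : 1 < x / y := by
    rwa [ENNReal.lt_div_iff_mul_lt (.inl hy0) (.inl hy), one_mul]
  have ht := ENNReal.tendsto_pow_atTop_nhds_top_iff.2 h1
  obtain ⟨m, hm, hm1⟩ :=
    ((ht.eventually (lt_mem_nhds hc.lt_top)).and (eventually_ge_atTop 1)).exists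
  have hym : y ^ m ≠ 0 := pow_ne_zero _ hy0
  have hym' : y ^ m ≠ ⊤ := ENNReal.pow_ne_top hy
  refine absurd (h m hm1) (not_le.2 ?_)
  rw [ENNReal.div_eq_inv_mul, mul_pow, ← ENNReal.inv_pow, ← ENNReal.div_eq_inv_mul] at hm
  rwa [ENNReal.lt_div_iff_mul_lt (.inl hym) (.inl hym')] at hm

section Cramer

variable {E : Type*} [NormedAddCommGroup E] [MeasurableSpace E] [BorelSpace E]
  [NormedSpace ℝ E] [FiniteDimensional ℝ E] [SecondCountableTopology E]

/-- The m-th power of the integral is an integral against the m-th convolution power, which lives on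
the ball of radius mR. Finitely many balls, in number independent of `m`, cover the rescaled ball,
and on each the exponential gain of `l` is offset by the decay forced by `h`. Taking m-th roots
removes the number of balls. -/
lemma lintegral_eexp_restrict_le {μ : Measure E} [IsProbabilityMeasure μ] {l : E →L[ℝ] ℝ} {u : ℝ}
    (h : ∀ p ∈ entropyEpigraph μ, l p.1 - p.2 ≤ u) (R : ℝ) {ε : ℝ} (hε : 0 < ε) :
    ∫⁻ s, eexp (l s) ∂(μ.restrict (Metric.closedBall 0 R)) ≤ eexp (u + 2 * ε) := by
  have : ProperSpace E := FiniteDimensional.proper ℝ E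
  have hy (y : E) : ∃ δ > 0, ‖l‖ * δ ≤ ε ∧ ∀ m : ℕ, 1 ≤ m →
      convPow μ m (Metric.closedBall ((m : ℝ) • y) (m * δ)) ≤ eexp (-(m * (l y - u - ε))) := by
    -- At this height `l y` minus the second coordinate is u + ε, which exceeds the supremum allowed
    -- by `h`.
    have hn : (y, l y - u - ε) ∉ entropyEpigraph μ := fun hmem => by
      have := h _ hmem
      simp only at this
      linarith
    simp only [entropyEpigraph, Set.mem_ofPred_eq] at hn
    push Not at hn
    obtain ⟨δ, hδ, a, ha, hm⟩ := hn
    refine ⟨min δ (ε / (‖l‖ + 1)), lt_min hδ (by positivity), ?_, fun m hm1 => ?_⟩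
    · calc ‖l‖ * min δ (ε / (‖l‖ + 1)) ≤ (‖l‖ + 1) * (ε / (‖l‖ + 1)) := by
            gcongr
            · linarith
            · exact min_le_right _ _
        _ = ε := by field_simp
    · refine (measure_mono (Metric.closedBall_subset_closedBall ?_)).trans
        ((hm m hm1).le.trans ?_)
      · gcongr
        exact min_le_left _ _
      · rw [eexp_le]
        gcongr
  choose δ hδ hlδ hm using hy
  obtain ⟨t, ht, hcov⟩ := (isCompact_closedBall (0 : E) R).elim_nhds_subcover
    (fun y => Metric.closedBall y (δ y)) fun y _ => Metric.closedBall_mem_nhds y (hδ y)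
  set ν := μ.restrict (Metric.closedBall 0 R)
  have hν : ν (Metric.closedBall 0 R)ᶜ = 0 := by
    rw [Measure.restrict_apply Metric.isClosed_closedBall.measurableSet.compl]
    simp
  refine ENNReal.le_of_forall_pow_le_mul (c := t.card) (eexp_ne_zero _) (eexp_ne_top _)
    (ENNReal.natCast_ne_top _) fun m hm1 => ?_
  have hm0 : (0 : ℝ) < m := by exact_mod_cast hm1
  rw [← lintegral_eexp_convPow]
  have hae : ∀ᵐ s ∂(convPow ν m), s ∈ Metric.closedBall (0 : E) (m * R) :=
    measure_eq_zero_iff_ae_notMem.1 (convPow_apply_compl_closedBall hν m) |>.mono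
      fun s hs => not_not.1 hs
  calc ∫⁻ s, eexp (l s) ∂(convPow ν m)
      ≤ ∫⁻ s, ∑ y ∈ t, (Metric.closedBall ((m : ℝ) • y) (m * δ y)).indicator
          (fun _ => eexp (m * (l y + ε))) s ∂(convPow ν m) := by
        refine lintegral_mono_ae (hae.mono fun s hs => ?_)
        have hs' : (m : ℝ)⁻¹ • s ∈ Metric.closedBall (0 : E) R := by
          rw [mem_closedBall_zero_iff] at hs ⊢
          rw [norm_smul, norm_inv, Real.norm_natCast, inv_mul_le_iff₀ hm0]
          exact hs
        obtain ⟨y, hyt, hys⟩ := Set.mem_iUnion₂.1 (hcov hs')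
        rw [mem_closedBall_iff_norm] at hys
        have hsub : s - (m : ℝ) • y = (m : ℝ) • ((m : ℝ)⁻¹ • s - y) := by
          rw [smul_sub, smul_inv_smul₀ hm0.ne']
        have hmem : s ∈ Metric.closedBall ((m : ℝ) • y) (m * δ y) := by
          rw [mem_closedBall_iff_norm, hsub, norm_smul, Real.norm_natCast]
          gcongr
        refine le_trans ?_ (Finset.single_le_sum (f := fun y =>
          (Metric.closedBall ((m : ℝ) • y) (m * δ y)).indicator
          (fun _ => eexp (m * (l y + ε))) s) (fun _ _ => zero_le) hyt)
        simp only [Set.indicator_of_mem hmem, eexp_le]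
        have h1 : l s = m * l y + m * l ((m : ℝ)⁻¹ • s - y) := by
          have : s = (m : ℝ) • y + (m : ℝ) • ((m : ℝ)⁻¹ • s - y) := by rw [← hsub]; abel
          conv_lhs => rw [this]
          simp
        have h2 : l ((m : ℝ)⁻¹ • s - y) ≤ ε :=
          (le_abs_self _).trans ((l.le_opNorm _).trans
            ((mul_le_mul_of_nonneg_left hys (norm_nonneg _)).trans (hlδ y)))
        rw [h1, mul_add]
        gcongr
    _ = ∑ y ∈ t, eexp (m * (l y + ε)) *
          convPow ν m (Metric.closedBall ((m : ℝ) • y) (m * δ y)) := by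
        rw [lintegral_finsetSum]
        · refine Finset.sum_congr rfl fun y _ => ?_
          rw [lintegral_indicator_const Metric.isClosed_closedBall.measurableSet]
        · exact fun y _ => measurable_const.indicator Metric.isClosed_closedBall.measurableSet
    _ ≤ ∑ y ∈ t, eexp (m * (u + 2 * ε)) := by
        refine Finset.sum_le_sum fun y _ => ?_
        refine (mul_le_mul_right ((convPow_mono Measure.restrict_le_self m _).trans
          (hm y m hm1)) _).trans ?_
        rw [← eexp_add, eexp_le]
        apply le_of_eq
        ring
    _ = _ := by rw [Finset.sum_const, nsmul_eq_mul, eexp_nat_mul]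

/-- The truncation to balls is removed by monotone convergence; the bound on each ball does not
depend on its radius. -/
lemma lintegral_eexp_le_of_entropyEpigraph {μ : Measure E} [IsProbabilityMeasure μ]
    {l : E →L[ℝ] ℝ} {u : ℝ} (h : ∀ p ∈ entropyEpigraph μ, l p.1 - p.2 ≤ u) :
    ∫⁻ s, eexp (l s) ∂μ ≤ eexp u := by
  have h1 (n : ℕ) : ∫⁻ s, eexp (l s) ∂(μ.restrict (Metric.closedBall 0 n)) ≤ eexp u := by
    have ht : Tendsto (fun ε : ℝ => eexp (u + 2 * ε)) (𝓝[>] 0) (𝓝 (eexp u)) := by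
      have : Continuous fun ε : ℝ => eexp (u + 2 * ε) := continuous_eexp.comp (by fun_prop)
      simpa using (this.tendsto 0).mono_left nhdsWithin_le_nhds
    exact ge_of_tendsto ht (eventually_mem_nhdsWithin.mono fun ε hε =>
      lintegral_eexp_restrict_le h n hε)
  have hl : Measurable fun s => eexp (l s) := by fun_prop
  have h2 := tendsto_measure_iUnion_atTop (μ := μ.withDensity fun s => eexp (l s))
    (s := fun n : ℕ => Metric.closedBall (0 : E) (n : ℝ))
    (fun a b hab => Metric.closedBall_subset_closedBall (by exact_mod_cast hab))
  rw [Metric.iUnion_closedBall_nat, withDensity_apply _ MeasurableSet.univ,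
    Measure.restrict_univ] at h2
  refine le_of_tendsto' h2 fun n => ?_
  rw [Function.comp, withDensity_apply _ Metric.isClosed_closedBall.measurableSet]
  exact h1 n

/-- The Legendre transform of the logarithmic moment generating function bounds the entropy. -/
lemma mem_entropyEpigraph {μ : Measure E} [IsProbabilityMeasure μ] {x : E} {a : ℝ}
    (h : ∀ l : E →L[ℝ] ℝ, eexp (l x - a) ≤ ∫⁻ s, eexp (l s) ∂μ) :
    (x, a) ∈ entropyEpigraph μ := by
  by_contra hn
  -- The separating functional has the form (y, b) ↦ l y + b s; the argument splits according to the
  -- sign of the slope `s`.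
  obtain ⟨f, u, hfu, hux⟩ := geometric_hahn_banach_closed_point (convex_entropyEpigraph μ)
    (isClosed_entropyEpigraph μ) hn
  set l : E →L[ℝ] ℝ := f.comp (ContinuousLinearMap.inl ℝ E ℝ) with hl
  set s : ℝ := f (0, 1) with hs
  have hf (y : E) (b : ℝ) : f (y, b) = l y + b * s := by
    have : (y, b) = (y, (0 : ℝ)) + b • ((0 : E), (1 : ℝ)) := by simp
    rw [this, map_add, map_smul, smul_eq_mul, hl, hs]
    simp
  simp only [Prod.forall, hf] at hfu hux
  -- Every bound by a functional of slope -1 that holds on the epigraph also holds at `(x, a)`: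
  -- combine `h` at `k • l` with the bound on the moment generating function.
  have hcov : ∀ (k : ℝ) (v : ℝ),
      (∀ (y : E) (b : ℝ), (y, b) ∈ entropyEpigraph μ → k * l y - b ≤ v) → k * l x - a ≤ v := by
    intro k v hkv
    have h1 := (h (k • l)).trans (lintegral_eexp_le_of_entropyEpigraph
      (l := k • l) (u := v) fun p hp => by simpa using hkv p.1 p.2 hp)
    rw [eexp_le] at h1
    simpa using h1
  -- Were the epigraph empty, `hcov` with k = 0 would apply vacuously to every `v`.
  have hne : ∃ p, p ∈ entropyEpigraph μ := by
    by_contra! hemp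
    have := hcov 0 (-a - 1) fun y b hb => absurd hb (hemp _)
    linarith
  obtain ⟨⟨y₀, b₀⟩, h₀⟩ := hne
  rcases lt_trichotomy s 0 with hs0 | hs0 | hs0
  -- Negative slope: dividing by -s normalizes the slope to -1, and `hcov` contradicts the
  -- separation.
  · have hs1 : s ≠ 0 := hs0.ne
    have h1 := hcov (-s)⁻¹ ((-s)⁻¹ * u) fun y b hb => by
      have := mul_le_mul_of_nonneg_left (hfu y b hb).le (inv_nonneg.2 (neg_pos.2 hs0).le)
      rw [mul_add] at this
      have h2 : (-s)⁻¹ * (b * s) = -b := by field_simp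
      linarith
    have h3 := mul_le_mul_of_nonneg_left h1 (neg_pos.2 hs0).le
    have h4 : -s * ((-s)⁻¹ * l x - a) = l x + a * s := by field_simp; ring
    have h5 : -s * ((-s)⁻¹ * u) = u := by field_simp
    linarith
  -- Vertical hyperplane: since b ≥ 0 on the epigraph, k l y - b ≤ k u for every natural `k`, and
  -- k(l x - u) outgrows `a`.
  · rw [hs0] at hfu hux
    have h1 (k : ℕ) : (k : ℝ) * (l x - u) ≤ a := by
      have := hcov k (k * u) fun y b hb => by
        have h2 := nonneg_of_mem_entropyEpigraph hb
        have h3 := mul_le_mul_of_nonneg_left (hfu y b hb).le (Nat.cast_nonneg (α := ℝ) k)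
        simp only [mul_zero, add_zero] at h3
        linarith
      linarith
    obtain ⟨k, hk⟩ := exists_nat_gt (a / (l x - u))
    rw [div_lt_iff₀ (by linarith)] at hk
    exact absurd (h1 k) (not_le.2 hk)
  -- Positive slope is impossible because the epigraph is unbounded upwards.
  · obtain ⟨c, hc⟩ := exists_gt (max b₀ ((u - l y₀) / s))
    rw [max_lt_iff, div_lt_iff₀ hs0] at hc
    have := hfu y₀ c (mem_entropyEpigraph_mono h₀ hc.1.le)
    linarith

/-- The lower bound in Cramér's theorem. -/
lemma cramer_lower_bound {Z : Type*} [MeasurableSpace Z] (γ : Measure Z) [IsProbabilityMeasure γ]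
    {f : Z → E} (hf : Measurable f) {x : E} {a₀ a : ℝ} (ha : a₀ < a)
    (h : ∀ l : E →L[ℝ] ℝ, eexp (l x - a₀) ≤ ∫⁻ z, eexp (l (f z)) ∂γ) {δ : ℝ} (hδ : 0 < δ) :
    ∀ᶠ m : ℕ in atTop, eexp (-(m * a)) ≤
      (Measure.pi fun _ : Fin m => γ) {z | ‖(m : ℝ)⁻¹ • ∑ i, f (z i) - x‖ ≤ δ} := by
  have := Measure.isProbabilityMeasure_map (μ := γ) hf.aemeasurable
  have hmem : (x, a₀) ∈ entropyEpigraph (γ.map f) := mem_entropyEpigraph fun l => by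
    rw [lintegral_map (by fun_prop) hf]
    exact h l
  filter_upwards [eventually_of_mem_entropyEpigraph hmem hδ ha, eventually_ge_atTop 1] with m hm hm1
  have hm0 : (0 : ℝ) < m := by exact_mod_cast hm1
  refine hm.trans (le_of_eq ?_)
  have hS : Measurable fun z : Fin m → Z => ∑ i, f (z i) :=
    Finset.measurable_sum _ fun i _ => hf.comp (measurable_pi_apply i)
  rw [← map_sum_pi γ hf, Measure.map_apply hS
    Metric.isClosed_closedBall.measurableSet]
  congr 1
  ext z
  have hsub : ∑ i, f (z i) - (m : ℝ) • x = (m : ℝ) • ((m : ℝ)⁻¹ • ∑ i, f (z i) - x) := by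
    rw [smul_sub, smul_inv_smul₀ hm0.ne']
  rw [Set.mem_preimage, mem_closedBall_iff_norm, hsub, norm_smul, Real.norm_natCast,
    mul_le_mul_iff_right₀ hm0]
  rfl

end Cramer

/-! ### Locally uniform Cramér estimates -/

/-- Absorbs the number of sets in a union bound, or a bounded normalizing constant, at the cost of
an arbitrarily small loss in the rate. -/
lemma eventually_const_mul_eexp_le {c : ENNReal} (hc : c ≠ ⊤) {a b : ℝ} (hab : a < b) :
    ∀ᶠ n : ℕ in atTop, c * eexp (-(n * b)) ≤ eexp (-(n * a)) := by
  have h1 : ∀ᶠ n : ℕ in atTop, Real.log (max 1 c.toReal) / (b - a) ≤ n :=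
    tendsto_natCast_atTop_atTop.eventually_ge_atTop _
  filter_upwards [h1] with n hn
  rw [div_le_iff₀ (by linarith)] at hn
  have hm : 0 < max 1 c.toReal := lt_max_of_lt_left one_pos
  calc c * eexp (-(n * b)) ≤ eexp (Real.log (max 1 c.toReal)) * eexp (-(n * b)) := by
        gcongr
        rw [eexp, Real.exp_log hm, ← ENNReal.ofReal_toReal hc]
        exact ENNReal.ofReal_le_ofReal (by simp)
    _ ≤ eexp (-(n * a)) := by
        rw [← eexp_add, eexp_le]
        linarith

lemma exists_eexp_eq {c : ENNReal} (h0 : c ≠ 0) (h1 : c ≠ ⊤) : ∃ a : ℝ, eexp a = c :=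
  ⟨Real.log c.toReal, by rw [eexp, Real.exp_log (ENNReal.toReal_pos h0 h1), ENNReal.ofReal_toReal h1]⟩

section Chernoff

variable {Z : Type*} [MeasurableSpace Z] (γ : Measure Z) [IsProbabilityMeasure γ]

lemma chernoff {g : Z → ℝ} (hg : Measurable g) {b : ℝ} (h : ∫⁻ z, eexp (g z) ∂γ ≤ eexp b)
    (m : ℕ) (s : ℝ) :
    (Measure.pi fun _ : Fin m => γ) {z | m * s ≤ ∑ i, g (z i)} ≤ eexp (-(m * (s - b))) := by
  have hS : Measurable fun z : Fin m → Z => ∑ i, g (z i) :=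
    Finset.measurable_sum _ fun i _ => hg.comp (measurable_pi_apply i)
  have := Measure.isProbabilityMeasure_map (μ := γ) hg.aemeasurable
  have h1 : ∫⁻ z, eexp (∑ i, g (z i)) ∂(Measure.pi fun _ : Fin m => γ) ≤ eexp (m * b) := by
    have h2 := lintegral_eexp_convPow (γ.map g) (ContinuousLinearMap.id ℝ ℝ) m
    rw [← map_sum_pi γ hg, lintegral_map (by fun_prop) hS, lintegral_map (by fun_prop) hg] at h2
    simp only [ContinuousLinearMap.coe_id', id_eq] at h2
    rw [h2, eexp_nat_mul]
    exact pow_le_pow_left' h m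
  calc (Measure.pi fun _ : Fin m => γ) {z | m * s ≤ ∑ i, g (z i)}
      = (Measure.pi fun _ : Fin m => γ) {z | eexp (m * s) ≤ eexp (∑ i, g (z i))} := by
        simp only [eexp_le]
    _ ≤ (∫⁻ z, eexp (∑ i, g (z i)) ∂(Measure.pi fun _ : Fin m => γ)) / eexp (m * s) :=
        meas_ge_le_lintegral_div hS.eexp.aemeasurable (eexp_ne_zero _) (eexp_ne_top _)
    _ ≤ eexp (m * b) / eexp (m * s) := by gcongr
    _ = eexp (-(m * (s - b))) := by
        symm
        rw [ENNReal.eq_div_iff (eexp_ne_zero _) (eexp_ne_top _), ← eexp_add]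
        congr 1
        ring

/-- Hölder's inequality against the constant 1. Shrinking the exponent makes the bound on the
logarithmic moment as small as desired. -/
lemma lintegral_eexp_mul_le {w : Z → ℝ} (hw : Measurable w) {θ M : ℝ}
    (hM : ∫⁻ z, eexp (θ * w z) ∂γ ≤ eexp M) {κ : ℝ} (h0 : 0 ≤ κ) (h1 : κ ≤ 1) :
    ∫⁻ z, eexp (κ * (θ * w z)) ∂γ ≤ eexp (κ * M) := by
  have h := ENNReal.lintegral_mul_norm_pow_le (μ := γ) (f := fun z => eexp (θ * w z))
    (g := fun _ => 1) (by fun_prop) (by fun_prop) h0 (sub_nonneg.2 h1) (by ring)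
  simp only [ENNReal.one_rpow, mul_one, lintegral_const, measure_univ] at h
  simp_rw [eexp_rpow] at h
  calc ∫⁻ z, eexp (κ * (θ * w z)) ∂γ = ∫⁻ z, eexp (θ * w z * κ) ∂γ := by simp_rw [mul_comm κ]
    _ ≤ _ := h
    _ ≤ eexp M ^ κ := by gcongr
    _ = _ := by rw [eexp_rpow, mul_comm]

end Chernoff

section LocalCramer

variable {E : Type*} [NormedAddCommGroup E] [MeasurableSpace E] [BorelSpace E]
  [NormedSpace ℝ E] [FiniteDimensional ℝ E] [SecondCountableTopology E]
  {Z : Type*} [MeasurableSpace Z] {X : Type*} [TopologicalSpace X]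

/-- A family of `E`-valued random variables depending continuously on a parameter, uniformly with
respect to a weight that has an exponential moment. -/
structure ExpContinuousFamily (γ : Measure Z) (w : Z → ℝ) (H : X → Z → E) : Prop where
  measurable_weight : Measurable w
  exp_moment : ∃ θ > 0, ∃ M : ℝ, 0 ≤ M ∧ ∫⁻ z, eexp (θ * w z) ∂γ ≤ eexp M
  measurable : ∀ q, Measurable (H q)
  growth : ∀ q, ∃ c : ℝ, 0 ≤ c ∧ ∀ z, ‖H q z‖ ≤ c * w z
  continuous : ∀ q, ∀ η > 0, ∀ᶠ q' in 𝓝 q, ∀ z, ‖H q' z - H q z‖ ≤ η * w z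

namespace ExpContinuousFamily

variable {γ : Measure Z} [IsProbabilityMeasure γ] {w : Z → ℝ} {H : X → Z → E}
  (hH : ExpContinuousFamily γ w H)

include hH

/-- The moment generating function at `l` itself need not survive a perturbation, as `l` may lie on
the boundary of the domain of finiteness. Shrinking to `t l` leaves the Hölder exponent 1/(1 - t)
free for the perturbation, which the weight controls. -/
lemma eventually_lintegral_le (Q : X) (l : E →L[ℝ] ℝ) {b t ε : ℝ} (ht0 : 0 < t) (ht1 : t < 1)
    (hε : 0 < ε) (h : ∫⁻ z, eexp (l (H Q z)) ∂γ ≤ eexp b) :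
    ∀ᶠ q in 𝓝 Q, ∫⁻ z, eexp (t * l (H q z)) ∂γ ≤ eexp (t * b + ε) := by
  obtain ⟨θ, hθ, M, hM0, hM⟩ := hH.exp_moment
  have hw := hH.measurable_weight
  have hl (q : X) : Measurable fun z => l (H q z) := l.continuous.measurable.comp (hH.measurable q)
  have hs : 0 < 1 - t := by linarith
  -- `κ` makes the weight's contribution (1 - t)κM at most `ε`; `η` below is the size of
  -- perturbation that consumes exactly the exponent κθ.
  set κ := min 1 (ε / ((1 - t) * (M + 1))) with hκ
  have hκ0 : 0 < κ := by positivity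
  have hκ1 : κ ≤ 1 := min_le_left _ _
  have hκM : (1 - t) * (κ * M) ≤ ε := by
    calc (1 - t) * (κ * M) ≤ (1 - t) * (ε / ((1 - t) * (M + 1)) * (M + 1)) := by
          gcongr
          · exact min_le_right _ _
          · linarith
      _ = ε := by field_simp
  set η := κ * θ * (1 - t) / (t * (‖l‖ + 1)) with hη
  have hη0 : 0 < η := by positivity
  filter_upwards [hH.continuous Q η hη0] with q hq
  calc ∫⁻ z, eexp (t * l (H q z)) ∂γ
      ≤ ∫⁻ z, eexp (l (H Q z)) ^ t * eexp (κ * (θ * w z)) ^ (1 - t) ∂γ := by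
        refine lintegral_mono fun z => ?_
        simp only [eexp_rpow]
        rw [← eexp_add, eexp_le]
        have h1 : l (H q z) - l (H Q z) ≤ (‖l‖ + 1) * (η * w z) := by
          rw [← map_sub]
          refine (le_abs_self _).trans ((l.le_opNorm _).trans ?_)
          gcongr
          · linarith
          · exact hq z
        have h2 : t * ((‖l‖ + 1) * (η * w z)) = κ * (θ * w z) * (1 - t) := by
          rw [hη]
          field_simp
        have h3 := mul_le_mul_of_nonneg_left h1 ht0.le
        linarith
    _ ≤ (∫⁻ z, eexp (l (H Q z)) ∂γ) ^ t * (∫⁻ z, eexp (κ * (θ * w z)) ∂γ) ^ (1 - t) :=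
        ENNReal.lintegral_mul_norm_pow_le (hl Q).eexp.aemeasurable (by fun_prop) ht0.le hs.le
          (by ring)
    _ ≤ eexp b ^ t * eexp (κ * M) ^ (1 - t) := by
        gcongr
        exact lintegral_eexp_mul_le γ hw hM hκ0.le hκ1
    _ ≤ eexp (t * b + ε) := by
        rw [eexp_rpow, eexp_rpow, ← eexp_add, eexp_le]
        linarith

/-- Chernoff's bound with the functional `t l` for `t` just below 1, which is stable under changes
of the parameter. -/
lemma local_upper (Q : X) (x : E) {a : ℝ}
    (h : ∃ l : E →L[ℝ] ℝ, ∫⁻ z, eexp (l (H Q z)) ∂γ < eexp (l x - a)) :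
    ∃ δ > 0, ∀ᶠ q in 𝓝 Q, ∀ m : ℕ, (Measure.pi fun _ : Fin m => γ)
      {z | ‖(m : ℝ)⁻¹ • ∑ i, H q (z i) - x‖ ≤ δ} ≤ eexp (-(m * a)) := by
  obtain ⟨l, hl⟩ := h
  obtain ⟨c, hc1, hc2⟩ := exists_between hl
  obtain ⟨b, rfl⟩ := exists_eexp_eq (pos_of_gt hc1).ne' hc2.ne_top
  rw [eexp_lt] at hc2
  have ht : ∀ᶠ t : ℝ in 𝓝[<] 1, a < t * (l x - b) := by
    have : Tendsto (fun t : ℝ => t * (l x - b)) (𝓝 1) (𝓝 (1 * (l x - b))) :=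
      (continuous_id.mul continuous_const).tendsto 1
    refine (this.mono_left nhdsWithin_le_nhds).eventually (lt_mem_nhds ?_)
    linarith
  obtain ⟨t, hta, ht0, ht1⟩ := (ht.and (Ioo_mem_nhdsLT (zero_lt_one' ℝ))).exists
  -- The slack `g` is shared equally between the radius `δ` and the perturbation of the moment
  -- generating function.
  set g := t * (l x - b) - a with hg
  have hg0 : 0 < g := sub_pos.2 hta
  have hδ : ‖l‖ * (g / 2 / (‖l‖ + 1)) ≤ g / 2 := by
    calc ‖l‖ * (g / 2 / (‖l‖ + 1)) ≤ (‖l‖ + 1) * (g / 2 / (‖l‖ + 1)) := by gcongr; linarith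
      _ = g / 2 := by field_simp
  refine ⟨g / 2 / (‖l‖ + 1), by positivity, ?_⟩
  filter_upwards [hH.eventually_lintegral_le Q l ht0 ht1 (half_pos hg0) hc1.le] with q hq m
  have hm : Measurable fun z => t * l (H q z) :=
    (l.continuous.measurable.comp (hH.measurable q)).const_mul t
  rcases Nat.eq_zero_or_pos m with rfl | hm0
  · simpa using prob_le_one
  have hm0 : (0 : ℝ) < m := by exact_mod_cast hm0
  refine le_trans (measure_mono fun z hz => ?_)
    ((chernoff γ hm hq m (t * (l x) - g / 2)).trans ?_)
  · have hz : ‖(m : ℝ)⁻¹ • ∑ i, H q (z i) - x‖ ≤ g / 2 / (‖l‖ + 1) := hz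
    have h1 : l x - l ((m : ℝ)⁻¹ • ∑ i, H q (z i)) ≤ g / 2 := by
      rw [← map_sub]
      refine (le_abs_self _).trans ((l.le_opNorm _).trans ?_)
      rw [norm_sub_rev]
      exact (mul_le_mul_of_nonneg_left hz (norm_nonneg _)).trans hδ
    have h2 : m * l ((m : ℝ)⁻¹ • ∑ i, H q (z i)) = ∑ i, l (H q (z i)) := by
      rw [map_smul, map_sum, smul_eq_mul, mul_inv_cancel_left₀ hm0.ne']
    have h3 : t * l x - g / 2 ≤ t * l ((m : ℝ)⁻¹ • ∑ i, H q (z i)) := by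
      have := mul_le_mul_of_nonneg_left h1 ht0.le
      nlinarith
    show (m : ℝ) * (t * l x - g / 2) ≤ ∑ i, t * l (H q (z i))
    rw [← Finset.mul_sum, ← h2]
    calc (m : ℝ) * (t * l x - g / 2) ≤ m * (t * l ((m : ℝ)⁻¹ • ∑ i, H q (z i))) := by gcongr
      _ = _ := by ring
  · rw [eexp_le, neg_le_neg_iff]
    gcongr
    linarith

/-- Chernoff's bound at a threshold `B` so high that the rate B - M exceeds `A`. A small enough
multiple of the mean weight is thus negligible at any prescribed exponential rate. -/
lemma eventually_weight_le (A : ℝ) {δ : ℝ} (hδ : 0 < δ) :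
    ∃ η > 0, ∀ m : ℕ, (Measure.pi fun _ : Fin m => γ) {z | m * δ ≤ η * ∑ i, w (z i)} ≤
      eexp (-(m * A)) := by
  obtain ⟨θ, hθ, M, hM0, hM⟩ := hH.exp_moment
  have hw := hH.measurable_weight
  set B := |A| + M + 1
  have hB : 0 < B := by positivity
  refine ⟨θ * δ / B, by positivity, fun m => ?_⟩
  refine le_trans (measure_mono fun z hz => ?_)
    ((chernoff γ (g := fun z => θ * w z) (by fun_prop) hM m B).trans ?_)
  · have hz : m * δ ≤ θ * δ / B * ∑ i, w (z i) := hz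
    show m * B ≤ ∑ i, θ * w (z i)
    rw [← Finset.mul_sum]
    have h1 : θ * δ / B * ∑ i, w (z i) = (δ / B) * (θ * ∑ i, w (z i)) := by ring
    have h2 : m * δ = (δ / B) * (m * B) := by field_simp
    rw [h1, h2] at hz
    exact le_of_mul_le_mul_left hz (by positivity)
  · rw [eexp_le, neg_le_neg_iff]
    gcongr
    have := le_abs_self A
    simp only [B]
    linarith

/-- Cramér's bound at `Q` transfers to nearby `q` because the two sample means differ by more than
δ/2 only with probability at most exp(-m a), which is at most half of the probability exp(-m b)
available at `Q`. -/
lemma local_lower (Q : X) (x : E) {a₀ a : ℝ} (ha : a₀ < a)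
    (h : ∀ l : E →L[ℝ] ℝ, eexp (l x - a₀) ≤ ∫⁻ z, eexp (l (H Q z)) ∂γ) {δ : ℝ} (hδ : 0 < δ) :
    ∃ U ∈ 𝓝 Q, ∀ᶠ m : ℕ in atTop, ∀ q ∈ U, eexp (-(m * a)) ≤ (Measure.pi fun _ : Fin m => γ)
      {z | ‖(m : ℝ)⁻¹ • ∑ i, H q (z i) - x‖ ≤ δ} := by
  obtain ⟨b, hab, hba⟩ := exists_between ha
  obtain ⟨η, hη, hbad⟩ := hH.eventually_weight_le a (half_pos hδ)
  refine ⟨_, hH.continuous Q η hη, ?_⟩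
  filter_upwards [cramer_lower_bound γ (hH.measurable Q) hab h (half_pos hδ),
    eventually_const_mul_eexp_le (c := 2) (by simp) hba, eventually_ge_atTop 1]
    with m hm h2 hm1 q hq
  have hm0 : (0 : ℝ) < m := by exact_mod_cast hm1
  set ν := Measure.pi fun _ : Fin m => γ
  have hsub : {z : Fin m → Z | ‖(m : ℝ)⁻¹ • ∑ i, H Q (z i) - x‖ ≤ δ / 2} ⊆
      {z | ‖(m : ℝ)⁻¹ • ∑ i, H q (z i) - x‖ ≤ δ} ∪ {z | m * (δ / 2) ≤ η * ∑ i, w (z i)} := by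
    intro z hz
    by_contra hcon
    simp only [Set.mem_union, Set.mem_ofPred_eq, not_or, not_le] at hz hcon
    have h1 : ‖(m : ℝ)⁻¹ • ∑ i, H q (z i) - (m : ℝ)⁻¹ • ∑ i, H Q (z i)‖ ≤ δ / 2 := by
      rw [← smul_sub, ← Finset.sum_sub_distrib, norm_smul, norm_inv, Real.norm_natCast,
        inv_mul_le_iff₀ hm0]
      refine (norm_sum_le _ _).trans ((Finset.sum_le_sum fun i _ => hq (z i)).trans ?_)
      rw [← Finset.mul_sum]
      exact hcon.2.le
    have h3 := norm_sub_le_norm_sub_add_norm_sub ((m : ℝ)⁻¹ • ∑ i, H q (z i))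
      ((m : ℝ)⁻¹ • ∑ i, H Q (z i)) x
    linarith [hcon.1]
  have h3 := hm.trans ((measure_mono hsub).trans (measure_union_le _ _))
  have h4 : eexp (-(m * a)) + eexp (-(m * a)) ≤
      ν {z | ‖(m : ℝ)⁻¹ • ∑ i, H q (z i) - x‖ ≤ δ} + eexp (-(m * a)) := by
    rw [← two_mul]
    exact h2.trans (h3.trans (by gcongr; exact hbad m))
  exact (ENNReal.add_le_add_iff_right (eexp_ne_top _)).1 h4

lemma local_tight (Q : X) (a : ℝ) :
    ∃ r : ℝ, ∀ᶠ q in 𝓝 Q, ∀ m : ℕ, (Measure.pi fun _ : Fin m => γ)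
      {z | r < ‖(m : ℝ)⁻¹ • ∑ i, H q (z i)‖} ≤ eexp (-(m * a)) := by
  obtain ⟨η, hη, hbad⟩ := hH.eventually_weight_le a one_pos
  obtain ⟨c, hc, hcw⟩ := hH.growth Q
  refine ⟨(c + 1) / η, ?_⟩
  filter_upwards [hH.continuous Q 1 one_pos] with q hq m
  rcases Nat.eq_zero_or_pos m with rfl | hm0
  · simpa using prob_le_one
  have hm0 : (0 : ℝ) < m := by exact_mod_cast hm0
  refine le_trans (measure_mono fun z hz => ?_) (hbad m)
  have hz : (c + 1) / η < ‖(m : ℝ)⁻¹ • ∑ i, H q (z i)‖ := hz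
  have h1 : ‖∑ i, H q (z i)‖ ≤ (c + 1) * ∑ i, w (z i) := by
    rw [Finset.mul_sum]
    refine (norm_sum_le _ _).trans (Finset.sum_le_sum fun i _ => ?_)
    have := norm_le_norm_add_norm_sub' (H q (z i)) (H Q (z i))
    linarith [hq (z i), hcw (z i)]
  rw [norm_smul, norm_inv, Real.norm_natCast, lt_inv_mul_iff₀ hm0] at hz
  show (m : ℝ) * 1 ≤ η * ∑ i, w (z i)
  have h2 : (c + 1) * (m / η) ≤ (c + 1) * ∑ i, w (z i) :=
    (by rw [show (c + 1) * (m / η) = m * ((c + 1) / η) by ring]; exact hz.le.trans h1)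
  have h3 := le_of_mul_le_mul_left h2 (by linarith)
  rw [div_le_iff₀ hη] at h3
  linarith

end ExpContinuousFamily

end LocalCramer

/-! ### Local large deviation estimates -/

/-- Splits a real bound on a sum of two rates into real bounds on each, also when a rate is
infinite. Nonnegativity excludes ⊤ + ⊥ and lets -1 serve as a bound below the other summand. -/
lemma EReal.exists_le_add_of_lt_add {a : ℝ} {u v : EReal} (hu : 0 ≤ u) (hv : 0 ≤ v)
    (h : (a : EReal) < u + v) : ∃ b c : ℝ, (b : EReal) < u ∧ (c : EReal) < v ∧ a ≤ b + c := by
  have hneg : ((-1 : ℝ) : EReal) < 0 := by exact_mod_cast (by norm_num : (-1 : ℝ) < 0)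
  induction u with
  | bot => simp at hu
  | top => exact ⟨a + 1, -1, EReal.coe_lt_top _, hneg.trans_le hv, by linarith⟩
  | coe u =>
    induction v with
    | bot => simp at hv
    | top => exact ⟨-1, a + 1, hneg.trans_le hu, EReal.coe_lt_top _, by linarith⟩
    | coe v =>
      have h' : a < u + v := by exact_mod_cast h
      refine ⟨u - (u + v - a) / 2, v - (u + v - a) / 2, ?_, ?_, by linarith⟩ <;>
      · rw [EReal.coe_lt_coe_iff]; linarith

lemma EReal.exists_add_le_of_add_lt {a : ℝ} {u v : EReal} (hu : 0 ≤ u) (hv : 0 ≤ v)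
    (h : u + v < (a : EReal)) : ∃ b c : ℝ, u < (b : EReal) ∧ v < (c : EReal) ∧ b + c ≤ a := by
  induction u with
  | bot => simp at hu
  | top => rw [EReal.top_add_of_ne_bot (ne_bot_of_le_ne_bot (by simp) hv)] at h; simp at h
  | coe u =>
    induction v with
    | bot => simp at hv
    | top => simp at h
    | coe v =>
      have h' : u + v < a := by exact_mod_cast h
      refine ⟨u + (a - (u + v)) / 2, v + (a - (u + v)) / 2, ?_, ?_, by linarith⟩ <;>
      · rw [EReal.coe_lt_coe_iff]; linarith

/-- Local exponential bounds near every point, together with exponential tightness. -/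
structure LocalLDP {X : Type*} [TopologicalSpace X] [MeasurableSpace X]
    (μ : ℕ → Measure X) (I : X → EReal) : Prop where
  nonneg : ∀ x, 0 ≤ I x
  upper : ∀ x, ∀ a : ℝ, (a : EReal) < I x → ∃ U ∈ 𝓝 x, ∀ᶠ n : ℕ in atTop, μ n U ≤ eexp (-(n * a))
  lower : ∀ x, ∀ a : ℝ, I x < a → ∀ U ∈ 𝓝 x, ∀ᶠ n : ℕ in atTop, eexp (-(n * a)) ≤ μ n U
  tight : ∀ a : ℝ, ∃ K : Set X, IsCompact K ∧ ∀ᶠ n : ℕ in atTop, μ n Kᶜ ≤ eexp (-(n * a))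

lemma scaled_log_eexp {n : ℕ} (hn : 1 ≤ n) (a : ℝ) :
    (((n : ℝ)⁻¹ : ℝ) : EReal) * ENNReal.log (eexp (-(n * a))) = ((-a : ℝ) : EReal) := by
  have hn0 : (n : ℝ) ≠ 0 := by positivity
  rw [log_eexp, ← EReal.coe_mul]
  congr 1
  field_simp

lemma scaled_log_mono (n : ℕ) {u v : ENNReal} (h : u ≤ v) :
    (((n : ℝ)⁻¹ : ℝ) : EReal) * ENNReal.log u ≤ (((n : ℝ)⁻¹ : ℝ) : EReal) * ENNReal.log v :=
  mul_le_mul_of_nonneg_left (ENNReal.log_le_log h)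
    (by exact_mod_cast inv_nonneg.2 (Nat.cast_nonneg (α := ℝ) n))

namespace LocalLDP

variable {X : Type*} [TopologicalSpace X] [MeasurableSpace X] {μ : ℕ → Measure X} {I : X → EReal}

/-- The neighbourhood `U` from the upper bound at `x` is also a neighbourhood of every nearby `x'`;
a smaller rate at `x'` would make the lower bound on the mass of `U` exceed the upper one. -/
lemma lowerSemicontinuous (h : LocalLDP μ I) : LowerSemicontinuous I := by
  intro x y hy
  obtain ⟨a, hya, hax⟩ := EReal.exists_between_coe_real hy
  obtain ⟨b, hab, hbx⟩ := EReal.exists_between_coe_real hax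
  obtain ⟨U, hU, hUn⟩ := h.upper x b hbx
  filter_upwards [eventually_mem_nhds_iff.2 hU] with x' hx'
  by_contra! hcon
  have hlow := h.lower x' _ (hcon.trans_lt hya) U hx'
  obtain ⟨n, ⟨h1, h2⟩, hn⟩ := ((hlow.and hUn).and (eventually_ge_atTop 1)).exists
  have h3 := h1.trans h2
  rw [eexp_le] at h3
  have hn' : (1 : ℝ) ≤ n := by exact_mod_cast hn
  rw [EReal.coe_lt_coe_iff] at hab
  nlinarith

lemma satisfiesLDP (h : LocalLDP μ I) : SatisfiesLDP μ I where
  ne_bot x := ne_bot_of_le_ne_bot (by simp) (h.nonneg x)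
  lsc := h.lowerSemicontinuous
  lower O hO := by
    refine EReal.neg_le_of_neg_le ?_
    refine le_iInf₂ fun x hx => EReal.le_of_forall_lt_iff_le.1 fun a ha => ?_
    refine EReal.neg_le_of_neg_le ?_
    refine le_liminf_of_le (by isBoundedDefault) ?_
    filter_upwards [h.lower x a ha O (hO.mem_nhds hx), eventually_ge_atTop 1] with n hn hn1
    rw [← EReal.coe_neg, ← scaled_log_eexp hn1 a]
    exact scaled_log_mono n hn
  upper F hF := by
    refine EReal.le_neg_of_le_neg ?_
    refine EReal.ge_of_forall_gt_iff_ge.1 fun a ha => ?_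
    refine EReal.le_neg_of_le_neg ?_
    obtain ⟨a', haa', ha'⟩ := EReal.exists_between_coe_real ha
    rw [EReal.coe_lt_coe_iff] at haa'
    obtain ⟨K, hK, hKn⟩ := h.tight a'
    -- Outside `F` the whole space is a dummy value, so that `U` is defined everywhere; the cover
    -- only uses centres in `F`.
    have hup (x : X) : ∃ U ∈ 𝓝 x, x ∈ F → ∀ᶠ n : ℕ in atTop, μ n U ≤ eexp (-(n * a')) := by
      by_cases hx : x ∈ F
      · obtain ⟨U, hU, hUn⟩ := h.upper x a' (ha'.trans_le (iInf₂_le x hx))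
        exact ⟨U, hU, fun _ => hUn⟩
      · exact ⟨Set.univ, univ_mem, fun hx' => absurd hx' hx⟩
    choose U hU hUn using hup
    obtain ⟨t, htF, hcov⟩ := (hK.inter_right hF).elim_nhds_subcover U fun x _ => hU x
    refine limsup_le_of_le (by isBoundedDefault) ?_
    filter_upwards [hKn, (Filter.eventually_all_finset t).2 fun x hx => hUn x (htF x hx).2,
      eventually_const_mul_eexp_le (c := (t.card : ENNReal) + 1) (by finiteness) haa',
      eventually_ge_atTop 1] with n h1 h2 h3 hn1
    rw [← EReal.coe_neg, ← scaled_log_eexp hn1 a]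
    refine scaled_log_mono n (le_trans ?_ h3)
    calc μ n F ≤ μ n ((⋃ x ∈ t, U x) ∪ Kᶜ) := by
          refine measure_mono fun x hx => ?_
          by_cases hxK : x ∈ K
          · exact Or.inl (hcov ⟨hxK, hx⟩)
          · exact Or.inr hxK
      _ ≤ ∑ x ∈ t, μ n (U x) + μ n Kᶜ :=
          (measure_union_le _ _).trans (add_le_add_left (measure_biUnion_finset_le _ _) _)
      _ ≤ ∑ x ∈ t, eexp (-(n * a')) + eexp (-(n * a')) :=
          add_le_add (Finset.sum_le_sum h2) h1
      _ = _ := by rw [Finset.sum_const, nsmul_eq_mul, add_mul, one_mul]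

/-! ### Composition with a kernel -/

/-- Laplace's upper bound: on each set of a finite cover of `K` the rates of the measure and of the
integrand add up to at least `a`, and the complement of `K` is negligible. -/
lemma lintegral_le_of_cover [OpensMeasurableSpace X] [T2Space X] {K : Set X} (hK : IsCompact K)
    {a b : ℝ} (hba : b < a) (hKn : ∀ᶠ n : ℕ in atTop, μ n Kᶜ ≤ eexp (-(n * a)))
    {f : ℕ → X → ENNReal} (hf : ∀ n x, f n x ≤ 1) (t : Finset X) {U : X → Set X}
    (hU : ∀ x, IsOpen (U x)) (hcov : K ⊆ ⋃ x ∈ t, U x) {c d : X → ℝ}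
    (hcd : ∀ x ∈ t, a ≤ c x + d x)
    (hc : ∀ x ∈ t, ∀ᶠ n : ℕ in atTop, μ n (U x) ≤ eexp (-(n * c x)))
    (hd : ∀ x ∈ t, ∀ᶠ n : ℕ in atTop, ∀ x' ∈ U x, f n x' ≤ eexp (-(n * d x))) :
    ∀ᶠ n : ℕ in atTop, ∫⁻ x, f n x ∂μ n ≤ eexp (-(n * b)) := by
  filter_upwards [hKn, (Filter.eventually_all_finset t).2 hc, (Filter.eventually_all_finset t).2 hd,
    eventually_const_mul_eexp_le (c := (t.card : ENNReal) + 1) (by finiteness) hba]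
    with n h1 h2 h3 h4
  refine le_trans ?_ h4
  have hKm : MeasurableSet Kᶜ := hK.isClosed.measurableSet.compl
  calc ∫⁻ x, f n x ∂μ n
      ≤ ∫⁻ x, ∑ y ∈ t, (U y).indicator (fun _ => eexp (-(n * d y))) x +
          Kᶜ.indicator (fun _ => 1) x ∂μ n := by
        refine lintegral_mono fun x => ?_
        by_cases hx : x ∈ K
        · obtain ⟨y, hyt, hy⟩ := Set.mem_iUnion₂.1 (hcov hx)
          refine le_trans ?_ (le_add_of_nonneg_right zero_le)
          refine le_trans ?_ (Finset.single_le_sum (f := fun y =>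
            (U y).indicator (fun _ => eexp (-(n * d y))) x) (fun _ _ => zero_le) hyt)
          simp only [Set.indicator_of_mem hy]
          exact h3 y hyt x hy
        · refine le_trans ?_ (le_add_of_nonneg_left zero_le)
          rw [Set.indicator_of_mem (show x ∈ Kᶜ from hx)]
          exact hf n x
    _ = ∑ y ∈ t, eexp (-(n * d y)) * μ n (U y) + μ n Kᶜ := by
        rw [lintegral_add_right _ (measurable_const.indicator hKm), lintegral_finsetSum,
          lintegral_indicator_const hKm, one_mul]
        · congr 1
          exact Finset.sum_congr rfl fun y _ => lintegral_indicator_const (hU y).measurableSet _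
        · exact fun y _ => measurable_const.indicator (hU y).measurableSet
    _ ≤ ∑ y ∈ t, eexp (-(n * a)) + eexp (-(n * a)) := by
        refine add_le_add (Finset.sum_le_sum fun y hy => ?_) h1
        refine (mul_le_mul_right (h2 y hy) _).trans ?_
        rw [← eexp_add, eexp_le]
        have := mul_le_mul_of_nonneg_left (hcd y hy) (Nat.cast_nonneg (α := ℝ) n)
        linarith
    _ = _ := by rw [Finset.sum_const, nsmul_eq_mul, add_mul, one_mul]

variable {Y : Type*} [TopologicalSpace Y] [MeasurableSpace Y] {ν : ℕ → Measure Y}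
  {κ : ℕ → X → Measure Y} {J : X → Y → EReal} {I' : Y → EReal}

/-- The kernel bounds are uniform over neighbourhoods of the starting point, and exponential
tightness reduces to finitely many of these. The assumptions `hI1` and `hI2` together say that `I'`
is the infimum of I + J over the starting point. -/
lemma comp_kernel [OpensMeasurableSpace X] [T2Space X] [OpensMeasurableSpace Y] [T2Space Y]
    [∀ n, IsProbabilityMeasure (μ n)] [∀ n x, IsProbabilityMeasure (κ n x)] (h : LocalLDP μ I)
    (hν : ∀ n, ∀ V, MeasurableSet V → ν n V = ∫⁻ x, κ n x V ∂μ n)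
    (hJ : ∀ x y, 0 ≤ J x y)
    (hup : ∀ x y, ∀ a : ℝ, a < J x y → ∃ U ∈ 𝓝 x, ∃ V ∈ 𝓝 y, ∀ᶠ n : ℕ in atTop,
      ∀ x' ∈ U, κ n x' V ≤ eexp (-(n * a)))
    (hlow : ∀ x y, ∀ a : ℝ, J x y < a → ∀ V ∈ 𝓝 y, ∃ U ∈ 𝓝 x, ∀ᶠ n : ℕ in atTop,
      ∀ x' ∈ U, eexp (-(n * a)) ≤ κ n x' V)
    (htight : ∀ x, ∀ a : ℝ, ∃ U ∈ 𝓝 x, ∃ K, IsCompact K ∧ ∀ᶠ n : ℕ in atTop,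
      ∀ x' ∈ U, κ n x' Kᶜ ≤ eexp (-(n * a)))
    (hI0 : ∀ y, 0 ≤ I' y) (hI1 : ∀ x y, I' y ≤ I x + J x y)
    (hI2 : ∀ y, ∀ a : ℝ, I' y < a → ∃ x, I x + J x y < a) : LocalLDP ν I' where
  nonneg := hI0
  upper y a hay := by
    obtain ⟨a', haa', hay'⟩ := EReal.exists_between_coe_real hay
    rw [EReal.coe_lt_coe_iff] at haa'
    obtain ⟨K, hK, hKn⟩ := h.tight a'
    have hloc (x : X) : ∃ (U : Set X) (V : Set Y) (c d : ℝ), IsOpen U ∧ x ∈ U ∧ IsOpen V ∧ y ∈ V ∧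
        a' ≤ c + d ∧ (∀ᶠ n : ℕ in atTop, μ n U ≤ eexp (-(n * c))) ∧
        ∀ᶠ n : ℕ in atTop, ∀ x' ∈ U, κ n x' V ≤ eexp (-(n * d)) := by
      obtain ⟨c, d, hc, hd, hcd⟩ := EReal.exists_le_add_of_lt_add (h.nonneg x) (hJ x y)
        (hay'.trans_le (hI1 x y))
      obtain ⟨U₁, hU₁, hμ⟩ := h.upper x c hc
      obtain ⟨U₂, hU₂, V, hV, hκ⟩ := hup x y d hd
      obtain ⟨U, hUsub, hUo, hxU⟩ := mem_nhds_iff.1 (inter_mem hU₁ hU₂)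
      obtain ⟨W, hWsub, hWo, hyW⟩ := mem_nhds_iff.1 hV
      refine ⟨U, W, c, d, hUo, hxU, hWo, hyW, hcd, ?_, ?_⟩
      · exact hμ.mono fun n hn => (measure_mono fun z hz => (hUsub hz).1).trans hn
      · exact hκ.mono fun n hn x' hx' => (measure_mono hWsub).trans (hn x' (hUsub hx').2)
    choose U V c d hUo hxU hVo hyV hcd hμ hκ using hloc
    obtain ⟨t, -, hcov⟩ := hK.elim_nhds_subcover U fun x _ => (hUo x).mem_nhds (hxU x)
    -- The neighbourhood of `y` depends on the starting point; compactness in `X` makes a finite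
    -- intersection sufficient.
    have hVt : IsOpen (⋂ x ∈ t, V x) := isOpen_biInter_finset fun x _ => hVo x
    refine ⟨⋂ x ∈ t, V x, hVt.mem_nhds (Set.mem_iInter₂.2 fun x _ => hyV x), ?_⟩
    simp_rw [fun n => hν n _ hVt.measurableSet]
    refine lintegral_le_of_cover hK haa' hKn (fun n x => prob_le_one) t hUo hcov
      (fun x _ => hcd x) (fun x _ => hμ x) fun x hx => ?_
    exact (hκ x).mono fun n hn x' hx' =>
      (measure_mono (Set.biInter_subset_of_mem (s := (t : Set X)) hx)).trans (hn x' hx')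
  lower y a hya V hV := by
    obtain ⟨x, hx⟩ := hI2 y a hya
    obtain ⟨b, c, hb, hc, hbc⟩ := EReal.exists_add_le_of_add_lt (h.nonneg x) (hJ x y) hx
    obtain ⟨W, hWsub, hWo, hyW⟩ := mem_nhds_iff.1 hV
    obtain ⟨U', hU', hκ⟩ := hlow x y c hc W (hWo.mem_nhds hyW)
    obtain ⟨U, hUsub, hUo, hxU⟩ := mem_nhds_iff.1 hU'
    filter_upwards [h.lower x b hb U (hUo.mem_nhds hxU), hκ] with n hn hκn
    calc eexp (-(n * a)) ≤ eexp (-(n * c)) * eexp (-(n * b)) := by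
          rw [← eexp_add, eexp_le]
          have := mul_le_mul_of_nonneg_left hbc (Nat.cast_nonneg (α := ℝ) n)
          linarith
      _ ≤ eexp (-(n * c)) * μ n U := by gcongr
      _ = ∫⁻ _ in U, eexp (-(n * c)) ∂μ n := by rw [setLIntegral_const]
      _ ≤ ∫⁻ x in U, κ n x W ∂μ n :=
          setLIntegral_mono' hUo.measurableSet fun x' hx' => hκn x' (hUsub hx')
      _ ≤ ∫⁻ x, κ n x W ∂μ n := setLIntegral_le_lintegral _ _
      _ = ν n W := (hν n W hWo.measurableSet).symm
      _ ≤ ν n V := measure_mono hWsub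
  tight a := by
    obtain ⟨K, hK, hKn⟩ := h.tight (a + 1)
    have hloc (x : X) : ∃ (U : Set X) (L : Set Y), IsOpen U ∧ x ∈ U ∧ IsCompact L ∧
        ∀ᶠ n : ℕ in atTop, ∀ x' ∈ U, κ n x' Lᶜ ≤ eexp (-(n * (a + 1))) := by
      obtain ⟨U', hU', L, hL, hκ⟩ := htight x (a + 1)
      obtain ⟨U, hUsub, hUo, hxU⟩ := mem_nhds_iff.1 hU'
      exact ⟨U, L, hUo, hxU, hL, hκ.mono fun n hn x' hx' => hn x' (hUsub hx')⟩
    choose U L hUo hxU hL hκ using hloc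
    obtain ⟨t, -, hcov⟩ := hK.elim_nhds_subcover U fun x _ => (hUo x).mem_nhds (hxU x)
    have hLt : IsCompact (⋃ x ∈ t, L x) := t.isCompact_biUnion fun x _ => hL x
    refine ⟨_, hLt, ?_⟩
    simp_rw [fun n => hν n _ hLt.isClosed.measurableSet.compl]
    -- Here the kernel alone supplies the rate, so the trivial rate 0 is used for the measure.
    refine lintegral_le_of_cover hK (lt_add_one a) hKn (fun n x => prob_le_one) t hUo hcov
      (c := fun _ => 0) (d := fun _ => a + 1) (fun x _ => by simp)
      (fun x _ => Eventually.of_forall fun n => by simpa using prob_le_one) fun x hx => ?_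
    refine (hκ x).mono fun n hn x' hx' => (measure_mono ?_).trans (hn x' hx')
    exact Set.compl_subset_compl.2 (Set.subset_biUnion_of_mem (u := L) (Finset.mem_coe.2 hx))

/-! ### Change of measure -/

/-- On compact sets `ω n` and `μ n` are comparable with constants independent of `n`, and elsewhere
only ω ≤ μ is needed, thanks to tightness. -/
lemma tilt [OpensMeasurableSpace X] [T2Space X] [LocallyCompactSpace X]
    [∀ n, IsProbabilityMeasure (μ n)] (h : LocalLDP μ I) {ω : ℕ → Measure X} (hω : ∀ n, ω n ≤ μ n)
    (hlow : ∀ K, IsCompact K → ∃ c : ENNReal, c ≠ 0 ∧ c ≠ ⊤ ∧ ∀ n, ∀ V ⊆ K, MeasurableSet V →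
      c * μ n V ≤ ω n V) :
    LocalLDP (fun n => (ω n Set.univ)⁻¹ • ω n) I := by
  -- A compact set eventually carries at least half of `μ n`, so the total mass of `ω n` stays above
  -- c/2.
  have hZ : ∃ C : ENNReal, C ≠ ⊤ ∧ ∀ᶠ n in atTop, (ω n Set.univ)⁻¹ ≤ C := by
    obtain ⟨K, hK, hKn⟩ := h.tight 1
    obtain ⟨c, hc0, hc1, hc⟩ := hlow K hK
    refine ⟨(c * 2⁻¹)⁻¹, ENNReal.inv_ne_top.2 (mul_ne_zero hc0 (by simp)), ?_⟩
    filter_upwards [hKn, eventually_const_mul_eexp_le (c := 2) (by simp) one_pos] with n h1 h2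
    rw [mul_zero, neg_zero, eexp_zero, mul_comm, ← ENNReal.le_div_iff_mul_le (by simp) (by simp),
      one_div] at h2
    have h3 : (2 : ENNReal)⁻¹ ≤ μ n K := by
      have h4 : μ n Kᶜ ≤ 2⁻¹ := h1.trans h2
      have h5 : (1 : ENNReal) ≤ μ n K + μ n Kᶜ := by
        rw [← measure_univ (μ := μ n), ← Set.union_compl_self K]
        exact measure_union_le _ _
      rw [← ENNReal.inv_two_add_inv_two] at h5
      exact (ENNReal.add_le_add_iff_right (by simp)).1 (h5.trans (add_le_add_right h4 _))
    refine ENNReal.inv_le_inv.2 ?_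
    calc c * 2⁻¹ ≤ c * μ n K := by gcongr
      _ ≤ ω n K := hc n K le_rfl hK.isClosed.measurableSet
      _ ≤ _ := measure_mono (Set.subset_univ _)
  obtain ⟨C, hC, hCn⟩ := hZ
  have hupper {a b : ℝ} (hab : a < b) {U : Set X}
      (hU : ∀ᶠ n : ℕ in atTop, μ n U ≤ eexp (-(n * b))) :
      ∀ᶠ n : ℕ in atTop, ((ω n Set.univ)⁻¹ • ω n) U ≤ eexp (-(n * a)) := by
    filter_upwards [hU, hCn, eventually_const_mul_eexp_le hC hab] with n h1 h2 h3
    rw [Measure.smul_apply, smul_eq_mul]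
    exact (mul_le_mul' h2 ((hω n U).trans h1)).trans h3
  refine ⟨h.nonneg, fun x a ha => ?_, fun x a ha U hU => ?_, fun a => ?_⟩
  · obtain ⟨b, hab, hb⟩ := EReal.exists_between_coe_real ha
    obtain ⟨U, hU, hUn⟩ := h.upper x b hb
    exact ⟨U, hU, hupper (EReal.coe_lt_coe_iff.1 hab) hUn⟩
  · obtain ⟨b, hb, hba⟩ := EReal.exists_between_coe_real ha
    rw [EReal.coe_lt_coe_iff] at hba
    -- Local compactness allows shrinking to a neighbourhood inside a compact set, where `ω n` is
    -- comparable to `μ n`.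
    obtain ⟨K, hK, hKx⟩ := exists_compact_mem_nhds x
    obtain ⟨c, hc0, hc1, hc⟩ := hlow K hK
    obtain ⟨V, hVsub, hVo, hxV⟩ := mem_nhds_iff.1 (inter_mem hKx hU)
    have hcinv : c⁻¹ ≠ ⊤ := ENNReal.inv_ne_top.2 hc0
    filter_upwards [h.lower x b hb V (hVo.mem_nhds hxV), eventually_const_mul_eexp_le hcinv hba]
      with n h1 h2
    have hω1 : 1 ≤ (ω n Set.univ)⁻¹ := ENNReal.one_le_inv.2 ((hω n _).trans prob_le_one)
    have h3 : eexp (-(n * a)) ≤ c * μ n V := by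
      have h4 := h2.trans h1
      rwa [mul_comm c⁻¹, ← div_eq_mul_inv, ENNReal.div_le_iff_le_mul (.inl hc0)
        (.inl hc1), mul_comm _ c] at h4
    calc eexp (-(n * a)) ≤ ω n V := h3.trans (hc n V (fun z hz => (hVsub hz).1) hVo.measurableSet)
      _ ≤ 1 * ω n U := by rw [one_mul]; exact measure_mono fun z hz => (hVsub hz).2
      _ ≤ _ := by rw [Measure.smul_apply, smul_eq_mul]; gcongr
  · obtain ⟨K, hK, hKn⟩ := h.tight (a + 1)
    exact ⟨K, hK, hupper (lt_add_one a) hKn⟩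

end LocalLDP

/-! ### The cone of positive semidefinite matrices -/

section Matrix

open scoped MatrixOrder Matrix.Norms.L2Operator

lemma Matrix.continuousOn_sqrt {ι : Type*} [Fintype ι] [DecidableEq ι] :
    ContinuousOn (CFC.sqrt : Matrix ι ι ℝ → Matrix ι ι ℝ) {Q | 0 ≤ Q} :=
  CFC.continuousOn_sqrt

end Matrix

namespace PSD

variable {ι : Type*} [Fintype ι]

/-- The entries of a positive semidefinite matrix, as an element of a normed space. -/
def entries (Q : PSD ι) : ι → ι → ℝ := fun i j => Q.1 i j

/-- Transfers Cramér's theorem from the normed space of arrays to the cone, and yields local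
compactness and compact sublevel sets of the norm. -/
lemma isClosedEmbedding_entries : IsClosedEmbedding (entries : PSD ι → ι → ι → ℝ) := by
  refine IsClosed.isClosedEmbedding_subtypeVal (X := ι → ι → ℝ)
    (s := {Q | Matrix.PosSemidef (Matrix.of Q)}) ?_
  simp_rw [Matrix.posSemidef_iff_dotProduct_mulVec, Set.ofPred_and, Matrix.IsHermitian]
  refine IsClosed.inter ?_ ?_
  · refine isClosed_eq (Y := Matrix ι ι ℝ) ?_ ?_
    · exact Continuous.matrix_conjTranspose (A := fun Q : ι → ι → ℝ => Matrix.of Q) continuous_id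
    · exact continuous_id
  · simp_rw [Set.ofPred_forall]
    refine isClosed_iInter fun v => isClosed_le continuous_const ?_
    simp only [dotProduct, Matrix.mulVec, Matrix.of_apply]
    fun_prop

lemma continuous_entries : Continuous (entries : PSD ι → ι → ι → ℝ) :=
  isClosedEmbedding_entries.continuous

instance : SecondCountableTopology (PSD ι) :=
  isClosedEmbedding_entries.isEmbedding.secondCountableTopology

instance : LocallyCompactSpace (PSD ι) := isClosedEmbedding_entries.locallyCompactSpace

lemma isCompact_norm_entries_le (r : ℝ) : IsCompact {Q : PSD ι | ‖entries Q‖ ≤ r} := by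
  have h := isClosedEmbedding_entries.isCompact_preimage
    (isCompact_closedBall (0 : ι → ι → ℝ) r)
  convert! h using 1
  ext Q
  simp

lemma nhds_basis_entries (Q : PSD ι) :
    (𝓝 Q).HasBasis (fun δ : ℝ => 0 < δ) fun δ => {Q' | ‖entries Q' - entries Q‖ ≤ δ} := by
  rw [isClosedEmbedding_entries.nhds_eq_comap]
  refine (Metric.nhds_basis_closedBall.comap entries).congr (fun _ => Iff.rfl) fun δ _ => ?_
  ext Q'
  rw [Set.mem_preimage, mem_closedBall_iff_norm, Set.mem_ofPred_eq]

open scoped MatrixOrder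

variable [DecidableEq ι]

/-- The square root of a positive semidefinite matrix, as an operator on Euclidean space. -/
noncomputable def sqrt (Q : PSD ι) : EuclideanSpace ℝ ι →L[ℝ] EuclideanSpace ℝ ι :=
  Matrix.toEuclideanCLM (𝕜 := ℝ) (CFC.sqrt Q.1)

lemma continuous_sqrt : Continuous (sqrt : PSD ι → _) := by
  have h1 : Continuous fun Q : PSD ι => CFC.sqrt Q.1 :=
    Matrix.continuousOn_sqrt.comp_continuous continuous_subtype_val
      fun Q => Matrix.nonneg_iff_posSemidef.2 Q.2
  have h2 : Continuous (Matrix.toEuclideanCLM (n := ι) (𝕜 := ℝ)) :=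
    LinearMap.continuous_of_finiteDimensional
      (Matrix.toEuclideanCLM (n := ι) (𝕜 := ℝ)).toAlgEquiv.toLinearMap
  exact h2.comp h1

/-- Couples all covariances, singular ones included, to one reference Gaussian on which the
parameter acts continuously through its square root. -/
lemma multivariateGaussian_eq (Q : PSD ι) :
    multivariateGaussian 0 Q.1 = (stdGaussian (EuclideanSpace ℝ ι)).map (sqrt Q) := by
  rw [multivariateGaussian]
  simp [sqrt]

end PSD

/-! ### Asymptotically Lipschitz functions -/

/-- A function that is Lipschitz up to a sublinear error. -/
def CoarseLipschitz {E F : Type*} [NormedAddCommGroup E] [NormedAddCommGroup F] (f : E → F) :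
    Prop :=
  ∃ K : ℝ, 0 ≤ K ∧ ∀ ε > 0, ∃ T : ℝ, 0 ≤ T ∧
    ∀ x y, ‖f x - f y‖ ≤ K * ‖x - y‖ + ε * (‖x‖ + ‖y‖) + T

namespace CoarseLipschitz

variable {E F G : Type*} [NormedAddCommGroup E] [NormedAddCommGroup F] [NormedAddCommGroup G]

lemma exists_growth {f : E → F} (hf : CoarseLipschitz f) :
    ∃ A : ℝ, 0 ≤ A ∧ ∀ x, ‖f x‖ ≤ A * (1 + ‖x‖) := by
  obtain ⟨K, hK, h⟩ := hf
  obtain ⟨T, hT, h⟩ := h 1 one_pos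
  refine ⟨K + 1 + T + ‖f 0‖, by positivity, fun x => ?_⟩
  have h1 := h x 0
  simp only [sub_zero, norm_zero, add_zero] at h1
  have h2 := norm_le_norm_add_norm_sub' (f x) (f 0)
  nlinarith [norm_nonneg x, norm_nonneg (f 0), mul_nonneg hT (norm_nonneg x),
    mul_nonneg (norm_nonneg (f 0)) (norm_nonneg x)]

/-- The linear growth of `f` turns the sublinear error of `g` at `f x` into a sublinear error in
`x`. -/
lemma comp {g : F → G} {f : E → F} (hg : CoarseLipschitz g) (hf : CoarseLipschitz f) :
    CoarseLipschitz (g ∘ f) := by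
  obtain ⟨A, hA, hfA⟩ := hf.exists_growth
  obtain ⟨K, hK, hg⟩ := hg
  obtain ⟨L, hL, hf⟩ := hf
  refine ⟨K * L, by positivity, fun ε hε => ?_⟩
  obtain ⟨T, hT, hg⟩ := hg (ε / 2 / (A + 1)) (by positivity)
  obtain ⟨S, hS, hf⟩ := hf (ε / 2 / (K + 1)) (by positivity)
  refine ⟨K * S + ε + T, by positivity, fun x y => ?_⟩
  have h1 : K * (ε / 2 / (K + 1)) ≤ ε / 2 := by
    rw [← mul_div_assoc, div_le_iff₀ (by positivity)]
    nlinarith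
  have h2 : ε / 2 / (A + 1) * A ≤ ε / 2 := by
    rw [div_mul_eq_mul_div, div_le_iff₀ (by positivity)]
    nlinarith
  calc ‖g (f x) - g (f y)‖
      ≤ K * ‖f x - f y‖ + ε / 2 / (A + 1) * (‖f x‖ + ‖f y‖) + T := hg _ _
    _ ≤ K * (L * ‖x - y‖ + ε / 2 / (K + 1) * (‖x‖ + ‖y‖) + S) +
        ε / 2 / (A + 1) * (A * (1 + ‖x‖) + A * (1 + ‖y‖)) + T := by
        gcongr
        · exact hf x y
        · exact hfA x
        · exact hfA y
    _ = K * L * ‖x - y‖ + K * (ε / 2 / (K + 1)) * (‖x‖ + ‖y‖) + K * S +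
        ε / 2 / (A + 1) * A * (2 + ‖x‖ + ‖y‖) + T := by ring
    _ ≤ K * L * ‖x - y‖ + ε / 2 * (‖x‖ + ‖y‖) + K * S + ε / 2 * (2 + ‖x‖ + ‖y‖) + T := by
        gcongr
    _ = _ := by ring

lemma of_clm [NormedSpace ℝ E] [NormedSpace ℝ F] (l : E →L[ℝ] F) : CoarseLipschitz l :=
  ⟨‖l‖, norm_nonneg l, fun ε hε => ⟨0, le_rfl, fun x y => by
    rw [← map_sub]
    have := l.le_opNorm (x - y)
    have : 0 ≤ ε * (‖x‖ + ‖y‖) := by positivity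
    linarith⟩⟩

/-- The error `ρ` is small relative to the norm only outside a ball. A point of the ball is replaced
by a fixed point `x₀` outside it, which costs a constant because `f` is bounded on the ball by
continuity. -/
lemma of_asympLipschitz [ProperSpace E] {f : E → F} (hf : Continuous f) {ρ : E → ℝ}
    (h : AsympLipschitz f ρ) : CoarseLipschitz f := by
  obtain ⟨⟨K, hK, hfK⟩, hρ⟩ := h
  refine ⟨K, hK, fun ε hε => ?_⟩
  have h1 : Bornology.IsBounded {x | ‖ρ x‖ ≤ ε * ‖‖x‖‖}ᶜ := by
    rw [Bornology.isBounded_def, compl_compl]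
    exact hρ.def hε
  obtain ⟨r, hr⟩ := h1.subset_closedBall 0
  have hout (x : E) (hx : r < ‖x‖) : ρ x ≤ ε * ‖x‖ := by
    by_contra hcon
    have h2 : x ∈ Metric.closedBall (0 : E) r := hr fun h3 => hcon (by
      have h4 : ‖ρ x‖ ≤ ε * ‖‖x‖‖ := h3
      rw [norm_norm] at h4
      exact (le_abs_self _).trans h4)
    rw [mem_closedBall_zero_iff] at h2
    linarith
  obtain ⟨B, hB⟩ := (isCompact_closedBall (0 : E) r).exists_bound_of_continuousOn hf.continuousOn
  by_cases hx₀ : ∃ x₀ : E, r < ‖x₀‖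
  · obtain ⟨x₀, hx₀⟩ := hx₀
    have hB' : ∀ x, ‖x‖ ≤ r → ‖f x - f x₀‖ ≤ |B| + ‖f x₀‖ := fun x hx =>
      (norm_sub_le _ _).trans (add_le_add_left
        ((hB x (mem_closedBall_zero_iff.2 hx)).trans (le_abs_self B)) _)
    have hret (x : E) : ∃ x', r < ‖x'‖ ∧ ‖f x - f x'‖ ≤ |B| + ‖f x₀‖ ∧
        ‖x - x'‖ ≤ |r| + ‖x₀‖ ∧ ‖x'‖ ≤ ‖x‖ + ‖x₀‖ := by
      by_cases hx : r < ‖x‖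
      · exact ⟨x, hx, by rw [sub_self, norm_zero]; positivity,
          by rw [sub_self, norm_zero]; positivity, by linarith [norm_nonneg x₀]⟩
      · exact ⟨x₀, hx₀, hB' x (not_lt.1 hx), (norm_sub_le _ _).trans (add_le_add_left
          ((not_lt.1 hx).trans (le_abs_self r)) _), by linarith [norm_nonneg x]⟩
    refine ⟨2 * (|B| + ‖f x₀‖) + K * (2 * (|r| + ‖x₀‖)) + 2 * ε * ‖x₀‖, by positivity,
      fun x y => ?_⟩
    obtain ⟨x', hx1, hx2, hx3, hx4⟩ := hret x
    obtain ⟨y', hy1, hy2, hy3, hy4⟩ := hret y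
    have hd : ‖x' - y'‖ ≤ ‖x - y‖ + 2 * (|r| + ‖x₀‖) := by
      calc ‖x' - y'‖ = ‖(x - y) - (x - x') + (y - y')‖ := by congr 1; abel
        _ ≤ ‖x - y‖ + ‖x - x'‖ + ‖y - y'‖ :=
          (norm_add_le _ _).trans (add_le_add_left (norm_sub_le _ _) _)
        _ ≤ _ := by linarith
    calc ‖f x - f y‖ = ‖(f x - f x') + (f x' - f y') - (f y - f y')‖ := by congr 1; abel
      _ ≤ ‖f x - f x'‖ + ‖f x' - f y'‖ + ‖f y - f y'‖ :=
        (norm_sub_le _ _).trans (add_le_add_left (norm_add_le _ _) _)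
      _ ≤ (|B| + ‖f x₀‖) + (K * (‖x - y‖ + 2 * (|r| + ‖x₀‖)) + ε * (‖x‖ + ‖x₀‖) +
          ε * (‖y‖ + ‖x₀‖)) + (|B| + ‖f x₀‖) := by
        have h5 := hfK x' y'
        have h6 := mul_le_mul_of_nonneg_left hd hK
        have h7 := (hout x' hx1).trans (mul_le_mul_of_nonneg_left hx4 hε.le)
        have h8 := (hout y' hy1).trans (mul_le_mul_of_nonneg_left hy4 hε.le)
        linarith
      _ = _ := by ring
  -- The whole space is a bounded set, as happens in dimension zero, and `f` is bounded.
  · push Not at hx₀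
    refine ⟨2 * |B|, by positivity, fun x y => ?_⟩
    have h5 := hB x (mem_closedBall_zero_iff.2 (hx₀ x))
    have h6 := hB y (mem_closedBall_zero_iff.2 (hx₀ y))
    have h7 := norm_sub_le (f x) (f y)
    have h8 := le_abs_self B
    have : 0 ≤ K * ‖x - y‖ + ε * (‖x‖ + ‖y‖) := by positivity
    linarith

/-- Products of two coarsely Lipschitz functions, composed with nearby linear maps, differ little
relative to the squared norm. -/
lemma eventually_mul_comp [NormedSpace ℝ E] [ProperSpace E] {V : Type*} [NormedAddCommGroup V]
    [NormedSpace ℝ V] {f g : E → ℝ} (hf : CoarseLipschitz f)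
    (hg : CoarseLipschitz g) (hfc : Continuous f) (hgc : Continuous g) {X : Type*}
    [TopologicalSpace X] {s : X → V →L[ℝ] E} (hs : Continuous s) (Q : X) {η : ℝ} (hη : 0 < η) :
    ∀ᶠ q in 𝓝 Q, ∀ z, |f (s q z) * g (s q z) - f (s Q z) * g (s Q z)| ≤ η * (1 + ‖z‖ ^ 2) := by
  obtain ⟨A, hA, hfA⟩ := hf.exists_growth
  obtain ⟨B, hB, hgB⟩ := hg.exists_growth
  obtain ⟨K, hK, hf⟩ := hf
  obtain ⟨L, hL, hg⟩ := hg
  set S := ‖s Q‖ + 1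
  have hS : 1 ≤ S := by simp [S]
  set D := (A + B + 1) * (1 + S)
  have hD : 1 ≤ D := by
    have : 0 ≤ (A + B) * S := by positivity
    have h2 : D = 1 + S + (A + B) * 1 + (A + B) * S := by ring
    linarith
  set θ := η / (8 * D)
  have hθ : 0 < θ := by positivity
  obtain ⟨T₁, hT₁, hf⟩ := hf (θ / (2 * S)) (by positivity)
  obtain ⟨T₂, hT₂, hg⟩ := hg (θ / (2 * S)) (by positivity)
  set T := T₁ + T₂
  -- Beyond norm `N` the additive constant `T` is at most θ‖z‖.
  set N := 1 + T / θ
  have hN : 1 ≤ N := by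
    have : 0 ≤ T / θ := by positivity
    linarith
  have huc := (isCompact_closedBall (0 : E) (S * N)).uniformContinuousOn_of_continuous
    (hfc.mul hgc).continuousOn
  rw [Metric.uniformContinuousOn_iff] at huc
  obtain ⟨δ, hδ, huc⟩ := huc η hη
  have hev := (hs.tendsto Q).eventually (Metric.ball_mem_nhds (s Q)
    (show 0 < min (min 1 (δ / N)) (θ / (K + L + 1)) by positivity))
  filter_upwards [hev] with q hq z
  rw [dist_eq_norm, lt_min_iff, lt_min_iff] at hq
  obtain ⟨⟨hq1, hq2⟩, hq3⟩ := hq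
  have hsQ : ‖s Q‖ ≤ S := by simp [S]
  have hsq : ‖s q‖ ≤ S := by
    have := norm_le_norm_add_norm_sub' (s q) (s Q)
    simp only [S]
    linarith
  have hx : ‖s q z‖ ≤ S * ‖z‖ := (s q).le_of_opNorm_le hsq z
  have hy : ‖s Q z‖ ≤ S * ‖z‖ := (s Q).le_of_opNorm_le hsQ z
  have hxy : ‖s q z - s Q z‖ ≤ ‖s q - s Q‖ * ‖z‖ := (s q - s Q).le_opNorm z
  -- Near the origin uniform continuity on a compact ball suffices. Far away each factor changes by
  -- at most 3θ‖z‖, one θ‖z‖ from each error term, while the other factor grows linearly; this gives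
  -- 3θD‖z‖² = (3/8)η‖z‖².
  by_cases hz : ‖z‖ ≤ N
  · have h1 := huc (s q z) (mem_closedBall_zero_iff.2 (hx.trans (by gcongr))) (s Q z)
      (mem_closedBall_zero_iff.2 (hy.trans (by gcongr))) (by
        rw [dist_eq_norm]
        refine hxy.trans_lt ?_
        rw [lt_div_iff₀ (by positivity)] at hq2
        exact lt_of_le_of_lt (by gcongr) hq2)
    rw [Real.dist_eq] at h1
    refine h1.le.trans ?_
    nlinarith [sq_nonneg ‖z‖]
  · push Not at hz
    set n := ‖z‖
    have hn : 1 ≤ n := hN.trans hz.le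
    have hTn : T ≤ θ * n := by
      have : T / θ ≤ n := by linarith
      rwa [div_le_iff₀ hθ, mul_comm] at this
    have hq3' : ‖s q - s Q‖ * (K + L + 1) ≤ θ := by
      rw [lt_div_iff₀ (by positivity)] at hq3
      exact hq3.le
    have hSn : θ / (2 * S) * (‖s q z‖ + ‖s Q z‖) ≤ θ * n := by
      calc θ / (2 * S) * (‖s q z‖ + ‖s Q z‖) ≤ θ / (2 * S) * (S * n + S * n) := by gcongr
        _ = θ * n := by field_simp; ring
    have hdiff {K' T' : ℝ} (hK' : 0 ≤ K') (hKK : K' ≤ K + L + 1) (hTT : T' ≤ T) :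
        K' * ‖s q z - s Q z‖ + θ / (2 * S) * (‖s q z‖ + ‖s Q z‖) + T' ≤ 3 * θ * n := by
      have : K' * ‖s q z - s Q z‖ ≤ θ * n := by
        calc K' * ‖s q z - s Q z‖ ≤ (K + L + 1) * (‖s q - s Q‖ * n) := by gcongr
          _ = ‖s q - s Q‖ * (K + L + 1) * n := by ring
          _ ≤ θ * n := by gcongr
      linarith
    have h1 : |f (s q z) - f (s Q z)| ≤ 3 * θ * n :=
      (hf _ _).trans (hdiff hK (by linarith) (by simp only [T]; linarith))
    have h2 : |g (s q z) - g (s Q z)| ≤ 3 * θ * n :=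
      (hg _ _).trans (hdiff hL (by linarith) (by simp only [T]; linarith))
    have hbd {A' : ℝ} (hA' : 0 ≤ A') {v : E} (hv : ‖v‖ ≤ S * n) :
        A' * (1 + ‖v‖) ≤ A' * ((1 + S) * n) := by
      gcongr
      linarith
    have h3 : |g (s q z)| ≤ B * ((1 + S) * n) := (hgB _).trans (hbd hB hx)
    have h4 : |f (s Q z)| ≤ A * ((1 + S) * n) := (hfA _).trans (hbd hA hy)
    calc |f (s q z) * g (s q z) - f (s Q z) * g (s Q z)|
        = |(f (s q z) - f (s Q z)) * g (s q z) + f (s Q z) * (g (s q z) - g (s Q z))| := by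
          congr 1; ring
      _ ≤ |f (s q z) - f (s Q z)| * |g (s q z)| + |f (s Q z)| * |g (s q z) - g (s Q z)| := by
          rw [← abs_mul, ← abs_mul]; exact abs_add_le _ _
      _ ≤ 3 * θ * n * (B * ((1 + S) * n)) + A * ((1 + S) * n) * (3 * θ * n) := by gcongr
      _ = 3 * θ * ((A + B) * (1 + S)) * n ^ 2 := by ring
      _ ≤ 3 * θ * D * n ^ 2 := by
          gcongr
          simp only [D]
          nlinarith
      _ = 3 / 8 * η * n ^ 2 := by simp only [θ]; field_simp
      _ ≤ η * (1 + n ^ 2) := by nlinarith [sq_nonneg n]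

end CoarseLipschitz

/-! ### Gaussian linear combinations -/

lemma charFunDual_gaussianReal_zero (v : NNReal) (L : StrongDual ℝ ℝ) :
    charFunDual (gaussianReal 0 v) L = Complex.exp (-((v * L 1 ^ 2 : ℝ) : ℂ) / 2) := by
  have h : L = L 1 • (1 : StrongDual ℝ ℝ) := by ext; simp
  rw [h, ← charFun_map_eq_charFunDual_smul]
  have : (⇑(1 : StrongDual ℝ ℝ)) = id := by ext; simp
  rw [this, Measure.map_id, charFun_gaussianReal]
  simp [neg_div, pow_two]

lemma charFunDual_multivariateGaussian_zero {ι : Type*} [Fintype ι] [DecidableEq ι] (Q : PSD ι)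
    (L : StrongDual ℝ (EuclideanSpace ℝ ι)) :
    charFunDual (multivariateGaussian 0 Q.1) L = Complex.exp (-((∑ a, ∑ b,
      L (EuclideanSpace.single a 1) * L (EuclideanSpace.single b 1) * Q.1 a b : ℝ) : ℂ) / 2) := by
  set x := (InnerProductSpace.toDual ℝ (EuclideanSpace ℝ ι)).symm L
  have hx (a : ι) : x a = L (EuclideanSpace.single a 1) := by
    rw [← InnerProductSpace.toDual_symm_apply (𝕜 := ℝ), EuclideanSpace.inner_single_right]
    simp [x]
  rw [← charFun_toDual_symm_eq_charFunDual, charFun_multivariateGaussian Q.2]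
  congr 1
  simp only [inner_zero_right, Complex.ofReal_zero, zero_mul, zero_sub, neg_div]
  congr 3
  simp only [dotProduct, Matrix.mulVec, Finset.mul_sum]
  refine Finset.sum_congr rfl fun a _ => Finset.sum_congr rfl fun b _ => ?_
  rw [← hx, ← hx]
  ring

/-- Linear combinations of independent Gaussian weights are independent Gaussian vectors. -/
lemma map_pi_gaussianReal {ι κ κ' κ'' : Type*} [Fintype ι] [DecidableEq ι] [Fintype κ]
    [Fintype κ'] [Fintype κ''] (v : NNReal) (s : ℝ) (φ : κ → κ' → ι → ℝ) (Q : PSD ι)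
    (hQ : ∀ a b, Q.1 a b = s ^ 2 * v * ∑ k, ∑ k', φ k k' a * φ k k' b) :
    (Measure.pi fun _ : κ => Measure.pi fun _ : κ' => Measure.pi fun _ : κ'' =>
        gaussianReal 0 v).map
      (fun w c => WithLp.toLp 2 fun a => s * ∑ k', ∑ k, w k k' c * φ k k' a) =
    Measure.pi fun _ : κ'' => multivariateGaussian 0 Q.1 := by
  classical
  let T : (κ → κ' → κ'' → ℝ) →ₗ[ℝ] κ'' → EuclideanSpace ℝ ι :=
    { toFun := fun w c => WithLp.toLp 2 fun a => s * ∑ k', ∑ k, w k k' c * φ k k' a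
      map_add' := fun w w' => by
        ext c a
        simp [add_mul, Finset.sum_add_distrib, mul_add]
      map_smul' := fun r w => by
        ext c a
        simp only [Pi.smul_apply, smul_eq_mul, RingHom.id_apply, PiLp.smul_apply, mul_assoc]
        simp only [← Finset.mul_sum]
        ring }
  let T' := T.toContinuousLinearMap
  have hT : (fun (w : κ → κ' → κ'' → ℝ) (c : κ'') =>
      WithLp.toLp 2 fun a => s * ∑ k', ∑ k, w k k' c * φ k k' a) = T' := rfl
  have hm : AEMeasurable T' (Measure.pi fun _ : κ => Measure.pi fun _ : κ' =>
      Measure.pi fun _ : κ'' => gaussianReal 0 v) := T'.continuous.measurable.aemeasurable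
  rw [hT]
  have := Measure.isProbabilityMeasure_map hm
  refine Measure.ext_of_charFunDual ?_
  ext L
  rw [charFunDual_map, charFunDual_pi, charFunDual_pi]
  simp_rw [charFunDual_pi, charFunDual_gaussianReal_zero, charFunDual_multivariateGaussian_zero,
    ← Complex.exp_sum, hQ]
  congr 1
  set u : κ'' → ι → ℝ := fun c a => L (Pi.single c (EuclideanSpace.single a 1)) with hu
  -- A weight acts only on its own channel `c`, in the direction φ k k'. Hence the variance of L ∘
  -- T' is a sum of squares over the weights, which `hQ` identifies with the quadratic form of `Q`
  -- channel by channel.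
  have hL (k : κ) (k' : κ') (c : κ'') :
      L (T' (Pi.single k (Pi.single k' (Pi.single c 1)))) = s * ∑ a, φ k k' a * u c a := by
    have h1 : T' (Pi.single k (Pi.single k' (Pi.single c 1))) =
        ∑ a, (s * φ k k' a) • Pi.single c (EuclideanSpace.single a (1 : ℝ)) := by
      ext d b
      change s * ∑ j', ∑ j, (Pi.single k (Pi.single k' (Pi.single c (1 : ℝ))) :
        κ → κ' → κ'' → ℝ) j j' d * φ j j' b = _
      rw [Finset.sum_comm, Finset.sum_eq_single k, Finset.sum_eq_single k']
      · by_cases hd : d = c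
        · subst hd
          simp [Finset.sum_apply, Pi.single_apply]
        · simp [Finset.sum_apply, hd]
      · intro j _ hj
        simp [hj]
      · simp
      · intro j _ hj
        simp [hj]
      · simp
    rw [h1, map_sum, Finset.mul_sum]
    refine Finset.sum_congr rfl fun a _ => ?_
    rw [map_smul, smul_eq_mul, mul_assoc]
  have h2 (k : κ) (k' : κ') (c : κ'') : ((((L ∘SL T') ∘SL ContinuousLinearMap.single ℝ
      (fun _ => κ' → κ'' → ℝ) k) ∘SL ContinuousLinearMap.single ℝ (fun _ => κ'' → ℝ) k') ∘SL
      ContinuousLinearMap.single ℝ (fun _ => ℝ) c) 1 = s * ∑ a, φ k k' a * u c a := hL k k' c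
  have h3 (c : κ'') (a : ι) : (L ∘SL ContinuousLinearMap.single ℝ (fun _ => EuclideanSpace ℝ ι) c)
      (EuclideanSpace.single a 1) = u c a := rfl
  simp_rw [h2, h3, neg_div, Finset.sum_neg_distrib, ← Finset.sum_div, ← Complex.ofReal_sum]
  congr 3
  rw [Finset.sum_congr rfl fun k _ => Finset.sum_comm, Finset.sum_comm]
  refine Finset.sum_congr rfl fun c _ => ?_
  simp_rw [mul_pow, pow_two (∑ a, _), Finset.sum_mul_sum, Finset.mul_sum]
  rw [Finset.sum_congr rfl fun k _ => Finset.sum_comm, Finset.sum_comm]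
  rw [Finset.sum_congr rfl fun a _ => Finset.sum_congr rfl fun k _ => Finset.sum_comm,
    Finset.sum_congr rfl fun a _ => Finset.sum_comm]
  refine Finset.sum_congr rfl fun a _ => Finset.sum_congr rfl fun b _ => Finset.sum_congr rfl
    fun k _ => Finset.sum_congr rfl fun k' _ => ?_
  ring

/-- Resampling one coordinate does not change a product of probability measures. -/
lemma map_update_pi {κ : Type*} [Fintype κ] [DecidableEq κ] {X : κ → Type*}
    [∀ i, MeasurableSpace (X i)] (μ : ∀ i, Measure (X i)) [∀ i, IsProbabilityMeasure (μ i)]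
    (j : κ) :
    MeasurePreserving (fun p : (∀ i, X i) × X j => Function.update p.1 j p.2)
      ((Measure.pi μ).prod (μ j)) (Measure.pi μ) := by
  have hm : Measurable fun p : (∀ i, X i) × X j => Function.update p.1 j p.2 := by
    refine measurable_pi_lambda _ fun i => ?_
    by_cases hi : i = j
    · subst hi
      simpa using measurable_snd
    · simp only [Function.update_of_ne hi]
      fun_prop
  refine ⟨hm, (Measure.pi_eq fun s hs => ?_).symm⟩
  rw [Measure.map_apply hm (MeasurableSet.univ_pi hs)]
  -- The old value of the resampled coordinate is forgotten, so its side of the rectangle becomes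
  -- `univ`.
  have : (fun p : (∀ i, X i) × X j => Function.update p.1 j p.2) ⁻¹' Set.univ.pi s =
      (Set.univ.pi (Function.update s j Set.univ)) ×ˢ s j := by
    ext ⟨w, v⟩
    simp only [Set.mem_preimage, Set.mem_univ_pi, Set.mem_prod]
    constructor
    · intro h
      refine ⟨fun i => ?_, by simpa using h j⟩
      by_cases hi : i = j
      · subst hi; simp
      · simpa [hi] using h i
    · rintro ⟨h1, h2⟩ i
      by_cases hi : i = j
      · subst hi; simpa using h2
      · simpa [hi] using h1 i
  rw [this, Measure.prod_prod, Measure.pi_pi,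
    ← Finset.mul_prod_erase Finset.univ (fun i => μ i (Function.update s j Set.univ i))
      (Finset.mem_univ j),
    ← Finset.mul_prod_erase Finset.univ (fun i => μ i (s i)) (Finset.mem_univ j)]
  simp only [Function.update_self, measure_univ, one_mul]
  rw [mul_comm]
  congr 1
  refine Finset.prod_congr rfl fun i hi => ?_
  rw [Function.update_of_ne (Finset.ne_of_mem_erase hi)]

/-! ### The conditional law of a layer -/

namespace CNN

variable (A : CNN) {C : ℕ → ℕ} {P : ℕ}

instance (C : ℕ → ℕ) : IsProbabilityMeasure (A.prior C) := by
  rw [prior]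
  infer_instance

/-- The activations that the weights of layer `ℓ` multiply. -/
noncomputable def feature (W : A.Weights C)
    (x : Fin P → Fin (C 0) → EuclideanSpace ℝ (Fin (A.N 0))) :
    ∀ ℓ : ℕ, ℓ < A.L + 1 → Fin (A.M ℓ) → Fin (C ℓ) → A.Idx P (ℓ + 1) → ℝ
  | 0, _ => fun m c a => A.R 0 a.1 (x a.2 c) m
  | ℓ + 1, h => fun m c a =>
      A.σ (A.R (ℓ + 1) a.1 (A.preact W (x a.2) ℓ (Nat.lt_of_succ_lt h) c) m)

/-- The pre-activations of all inputs at layer `ℓ + 1`. -/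
noncomputable def preacts (W : A.Weights C)
    (x : Fin P → Fin (C 0) → EuclideanSpace ℝ (Fin (A.N 0))) (ℓ : ℕ) (h : ℓ < A.L + 1)
    (c : Fin (C (ℓ + 1))) : EuclideanSpace ℝ (A.Idx P (ℓ + 1)) :=
  WithLp.toLp 2 fun a => A.preact W (x a.2) ℓ h c a.1

variable (x : Fin P → Fin (C 0) → EuclideanSpace ℝ (Fin (A.N 0)))

lemma preacts_eq (W : A.Weights C) (ℓ : ℕ) (h : ℓ < A.L + 1) :
    A.preacts W x ℓ h = fun c => WithLp.toLp 2 fun a =>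
      (√((A.M ℓ : ℝ) * C ℓ))⁻¹ * ∑ c', ∑ m, W ⟨ℓ, h⟩ m c' c * A.feature W x ℓ h m c' a := by
  cases ℓ <;> rfl

/-- Treats the input layer and the hidden layers alike, in the form of the hypothesis `hQ` of
`map_pi_gaussianReal`. -/
lemma condCov_eq (W : A.Weights C) (ℓ : ℕ) (h : ℓ < A.L + 1) (a b : A.Idx P (ℓ + 1)) :
    (A.condCov W x ℓ h).1 a b = ((√((A.M ℓ : ℝ) * C ℓ))⁻¹) ^ 2 * ((A.lam ℓ)⁻¹ : NNReal) *
      ∑ m, ∑ c, A.feature W x ℓ h m c a * A.feature W x ℓ h m c b := by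
  have hs : ((√((A.M ℓ : ℝ) * C ℓ))⁻¹) ^ 2 = (A.M ℓ : ℝ)⁻¹ * (C ℓ : ℝ)⁻¹ := by
    rw [inv_pow, Real.sq_sqrt (by positivity), mul_inv]
  rw [hs, Finset.sum_comm]
  cases ℓ with
  | zero =>
    simp only [condCov, inputCov, PSD.mean, PSD.gram, feature, Matrix.smul_apply, Matrix.sum_apply,
      Matrix.of_apply, smul_eq_mul, ← Finset.mul_sum]
    push_cast
    rw [mul_inv]
    ring
  | succ ℓ =>
    simp only [condCov, G, PSD.mean, PSD.gram, feature, Matrix.smul_apply, Matrix.sum_apply,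
      Matrix.of_apply, smul_eq_mul, ← Finset.mul_sum]
    push_cast
    rw [mul_inv]
    simp only [slice]
    ring

lemma preact_congr {W W' : A.Weights C} (x : Fin (C 0) → EuclideanSpace ℝ (Fin (A.N 0)))
    (ℓ : ℕ) (h : ℓ < A.L + 1) (hW : ∀ j : Fin (A.L + 1), (j : ℕ) ≤ ℓ → W j = W' j) :
    A.preact W x ℓ h = A.preact W' x ℓ h := by
  induction ℓ with
  | zero =>
    simp only [preact]
    rw [hW ⟨0, h⟩ le_rfl]
  | succ ℓ ih =>
    simp only [preact]
    rw [hW ⟨ℓ + 1, h⟩ le_rfl, ih _ fun j hj => hW j (by omega)]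

lemma feature_congr {W W' : A.Weights C} (ℓ : ℕ) (h : ℓ < A.L + 1)
    (hW : ∀ j : Fin (A.L + 1), (j : ℕ) < ℓ → W j = W' j) :
    A.feature W x ℓ h = A.feature W' x ℓ h := by
  cases ℓ with
  | zero => rfl
  | succ ℓ =>
    ext m c a
    simp only [feature]
    rw [A.preact_congr (x a.2) ℓ _ fun j hj => hW j (by omega)]

/-- The inequality j < ℓ is strict: this covariance is K^{(ℓ+1)}, a function of the weights that
precede layer `ℓ`, and hence independent of the weights of layer `ℓ`. -/
lemma condCov_congr {W W' : A.Weights C} (ℓ : ℕ) (h : ℓ < A.L + 1)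
    (hW : ∀ j : Fin (A.L + 1), (j : ℕ) < ℓ → W j = W' j) :
    A.condCov W x ℓ h = A.condCov W' x ℓ h := by
  refine Subtype.ext (Matrix.ext fun a b => ?_)
  rw [condCov_eq, condCov_eq, A.feature_congr x ℓ h hW]

section Continuity

variable {A} (hσ : Continuous A.σ) (hR : ∀ ℓ, 1 ≤ ℓ → ℓ ≤ A.L → ∀ i, Continuous (A.R ℓ i))

include hσ hR

lemma continuous_preact (x : Fin (C 0) → EuclideanSpace ℝ (Fin (A.N 0))) (ℓ : ℕ)
    (h : ℓ < A.L + 1) : Continuous fun W : A.Weights C => A.preact W x ℓ h := by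
  have hW (j : Fin (A.L + 1)) (m : Fin (A.M j)) (c' : Fin (C j)) (c : Fin (C (j + 1))) :
      Continuous fun W : A.Weights C => W j m c' c := by fun_prop
  induction ℓ with
  | zero =>
    simp only [preact]
    refine continuous_pi fun c => (PiLp.continuous_toLp 2 _).comp (continuous_pi fun i => ?_)
    refine continuous_const.mul (continuous_finsetSum _ fun c' _ => continuous_finsetSum _
      fun m _ => (hW ⟨0, h⟩ m c' c).mul continuous_const)
  | succ ℓ ih =>
    simp only [preact]
    refine continuous_pi fun c => (PiLp.continuous_toLp 2 _).comp (continuous_pi fun i => ?_)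
    refine continuous_const.mul (continuous_finsetSum _ fun c' _ => continuous_finsetSum _
      fun m _ => (hW ⟨ℓ + 1, h⟩ m c' c).mul (hσ.comp ?_))
    exact (EuclideanSpace.proj (𝕜 := ℝ) m).continuous.comp
      ((hR (ℓ + 1) (by omega) (by omega) i).comp
        ((continuous_apply c').comp (ih (Nat.lt_of_succ_lt h))))

lemma continuous_preacts (ℓ : ℕ) (h : ℓ < A.L + 1) :
    Continuous fun W : A.Weights C => A.preacts W x ℓ h := by
  refine continuous_pi fun c => (PiLp.continuous_toLp 2 _).comp (continuous_pi fun a => ?_)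
  exact (EuclideanSpace.proj (𝕜 := ℝ) a.1).continuous.comp
    ((continuous_apply c).comp (continuous_preact hσ hR (x a.2) ℓ h))

lemma continuous_feature (ℓ : ℕ) (h : ℓ < A.L + 1) (m : Fin (A.M ℓ)) (c : Fin (C ℓ))
    (a : A.Idx P (ℓ + 1)) : Continuous fun W : A.Weights C => A.feature W x ℓ h m c a := by
  cases ℓ with
  | zero => exact continuous_const
  | succ ℓ =>
    exact hσ.comp ((EuclideanSpace.proj (𝕜 := ℝ) m).continuous.comp
      ((hR (ℓ + 1) (by omega) (by omega) a.1).comp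
        ((continuous_apply c).comp (continuous_preact hσ hR (x a.2) ℓ _))))

lemma continuous_condCov (ℓ : ℕ) (h : ℓ < A.L + 1) :
    Continuous fun W : A.Weights C => A.condCov W x ℓ h := by
  refine PSD.isClosedEmbedding_entries.continuous_iff.2
    (continuous_pi fun a => continuous_pi fun b => ?_)
  simp only [Function.comp_apply, PSD.entries, condCov_eq]
  exact continuous_const.mul (continuous_finsetSum _ fun m _ => continuous_finsetSum _ fun c _ =>
    (continuous_feature x hσ hR ℓ h m c a).mul (continuous_feature x hσ hR ℓ h m c b))

lemma continuous_G (ℓ : ℕ) (h1 : 1 ≤ ℓ) (h : ℓ ≤ A.L) :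
    Continuous (A.G ℓ : EuclideanSpace ℝ (A.Idx P ℓ) → _) := by
  have hs (μ : Fin P) : Continuous fun z : EuclideanSpace ℝ (A.Idx P ℓ) => A.slice z μ := by
    unfold slice
    fun_prop
  have hf (m : Fin (A.M ℓ)) (a : A.Idx P (ℓ + 1)) :
      Continuous fun z : EuclideanSpace ℝ (A.Idx P ℓ) => A.σ (A.R ℓ a.1 (A.slice z a.2) m) :=
    hσ.comp ((EuclideanSpace.proj (𝕜 := ℝ) m).continuous.comp ((hR ℓ h1 h a.1).comp (hs a.2)))
  refine Continuous.subtype_mk (continuous_pi fun a => continuous_pi fun b => ?_) _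
  exact continuous_const.mul (continuous_finsetSum _ fun m _ => (hf m a).mul (hf m b))

/-- Given the covariance `Q` of a layer, its pre-activations are independent with law `N(0, Q)`. -/
lemma lintegral_condCov_preacts (ℓ : ℕ) (h : ℓ < A.L + 1)
    {F : PSD (A.Idx P (ℓ + 1)) × (Fin (C (ℓ + 1)) → EuclideanSpace ℝ (A.Idx P (ℓ + 1))) → ENNReal}
    (hF : Measurable F) :
    ∫⁻ W, F (A.condCov W x ℓ h, A.preacts W x ℓ h) ∂(A.prior C) =
      ∫⁻ Q, ∫⁻ z, F (Q, fun c => PSD.sqrt Q (z c))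
        ∂(Measure.pi fun _ => stdGaussian (EuclideanSpace ℝ (A.Idx P (ℓ + 1))))
        ∂((A.prior C).map fun W => A.condCov W x ℓ h) := by
  have hcc := (continuous_condCov x hσ hR ℓ h (C := C)).measurable
  have hpc := (continuous_preacts x hσ hR ℓ h (C := C)).measurable
  have hsq : Continuous fun p : PSD (A.Idx P (ℓ + 1)) ×
      (Fin (C (ℓ + 1)) → EuclideanSpace ℝ (A.Idx P (ℓ + 1))) =>
      (p.1, fun c => PSD.sqrt p.1 (p.2 c)) := by
    refine continuous_fst.prodMk (continuous_pi fun c => ?_)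
    exact (PSD.continuous_sqrt.comp continuous_fst).clm_apply
      ((continuous_apply c).comp continuous_snd)
  have hFs : Measurable fun p : PSD (A.Idx P (ℓ + 1)) ×
      (Fin (C (ℓ + 1)) → EuclideanSpace ℝ (A.Idx P (ℓ + 1))) =>
      F (p.1, fun c => PSD.sqrt p.1 (p.2 c)) := hF.comp hsq.measurable
  refine Eq.trans ?_ (lintegral_map (hFs.lintegral_prod_right' (ν := Measure.pi fun _ =>
    stdGaussian (EuclideanSpace ℝ (A.Idx P (ℓ + 1))))) hcc).symm
  have hFW : Measurable fun W : A.Weights C => F (A.condCov W x ℓ h, A.preacts W x ℓ h) :=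
    hF.comp (hcc.prodMk hpc)
  -- Resampling the weights of layer `ℓ` isolates them: the covariance and the features ignore the
  -- update, so the inner integral is over a Gaussian linear map with frozen coefficients.
  have hup := map_update_pi (fun j : Fin (A.L + 1) => Measure.pi fun _ : Fin (A.M j) =>
    Measure.pi fun _ : Fin (C j) => Measure.pi fun _ : Fin (C (j + 1)) =>
      gaussianReal 0 (A.lam j)⁻¹) ⟨ℓ, h⟩
  rw [prior, ← hup.lintegral_comp hFW]
  refine (lintegral_prod _ (hFW.comp hup.measurable).aemeasurable).trans
    (lintegral_congr fun W => ?_)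
  simp only [Function.comp_apply]
  have hne (w) (j : Fin (A.L + 1)) (hj : (j : ℕ) < ℓ) :
      Function.update W ⟨ℓ, h⟩ w j = W j :=
    Function.update_of_ne (fun he => by rw [he] at hj; exact lt_irrefl _ hj) _ _
  simp_rw [preacts_eq, fun w => A.condCov_congr x ℓ h (hne w),
    fun w => A.feature_congr x ℓ h (hne w), Function.update_self]
  have hlaw := map_pi_gaussianReal (κ'' := Fin (C (ℓ + 1))) (A.lam ℓ)⁻¹
    (√((A.M ℓ : ℝ) * C ℓ))⁻¹ (A.feature W x ℓ h) (A.condCov W x ℓ h) (A.condCov_eq x W ℓ h)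
  have hFQ : Measurable fun v => F (A.condCov W x ℓ h, v) := hF.comp measurable_prodMk_left
  have hmeas : Measurable fun (w : Fin (A.M ℓ) → Fin (C ℓ) → Fin (C (ℓ + 1)) → ℝ) c =>
      WithLp.toLp 2 fun a => (√((A.M ℓ : ℝ) * C ℓ))⁻¹ *
        ∑ k', ∑ k, w k k' c * A.feature W x ℓ h k k' a := by
    refine Continuous.measurable ?_
    fun_prop
  rw [← lintegral_map (f := fun v => F (A.condCov W x ℓ h, v)) hFQ hmeas, hlaw,
    PSD.multivariateGaussian_eq]
  have hsqm : Measurable (PSD.sqrt (A.condCov W x ℓ h)) :=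
    (PSD.sqrt (A.condCov W x ℓ h)).continuous.measurable
  have := Measure.isProbabilityMeasure_map
    (μ := stdGaussian (EuclideanSpace ℝ (A.Idx P (ℓ + 1)))) hsqm.aemeasurable
  rw [← Measure.pi_map_pi fun _ => hsqm.aemeasurable, lintegral_map hFQ (by fun_prop)]

end Continuity

/-- The law of `K^{(ℓ+1)}` given `K^{(ℓ)} = Q`, with `m` channels. -/
noncomputable def layerKernel (P ℓ m : ℕ) (Q : PSD (A.Idx P ℓ)) : Measure (PSD (A.Idx P (ℓ + 1))) :=
  (Measure.pi fun _ : Fin m => stdGaussian (EuclideanSpace ℝ (A.Idx P ℓ))).map fun z =>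
    PSD.mean fun c => A.G ℓ (PSD.sqrt Q (z c))

variable {A}

lemma continuous_mean {ι : Type*} {m : ℕ} : Continuous (PSD.mean : (Fin m → PSD ι) → PSD ι) := by
  refine Continuous.subtype_mk ?_ _
  exact (continuous_finsetSum _ fun c _ => continuous_subtype_val.comp
    (continuous_apply c)).const_smul (m : ℝ)⁻¹

/-- The Markov property: the next covariance is a function of the pre-activations, which depend on
the past only through the current covariance. -/
lemma map_condCov_succ (hσ : Continuous A.σ)
    (hR : ∀ ℓ, 1 ≤ ℓ → ℓ ≤ A.L → ∀ i, Continuous (A.R ℓ i)) (ℓ : ℕ) (h : ℓ + 1 < A.L + 1)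
    {V : Set (PSD (A.Idx P (ℓ + 2)))} (hV : MeasurableSet V) :
    (A.prior C).map (fun W => A.condCov W x (ℓ + 1) h) V =
      ∫⁻ Q, A.layerKernel P (ℓ + 1) (C (ℓ + 1)) Q V
        ∂((A.prior C).map fun W => A.condCov W x ℓ (Nat.lt_of_succ_lt h)) := by
  have hG := continuous_G (P := P) hσ hR (ℓ + 1) (by omega) (by omega)
  have hmG : Continuous fun v : Fin (C (ℓ + 1)) → EuclideanSpace ℝ (A.Idx P (ℓ + 1)) =>
      PSD.mean fun c => A.G (ℓ + 1) (v c) :=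
    continuous_mean.comp (continuous_pi fun c => hG.comp (continuous_apply c))
  have hF : Measurable fun p : PSD (A.Idx P (ℓ + 1)) ×
      (Fin (C (ℓ + 1)) → EuclideanSpace ℝ (A.Idx P (ℓ + 1))) =>
      V.indicator (fun _ => (1 : ENNReal)) (PSD.mean fun c => A.G (ℓ + 1) (p.2 c)) :=
    (measurable_const.indicator hV).comp (hmG.measurable.comp measurable_snd)
  have key := lintegral_condCov_preacts x hσ hR ℓ (Nat.lt_of_succ_lt h) hF
  rw [Measure.map_apply (continuous_condCov x hσ hR _ h).measurable hV, ← lintegral_indicator_one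
    ((continuous_condCov x hσ hR _ h).measurable hV)]
  refine key.trans (lintegral_congr fun Q => ?_)
  have hm : Measurable fun z : Fin (C (ℓ + 1)) → EuclideanSpace ℝ (A.Idx P (ℓ + 1)) =>
      PSD.mean fun c => A.G (ℓ + 1) (PSD.sqrt Q (z c)) := by
    refine (hmG.comp (continuous_pi fun c => ?_)).measurable
    exact (PSD.sqrt Q).continuous.comp (continuous_apply c)
  rw [layerKernel, Measure.map_apply hm hV, ← lintegral_indicator_one (hm hV)]
  rfl

end CNN

/-! ### Locally uniform estimates for a layer -/

/-- Fernique's theorem. The summand 1 lets the weight dominate constants as well as squares. -/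
lemma exists_lintegral_eexp_sq_le (E : Type*) [NormedAddCommGroup E] [InnerProductSpace ℝ E]
    [FiniteDimensional ℝ E] [MeasurableSpace E] [BorelSpace E] :
    ∃ θ > 0, ∃ M : ℝ, 0 ≤ M ∧ ∫⁻ z, eexp (θ * (1 + ‖z‖ ^ 2)) ∂(stdGaussian E) ≤ eexp M := by
  have : SecondCountableTopology E := secondCountable_of_proper (α := E)
  have : CompleteSpace E := FiniteDimensional.complete ℝ E
  obtain ⟨θ, hθ, hint⟩ := IsGaussian.exists_integrable_exp_sq (stdGaussian E)
  have hfin : ∫⁻ z, eexp (θ * ‖z‖ ^ 2) ∂(stdGaussian E) ≠ ⊤ := by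
    have := hint.lintegral_lt_top
    exact this.ne
  refine ⟨θ, hθ, ?_⟩
  simp_rw [mul_add, eexp_add]
  rw [lintegral_const_mul' _ _ (eexp_ne_top _)]
  set c := eexp (θ * 1) * ∫⁻ z, eexp (θ * ‖z‖ ^ 2) ∂(stdGaussian E) with hc
  have hc1 : max 1 c ≠ ⊤ := by
    rw [hc]
    exact (max_lt ENNReal.one_lt_top (ENNReal.mul_lt_top (eexp_ne_top _).lt_top hfin.lt_top)).ne
  obtain ⟨M, hM⟩ := exists_eexp_eq (lt_max_of_lt_left one_pos).ne' hc1
  refine ⟨M, ?_, hM ▸ le_max_right _ _⟩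
  rw [← eexp_le, eexp_zero, hM]
  exact le_max_left _ _

namespace CNN

variable {A : CNN} {P : ℕ}

/-- The slice `z_{:,μ}` as a continuous linear function of `z`. -/
noncomputable def sliceCLM (A : CNN) (P ℓ : ℕ) (μ : Fin P) :
    EuclideanSpace ℝ (A.Idx P ℓ) →L[ℝ] EuclideanSpace ℝ (Fin (A.N ℓ)) :=
  LinearMap.toContinuousLinearMap
    { toFun := fun z => A.slice z μ
      map_add' := fun _ _ => rfl
      map_smul' := fun _ _ => rfl }

/-- The activation with index `m` of the receptive field `a`. -/
noncomputable def activation (A : CNN) {P : ℕ} (ℓ : ℕ) (m : Fin (A.M ℓ)) (a : A.Idx P (ℓ + 1))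
    (z : EuclideanSpace ℝ (A.Idx P ℓ)) : ℝ :=
  A.σ (A.R ℓ a.1 (A.slice z a.2) m)

lemma entries_G (ℓ : ℕ) (z : EuclideanSpace ℝ (A.Idx P ℓ)) (a b : A.Idx P (ℓ + 1)) :
    PSD.entries (A.G ℓ z) a b = ((A.lam ℓ * A.M ℓ : NNReal) : ℝ)⁻¹ *
      ∑ m, A.activation ℓ m a z * A.activation ℓ m b z := rfl

lemma entries_mean {ι : Type*} [Fintype ι] {m : ℕ} (Q : Fin m → PSD ι) :
    PSD.entries (PSD.mean Q) = (m : ℝ)⁻¹ • ∑ c, PSD.entries (Q c) := by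
  ext a b
  simp [PSD.entries, PSD.mean, Matrix.sum_apply]

section Regular

variable (hσ : Continuous A.σ) (hσLip : ∃ ρ, AsympLipschitz A.σ ρ)
  (hR : ∀ ℓ, 1 ≤ ℓ → ℓ ≤ A.L → ∀ i, Continuous (A.R ℓ i))
  (hRLip : ∀ ℓ, 1 ≤ ℓ → ℓ ≤ A.L → ∀ i, ∃ ρ, AsympLipschitz (A.R ℓ i) ρ)
  {ℓ : ℕ} (h1 : 1 ≤ ℓ) (hℓ : ℓ ≤ A.L)

include hσ hR h1 hℓ

lemma continuous_activation (m : Fin (A.M ℓ)) (a : A.Idx P (ℓ + 1)) :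
    Continuous (A.activation ℓ m a) :=
  hσ.comp ((EuclideanSpace.proj (𝕜 := ℝ) m).continuous.comp ((hR ℓ h1 hℓ a.1).comp
    (A.sliceCLM P ℓ a.2).continuous))

include hσLip hRLip

lemma coarseLipschitz_activation (m : Fin (A.M ℓ)) (a : A.Idx P (ℓ + 1)) :
    CoarseLipschitz (A.activation ℓ m a) := by
  obtain ⟨ρ, hρ⟩ := hσLip
  obtain ⟨ρ', hρ'⟩ := hRLip ℓ h1 hℓ a.1
  exact (CoarseLipschitz.of_asympLipschitz hσ hρ).comp
    ((CoarseLipschitz.of_clm (EuclideanSpace.proj (𝕜 := ℝ) m)).comp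
      ((CoarseLipschitz.of_asympLipschitz (hR ℓ h1 hℓ a.1) hρ').comp
        (CoarseLipschitz.of_clm (A.sliceCLM P ℓ a.2))))

/-- Entries of G are sums of products of two activations, each of linear growth and coarsely
Lipschitz, so growth and continuity are both measured against the squared norm. -/
lemma expContinuousFamily : ExpContinuousFamily (stdGaussian (EuclideanSpace ℝ (A.Idx P ℓ)))
    (fun z => 1 + ‖z‖ ^ 2) fun (Q : PSD (A.Idx P ℓ)) z => PSD.entries (A.G ℓ (PSD.sqrt Q z)) where
  measurable_weight := by fun_prop
  exp_moment := exists_lintegral_eexp_sq_le _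
  measurable Q := (PSD.continuous_entries.comp ((continuous_G hσ hR ℓ h1 hℓ).comp
    (PSD.sqrt Q).continuous)).measurable
  growth Q := by
    choose B hB0 hB using fun m (a : A.Idx P (ℓ + 1)) =>
      (coarseLipschitz_activation hσ hσLip hR hRLip h1 hℓ m a).exists_growth
    set D := ∑ m, ∑ a, B m a
    have hD0 : 0 ≤ D := Finset.sum_nonneg fun m _ => Finset.sum_nonneg fun a _ => hB0 m a
    have hBD (m a) : B m a ≤ D :=
      (Finset.single_le_sum (f := fun a => B m a) (fun a _ => hB0 m a) (Finset.mem_univ a)).trans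
        (Finset.single_le_sum (f := fun m => ∑ a, B m a)
          (fun m _ => Finset.sum_nonneg fun a _ => hB0 m a) (Finset.mem_univ m))
    set s := ‖PSD.sqrt Q‖
    have hact (m a z) : |A.activation ℓ m a (PSD.sqrt Q z)| ≤ D * (1 + s) * (1 + ‖z‖) := by
      have h2 : ‖PSD.sqrt Q z‖ ≤ s * ‖z‖ := (PSD.sqrt Q).le_opNorm z
      calc |A.activation ℓ m a (PSD.sqrt Q z)| ≤ B m a * (1 + ‖PSD.sqrt Q z‖) := hB m a _
        _ ≤ D * ((1 + s) * (1 + ‖z‖)) := by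
          gcongr
          · exact hBD m a
          · nlinarith [norm_nonneg z, norm_nonneg (PSD.sqrt Q)]
        _ = _ := by ring
    set r : ℝ := ((A.lam ℓ * A.M ℓ : NNReal) : ℝ)⁻¹ with hr
    have hr0 : 0 ≤ r := inv_nonneg.2 (NNReal.coe_nonneg _)
    refine ⟨r * (A.M ℓ * (2 * (D * (1 + s)) ^ 2)), by positivity, fun z => ?_⟩
    refine (pi_norm_le_iff_of_nonneg (by positivity)).2 fun a =>
      (pi_norm_le_iff_of_nonneg (by positivity)).2 fun b => ?_
    rw [entries_G, norm_mul, Real.norm_of_nonneg hr0, mul_assoc]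
    gcongr
    refine (norm_sum_le _ _).trans ?_
    have hterm (m : Fin (A.M ℓ)) : ‖A.activation ℓ m a (PSD.sqrt Q z) *
        A.activation ℓ m b (PSD.sqrt Q z)‖ ≤ 2 * (D * (1 + s)) ^ 2 * (1 + ‖z‖ ^ 2) := by
      rw [norm_mul]
      calc _ ≤ D * (1 + s) * (1 + ‖z‖) * (D * (1 + s) * (1 + ‖z‖)) := by
            gcongr
            · exact hact m a z
            · exact hact m b z
        _ = (D * (1 + s)) ^ 2 * (1 + ‖z‖) ^ 2 := by ring
        _ ≤ (D * (1 + s)) ^ 2 * (2 * (1 + ‖z‖ ^ 2)) := by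
            gcongr
            nlinarith [sq_nonneg (1 - ‖z‖)]
        _ = _ := by ring
    refine (Finset.sum_le_sum fun m _ => hterm m).trans (le_of_eq ?_)
    simp
    ring
  continuous Q η hη := by
    set r : ℝ := ((A.lam ℓ * A.M ℓ : NNReal) : ℝ)⁻¹ with hr
    have hr0 : 0 ≤ r := inv_nonneg.2 (NNReal.coe_nonneg _)
    have hev (m : Fin (A.M ℓ)) (a b : A.Idx P (ℓ + 1)) :=
      (coarseLipschitz_activation hσ hσLip hR hRLip h1 hℓ m a).eventually_mul_comp
        (coarseLipschitz_activation hσ hσLip hR hRLip h1 hℓ m b)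
        (continuous_activation hσ hR h1 hℓ m a) (continuous_activation hσ hR h1 hℓ m b)
        PSD.continuous_sqrt Q (show 0 < η / (r * A.M ℓ + 1) by positivity)
    have hall := eventually_all.2 fun m => eventually_all.2 fun a => eventually_all.2 (hev m a)
    filter_upwards [hall] with q hq z
    refine (pi_norm_le_iff_of_nonneg (by positivity)).2 fun a =>
      (pi_norm_le_iff_of_nonneg (by positivity)).2 fun b => ?_
    rw [Pi.sub_apply, Pi.sub_apply, entries_G, entries_G, ← mul_sub, ← Finset.sum_sub_distrib,
      norm_mul, Real.norm_of_nonneg hr0]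
    calc r * ‖∑ m, (A.activation ℓ m a (PSD.sqrt q z) * A.activation ℓ m b (PSD.sqrt q z) -
          A.activation ℓ m a (PSD.sqrt Q z) * A.activation ℓ m b (PSD.sqrt Q z))‖
        ≤ r * ∑ m : Fin (A.M ℓ), η / (r * A.M ℓ + 1) * (1 + ‖z‖ ^ 2) := by
          gcongr
          exact (norm_sum_le _ _).trans (Finset.sum_le_sum fun m _ => hq m a b z)
      _ = r * A.M ℓ / (r * A.M ℓ + 1) * (η * (1 + ‖z‖ ^ 2)) := by
          simp
          ring
      _ ≤ 1 * (η * (1 + ‖z‖ ^ 2)) := by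
          gcongr
          rw [div_le_one (by positivity)]
          linarith
      _ = _ := one_mul _

end Regular

/-! ### The conditional rate function -/

lemma condRate_nonneg (ℓ : ℕ) (Q₂ : PSD (A.Idx P (ℓ + 1))) (Q₁ : PSD (A.Idx P ℓ)) :
    0 ≤ A.condRate ℓ Q₂ Q₁ := by
  refine le_trans ?_ (le_iSup _ (⟨0, Matrix.isSymm_zero⟩ :
    {Q : Matrix (A.Idx P (ℓ + 1)) (A.Idx P (ℓ + 1)) ℝ // Q.IsSymm}))
  simp

/-- Translates the extended-real rate function into inequalities between integrals, which remain
meaningful when `I` is infinite. -/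
lemma EReal.lt_coe_sub_log_iff {a t : ℝ} {I : ENNReal} :
    (a : EReal) < t - ENNReal.log I ↔ I < eexp (t - a) := by
  rw [← ENNReal.log_lt_log_iff, log_eexp]
  induction ENNReal.log I with
  | bot => exact iff_of_true (by simp) (EReal.bot_lt_coe _)
  | top => simp
  | coe r =>
    norm_cast
    constructor <;> intro h <;> linarith

lemma trace_transpose_mul {ι : Type*} [Fintype ι] (Q₀ Q : Matrix ι ι ℝ) :
    (Q₀.transpose * Q).trace = ∑ a, ∑ b, Q₀ b a * Q b a := by
  simp [Matrix.trace, Matrix.mul_apply]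

lemma lintegral_multivariateGaussian (hσ : Continuous A.σ)
    (hR : ∀ ℓ, 1 ≤ ℓ → ℓ ≤ A.L → ∀ i, Continuous (A.R ℓ i)) {ℓ : ℕ} (h1 : 1 ≤ ℓ) (hℓ : ℓ ≤ A.L)
    (Q₁ : PSD (A.Idx P ℓ)) {f : (A.Idx P (ℓ + 1) → A.Idx P (ℓ + 1) → ℝ) → ℝ} (hf : Continuous f) :
    ∫⁻ z, eexp (f (PSD.entries (A.G ℓ z))) ∂(multivariateGaussian 0 Q₁.1) =
      ∫⁻ z, eexp (f (PSD.entries (A.G ℓ (PSD.sqrt Q₁ z))))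
        ∂(stdGaussian (EuclideanSpace ℝ (A.Idx P ℓ))) := by
  rw [PSD.multivariateGaussian_eq, lintegral_map _ (PSD.sqrt Q₁).continuous.measurable]
  exact (hf.comp (PSD.continuous_entries.comp (continuous_G hσ hR ℓ h1 hℓ))).measurable.eexp

lemma exists_clm_of_lt_condRate (hσ : Continuous A.σ)
    (hR : ∀ ℓ, 1 ≤ ℓ → ℓ ≤ A.L → ∀ i, Continuous (A.R ℓ i)) {ℓ : ℕ} (h1 : 1 ≤ ℓ) (hℓ : ℓ ≤ A.L)
    (Q₂ : PSD (A.Idx P (ℓ + 1))) (Q₁ : PSD (A.Idx P ℓ)) {a : ℝ}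
    (h : (a : EReal) < A.condRate ℓ Q₂ Q₁) :
    ∃ l : (A.Idx P (ℓ + 1) → A.Idx P (ℓ + 1) → ℝ) →L[ℝ] ℝ,
      ∫⁻ z, eexp (l (PSD.entries (A.G ℓ (PSD.sqrt Q₁ z))))
        ∂(stdGaussian (EuclideanSpace ℝ (A.Idx P ℓ))) < eexp (l (PSD.entries Q₂) - a) := by
  obtain ⟨Q₀, hQ₀⟩ := lt_iSup_iff.1 h
  let l : (A.Idx P (ℓ + 1) → A.Idx P (ℓ + 1) → ℝ) →L[ℝ] ℝ := LinearMap.toContinuousLinearMap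
    { toFun := fun E => ∑ a, ∑ b, Q₀.1 b a * E b a
      map_add' := fun E E' => by simp [mul_add, Finset.sum_add_distrib]
      map_smul' := fun r E => by
        simp only [Pi.smul_apply, smul_eq_mul, RingHom.id_apply, Finset.mul_sum]
        exact Finset.sum_congr rfl fun _ _ => Finset.sum_congr rfl fun _ _ => by ring }
  have hl (Q : PSD (A.Idx P (ℓ + 1))) : (Q₀.1.transpose * Q.1).trace = l (PSD.entries Q) :=
    trace_transpose_mul _ _
  simp_rw [hl] at hQ₀
  refine ⟨l, ?_⟩
  rw [← lintegral_multivariateGaussian hσ hR h1 hℓ Q₁ l.continuous]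
  exact EReal.lt_coe_sub_log_iff.1 hQ₀

/-- The rate function only tests symmetric matrices, whereas Cramér's theorem needs all linear
functionals. Symmetrizing the matrix of `l` does not change its values on symmetric matrices. -/
lemma eexp_le_of_condRate_le (hσ : Continuous A.σ)
    (hR : ∀ ℓ, 1 ≤ ℓ → ℓ ≤ A.L → ∀ i, Continuous (A.R ℓ i)) {ℓ : ℕ} (h1 : 1 ≤ ℓ) (hℓ : ℓ ≤ A.L)
    (Q₂ : PSD (A.Idx P (ℓ + 1))) (Q₁ : PSD (A.Idx P ℓ)) {a : ℝ}
    (h : A.condRate ℓ Q₂ Q₁ ≤ a) (l : (A.Idx P (ℓ + 1) → A.Idx P (ℓ + 1) → ℝ) →L[ℝ] ℝ) :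
    eexp (l (PSD.entries Q₂) - a) ≤ ∫⁻ z, eexp (l (PSD.entries (A.G ℓ (PSD.sqrt Q₁ z))))
        ∂(stdGaussian (EuclideanSpace ℝ (A.Idx P ℓ))) := by
  let B : Matrix (A.Idx P (ℓ + 1)) (A.Idx P (ℓ + 1)) ℝ :=
    Matrix.of fun a b => l (Pi.single a (Pi.single b 1))
  have hB (E : A.Idx P (ℓ + 1) → A.Idx P (ℓ + 1) → ℝ) : l E = ∑ a, ∑ b, B a b * E a b := by
    have hE : E = ∑ a, ∑ b, E a b • Pi.single a (Pi.single b (1 : ℝ)) := by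
      ext a b
      rw [Finset.sum_apply, Finset.sum_apply, Finset.sum_eq_single a]
      · rw [Finset.sum_apply, Finset.sum_apply, Finset.sum_eq_single b]
        · simp
        · intro b' _ hb'
          simp [hb'.symm]
        · simp
      · intro a' _ ha'
        simp [Finset.sum_apply, ha'.symm]
      · simp
    conv_lhs => rw [hE]
    simp only [map_sum, map_smul, smul_eq_mul, B, Matrix.of_apply]
    exact Finset.sum_congr rfl fun _ _ => Finset.sum_congr rfl fun _ _ => mul_comm _ _
  let Q₀ : Matrix (A.Idx P (ℓ + 1)) (A.Idx P (ℓ + 1)) ℝ := (1 / 2 : ℝ) • (B + B.transpose)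
  have hQ₀ : Q₀.IsSymm := by
    refine Matrix.IsSymm.ext fun a b => ?_
    simp [Q₀, add_comm]
  have hl (Q : PSD (A.Idx P (ℓ + 1))) : (Q₀.transpose * Q.1).trace = l (PSD.entries Q) := by
    have hsymm (a b) : Q.1 a b = Q.1 b a := by
      have := congrFun (congrFun Q.2.isHermitian b) a
      simpa using this
    rw [trace_transpose_mul, hB]
    have e1 : ∑ a, ∑ b, Q₀ b a * Q.1 b a =
        1 / 2 * ∑ a, ∑ b, B b a * Q.1 b a + 1 / 2 * ∑ a, ∑ b, B a b * Q.1 a b := by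
      rw [Finset.mul_sum, Finset.mul_sum, ← Finset.sum_add_distrib]
      refine Finset.sum_congr rfl fun a _ => ?_
      rw [Finset.mul_sum, Finset.mul_sum, ← Finset.sum_add_distrib]
      refine Finset.sum_congr rfl fun b _ => ?_
      rw [hsymm a b]
      simp only [Q₀, Matrix.smul_apply, Matrix.add_apply, Matrix.transpose_apply, smul_eq_mul]
      ring
    rw [e1, Finset.sum_comm]
    simp only [PSD.entries]
    ring
  have hle := (le_iSup (fun Q₀ : {Q : Matrix (A.Idx P (ℓ + 1)) (A.Idx P (ℓ + 1)) ℝ // Q.IsSymm} =>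
    ((Q₀.1.transpose * Q₂.1).trace : EReal) - ENNReal.log (∫⁻ z, ENNReal.ofReal (Real.exp
      ((Q₀.1.transpose * (A.G ℓ z).1).trace)) ∂(multivariateGaussian 0 Q₁.1))) ⟨Q₀, hQ₀⟩).trans h
  simp_rw [hl] at hle
  rw [← lintegral_multivariateGaussian hσ hR h1 hℓ Q₁ l.continuous]
  by_contra! hcon
  exact absurd (EReal.lt_coe_sub_log_iff.2 hcon) (not_lt.2 hle)

end CNN

/-! ### From the number of channels to the speed `n` -/

lemma eventually_mul_le_mul_of_lt {k : ℕ → ℕ} {α : ℝ}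
    (hk : Tendsto (fun n : ℕ => (k n : ℝ) / n) atTop (𝓝 α)) {a b : ℝ} (h : a < α * b) :
    ∀ᶠ n : ℕ in atTop, n * a ≤ k n * b := by
  filter_upwards [(hk.mul_const b).eventually (lt_mem_nhds h), eventually_ge_atTop 1] with n hn hn1
  have hn0 : (0 : ℝ) < n := by exact_mod_cast hn1
  have := mul_le_mul_of_nonneg_left hn.le hn0.le
  calc n * a ≤ n * (k n / n * b) := this
    _ = k n * b := by field_simp

lemma eventually_mul_le_mul_of_gt {k : ℕ → ℕ} {α : ℝ}
    (hk : Tendsto (fun n : ℕ => (k n : ℝ) / n) atTop (𝓝 α)) {a b : ℝ} (h : α * b < a) :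
    ∀ᶠ n : ℕ in atTop, k n * b ≤ n * a := by
  filter_upwards [eventually_mul_le_mul_of_lt hk (a := -a) (b := -b) (by linarith)] with n hn
  linarith

lemma tendsto_atTop_of_div_tendsto {k : ℕ → ℕ} {α : ℝ} (hα : 0 < α)
    (hk : Tendsto (fun n : ℕ => (k n : ℝ) / n) atTop (𝓝 α)) : Tendsto k atTop atTop := by
  rw [← tendsto_natCast_atTop_iff (R := ℝ)]
  refine (hk.pos_mul_atTop hα tendsto_natCast_atTop_atTop).congr' ?_
  filter_upwards [eventually_ge_atTop 1] with n hn
  have hn0 : (n : ℝ) ≠ 0 := by positivity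
  field_simp

lemma EReal.exists_lt_of_lt_coe_mul {α a : ℝ} (hα : 0 < α) {J : EReal} (hJ : 0 ≤ J)
    (h : (a : EReal) < α * J) : ∃ b : ℝ, (b : EReal) < J ∧ a < α * b := by
  have key : ∀ b, a / α < b → a < α * b := fun b hb => by
    rwa [div_lt_iff₀ hα, mul_comm] at hb
  induction J with
  | bot => simp at hJ
  | top => exact ⟨a / α + 1, EReal.coe_lt_top _, key _ (by linarith)⟩
  | coe r =>
    have h' : a < α * r := by exact_mod_cast h
    obtain ⟨b, h1, h2⟩ := exists_between (show a / α < r by rwa [div_lt_iff₀ hα, mul_comm])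
    exact ⟨b, by exact_mod_cast h2, key b h1⟩

lemma EReal.exists_gt_of_coe_mul_lt {α a : ℝ} (hα : 0 < α) {J : EReal} (hJ : 0 ≤ J)
    (h : α * J < (a : EReal)) : ∃ b : ℝ, J < (b : EReal) ∧ α * b < a := by
  induction J with
  | bot => simp at hJ
  | top => rw [EReal.coe_mul_top_of_pos hα] at h; simp at h
  | coe r =>
    have h' : α * r < a := by exact_mod_cast h
    obtain ⟨b, h1, h2⟩ := exists_between (show r < a / α by rwa [lt_div_iff₀ hα, mul_comm])
    exact ⟨b, by exact_mod_cast h1, by rwa [lt_div_iff₀ hα, mul_comm] at h2⟩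

/-! ### Large deviation estimates for the transition between layers -/

namespace CNN

variable {A : CNN} {P : ℕ}

section Layer

variable (hσ : Continuous A.σ) (hR : ∀ ℓ, 1 ≤ ℓ → ℓ ≤ A.L → ∀ i, Continuous (A.R ℓ i))
  {ℓ : ℕ} (h1 : 1 ≤ ℓ) (hℓ : ℓ ≤ A.L)

include hσ hR h1 hℓ

lemma continuous_mean_G (m : ℕ) (Q : PSD (A.Idx P ℓ)) :
    Continuous fun z : Fin m → EuclideanSpace ℝ (A.Idx P ℓ) =>
      PSD.mean fun c => A.G ℓ (PSD.sqrt Q (z c)) :=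
  continuous_mean.comp (continuous_pi fun c => (continuous_G hσ hR ℓ h1 hℓ).comp
    ((PSD.sqrt Q).continuous.comp (continuous_apply c)))

lemma isProbabilityMeasure_layerKernel (m : ℕ) (Q : PSD (A.Idx P ℓ)) :
    IsProbabilityMeasure (A.layerKernel P ℓ m Q) :=
  Measure.isProbabilityMeasure_map (continuous_mean_G hσ hR h1 hℓ m Q).measurable.aemeasurable

lemma layerKernel_apply (m : ℕ) (Q : PSD (A.Idx P ℓ))
    {s : Set (A.Idx P (ℓ + 1) → A.Idx P (ℓ + 1) → ℝ)} (hs : MeasurableSet s) :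
    A.layerKernel P ℓ m Q (PSD.entries ⁻¹' s) =
      (Measure.pi fun _ : Fin m => stdGaussian (EuclideanSpace ℝ (A.Idx P ℓ)))
        {z | (m : ℝ)⁻¹ • ∑ c, PSD.entries (A.G ℓ (PSD.sqrt Q (z c))) ∈ s} := by
  rw [layerKernel, Measure.map_apply (continuous_mean_G hσ hR h1 hℓ m Q).measurable
    (PSD.continuous_entries.measurable hs)]
  simp only [← entries_mean]
  rfl

variable (hσLip : ∃ ρ, AsympLipschitz A.σ ρ)
  (hRLip : ∀ ℓ, 1 ≤ ℓ → ℓ ≤ A.L → ∀ i, ∃ ρ, AsympLipschitz (A.R ℓ i) ρ)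
  {k : ℕ → ℕ} {α : ℝ} (hα : 0 < α) (hk : Tendsto (fun n : ℕ => (k n : ℝ) / n) atTop (𝓝 α))

include hσLip hRLip hα hk

lemma layerKernel_upper (Q : PSD (A.Idx P ℓ)) (Q' : PSD (A.Idx P (ℓ + 1))) (a : ℝ)
    (h : (a : EReal) < α * A.condRate ℓ Q' Q) : ∃ U ∈ 𝓝 Q, ∃ V ∈ 𝓝 Q', ∀ᶠ n : ℕ in atTop,
      ∀ q ∈ U, A.layerKernel P ℓ (k n) q V ≤ eexp (-(n * a)) := by
  obtain ⟨b, hb, hab⟩ := EReal.exists_lt_of_lt_coe_mul hα (condRate_nonneg _ _ _) h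
  obtain ⟨δ, hδ, hU⟩ := (expContinuousFamily hσ hσLip hR hRLip h1 hℓ).local_upper Q
    (PSD.entries Q') (exists_clm_of_lt_condRate hσ hR h1 hℓ Q' Q hb)
  refine ⟨_, hU, _, (PSD.nhds_basis_entries Q').mem_of_mem hδ, ?_⟩
  filter_upwards [eventually_mul_le_mul_of_lt hk hab] with n hn q hq
  refine ((layerKernel_apply hσ hR h1 hℓ (k n) q
    (s := {E | ‖E - PSD.entries Q'‖ ≤ δ}) ?_).trans_le (hq (k n))).trans ?_
  · exact (isClosed_le (by fun_prop) continuous_const).measurableSet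
  · rw [eexp_le]
    linarith

lemma layerKernel_lower (Q : PSD (A.Idx P ℓ)) (Q' : PSD (A.Idx P (ℓ + 1))) (a : ℝ)
    (h : α * A.condRate ℓ Q' Q < (a : EReal)) (V : Set (PSD (A.Idx P (ℓ + 1)))) (hV : V ∈ 𝓝 Q') :
    ∃ U ∈ 𝓝 Q, ∀ᶠ n : ℕ in atTop,
      ∀ q ∈ U, eexp (-(n * a)) ≤ A.layerKernel P ℓ (k n) q V := by
  obtain ⟨b, hb, hab⟩ := EReal.exists_gt_of_coe_mul_lt hα (condRate_nonneg _ _ _) h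
  obtain ⟨b₀, hb₀, hbb⟩ := EReal.exists_between_coe_real hb
  rw [EReal.coe_lt_coe_iff] at hbb
  obtain ⟨δ, hδ, hδV⟩ := (PSD.nhds_basis_entries Q').mem_iff.1 hV
  obtain ⟨U, hU, hUn⟩ := (expContinuousFamily hσ hσLip hR hRLip h1 hℓ).local_lower Q
    (PSD.entries Q') hbb (eexp_le_of_condRate_le hσ hR h1 hℓ Q' Q hb₀.le) hδ
  refine ⟨U, hU, ?_⟩
  filter_upwards [(tendsto_atTop_of_div_tendsto hα hk).eventually hUn,
    eventually_mul_le_mul_of_gt hk hab] with n hn hn2 q hq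
  refine le_trans ?_ ((hn q hq).trans ((layerKernel_apply hσ hR h1 hℓ (k n) q
    (s := {E | ‖E - PSD.entries Q'‖ ≤ δ}) ?_).symm.trans_le (measure_mono hδV)))
  · rw [eexp_le]
    linarith
  · exact (isClosed_le (by fun_prop) continuous_const).measurableSet

lemma layerKernel_tight (Q : PSD (A.Idx P ℓ)) (a : ℝ) :
    ∃ U ∈ 𝓝 Q, ∃ K, IsCompact K ∧ ∀ᶠ n : ℕ in atTop,
      ∀ q ∈ U, A.layerKernel P ℓ (k n) q Kᶜ ≤ eexp (-(n * a)) := by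
  -- Per channel the rate must exceed a/α, since there are about αn channels.
  obtain ⟨r, hr⟩ := (expContinuousFamily hσ hσLip hR hRLip h1 hℓ).local_tight Q ((a + 1) / α)
  refine ⟨_, hr, _, PSD.isCompact_norm_entries_le r, ?_⟩
  have hab : a < α * ((a + 1) / α) := by
    rw [mul_div_cancel₀ _ hα.ne']
    linarith
  filter_upwards [eventually_mul_le_mul_of_lt hk hab] with n hn q hq
  have hset : {Q : PSD (A.Idx P (ℓ + 1)) | ‖PSD.entries Q‖ ≤ r}ᶜ =
      PSD.entries ⁻¹' {E | r < ‖E‖} := by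
    ext Q
    simp
  rw [hset]
  refine ((layerKernel_apply hσ hR h1 hℓ (k n) q ?_).trans_le (hq (k n))).trans ?_
  · exact (isOpen_lt continuous_const continuous_norm).measurableSet
  · rw [eexp_le]
    linarith

end Layer

/-! ### The rate functions of the layers -/

/-- The rate function of the conditional covariance of layer `ℓ + 1`. -/
noncomputable def rateUpTo (A : CNN) {P C₀ : ℕ} (α : ℕ → ℝ)
    (x : Fin P → Fin C₀ → EuclideanSpace ℝ (Fin (A.N 0))) (ℓ : ℕ) (Q : PSD (A.Idx P (ℓ + 1))) :
    EReal :=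
  ⨅ (q : ∀ ℓ : ℕ, PSD (A.Idx P ℓ)) (_ : q 1 = A.inputCov x) (_ : q (ℓ + 1) = Q),
    ∑ k ∈ Finset.Icc 1 ℓ, (α k : EReal) * A.condRate k (q (k + 1)) (q k)

variable {C₀ : ℕ} {α : ℕ → ℝ} {x : Fin P → Fin C₀ → EuclideanSpace ℝ (Fin (A.N 0))}

lemma rateUpTo_lt_iff {ℓ : ℕ} {Q : PSD (A.Idx P (ℓ + 1))} {a : EReal} :
    A.rateUpTo α x ℓ Q < a ↔ ∃ q : ∀ ℓ : ℕ, PSD (A.Idx P ℓ), q 1 = A.inputCov x ∧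
      q (ℓ + 1) = Q ∧ ∑ k ∈ Finset.Icc 1 ℓ, (α k : EReal) * A.condRate k (q (k + 1)) (q k) < a := by
  simp only [rateUpTo, iInf_lt_iff, exists_prop]

lemma rateUpTo_nonneg (hα : ∀ ℓ, 1 ≤ ℓ → ℓ ≤ A.L → 0 < α ℓ) {ℓ : ℕ} (hℓ : ℓ ≤ A.L)
    (Q : PSD (A.Idx P (ℓ + 1))) : 0 ≤ A.rateUpTo α x ℓ Q := by
  refine le_iInf fun q => le_iInf fun _ => le_iInf fun _ => Finset.sum_nonneg fun k hk => ?_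
  rw [Finset.mem_Icc] at hk
  exact mul_nonneg (EReal.coe_nonneg.2 (hα k hk.1 (hk.2.trans hℓ)).le) (condRate_nonneg _ _ _)

/-- Dynamic programming: a nearly optimal path ending at `Q` is extended by one step to `Q'`. The
reverse inequality, in the next lemma, truncates a path. -/
lemma rateUpTo_succ_le (hα : ∀ ℓ, 1 ≤ ℓ → ℓ ≤ A.L → 0 < α ℓ) {ℓ : ℕ} (hℓ : ℓ + 1 ≤ A.L)
    (Q : PSD (A.Idx P (ℓ + 1))) (Q' : PSD (A.Idx P (ℓ + 2))) :
    A.rateUpTo α x (ℓ + 1) Q' ≤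
      A.rateUpTo α x ℓ Q + α (ℓ + 1) * A.condRate (ℓ + 1) Q' Q := by
  refine EReal.le_of_forall_lt_iff_le.1 fun z hz => ?_
  obtain ⟨b, c, hb, hc, hbc⟩ := EReal.exists_add_le_of_add_lt
    (rateUpTo_nonneg hα (by omega) Q)
    (mul_nonneg (EReal.coe_nonneg.2 (hα (ℓ + 1) (by omega) hℓ).le) (condRate_nonneg _ _ _)) hz
  obtain ⟨q, hq1, hq2, hq3⟩ := rateUpTo_lt_iff.1 hb
  have hne {k : ℕ} (hk : k ≤ ℓ + 1) : Function.update q (ℓ + 2) Q' k = q k :=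
    Function.update_of_ne (by omega) _ _
  refine (iInf_le_of_le (Function.update q (ℓ + 2) Q') (iInf_le_of_le ?_ (iInf_le_of_le ?_ ?_)))
  · exact (hne (by omega)).trans hq1
  · exact Function.update_self _ _ _
  · rw [Finset.sum_Icc_succ_top (by omega)]
    refine le_trans (add_le_add (b := (b : EReal)) (d := (c : EReal)) ?_ ?_) (by exact_mod_cast hbc)
    · refine le_trans (le_of_eq (Finset.sum_congr rfl fun k hk => ?_)) hq3.le
      rw [Finset.mem_Icc] at hk
      rw [hne (by omega), hne (by omega)]
    · rw [hne le_rfl, hq2]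
      refine le_trans (le_of_eq ?_) hc.le
      congr 2
      exact Function.update_self _ _ _

lemma exists_of_rateUpTo_succ_lt {ℓ : ℕ} (Q' : PSD (A.Idx P (ℓ + 2))) (a : ℝ)
    (h : A.rateUpTo α x (ℓ + 1) Q' < a) :
    ∃ Q : PSD (A.Idx P (ℓ + 1)),
      A.rateUpTo α x ℓ Q + α (ℓ + 1) * A.condRate (ℓ + 1) Q' Q < a := by
  obtain ⟨q, hq1, hq2, hq3⟩ := rateUpTo_lt_iff.1 h
  refine ⟨q (ℓ + 1), lt_of_le_of_lt ?_ hq3⟩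
  rw [Finset.sum_Icc_succ_top (by omega), ← hq2]
  gcongr
  exact iInf_le_of_le q (iInf_le_of_le hq1 (iInf_le_of_le rfl le_rfl))

/-- The number of input channels equals `C₀` only propositionally, so the inputs are transported
along the equality. -/
lemma inputCov_cast {k : ℕ} (h : k = C₀) :
    A.inputCov (fun μ c => x μ (Fin.cast h c)) = A.inputCov x := by
  subst h
  rfl

/-- The conditional covariance of every layer satisfies local large deviation estimates. -/
lemma localLDP_condCov (hσ : Continuous A.σ) (hσLip : ∃ ρ, AsympLipschitz A.σ ρ)
    (hR : ∀ ℓ, 1 ≤ ℓ → ℓ ≤ A.L → ∀ i, Continuous (A.R ℓ i))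
    (hRLip : ∀ ℓ, 1 ≤ ℓ → ℓ ≤ A.L → ∀ i, ∃ ρ, AsympLipschitz (A.R ℓ i) ρ)
    {C : ℕ → ℕ → ℕ} (hC₀ : ∀ n, C n 0 = C₀) (hα : ∀ ℓ, 1 ≤ ℓ → ℓ ≤ A.L → 0 < α ℓ)
    (hC : ∀ ℓ, 1 ≤ ℓ → ℓ ≤ A.L → Tendsto (fun n : ℕ => (C n ℓ : ℝ) / n) atTop (𝓝 (α ℓ)))
    (ℓ : ℕ) (h : ℓ < A.L + 1) :
    LocalLDP (fun n => (A.prior (C n)).map fun W =>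
      A.condCov W (fun μ c => x μ (Fin.cast (hC₀ n) c)) ℓ h) (A.rateUpTo α x ℓ) := by
  induction ℓ with
  | zero =>
    -- The first covariance is deterministic; its rate is 0 at that matrix (an empty sum) and
    -- infinite elsewhere (no admissible path).
    have hd (n : ℕ) : ((A.prior (C n)).map fun W =>
        A.condCov W (fun μ c => x μ (Fin.cast (hC₀ n) c)) 0 h) =
        Measure.dirac (A.inputCov x) := by
      simp only [condCov, inputCov_cast]
      rw [Measure.map_const, measure_univ, one_smul]
    simp_rw [hd]
    refine ⟨rateUpTo_nonneg hα (by omega), fun Q a ha => ?_, fun Q a ha U hU => ?_,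
      fun a => ⟨{A.inputCov x}, isCompact_singleton, Eventually.of_forall fun n => ?_⟩⟩
    · by_cases hQ : Q = A.inputCov x
      · refine ⟨Set.univ, univ_mem, Eventually.of_forall fun n => ?_⟩
        have ha0 : a ≤ 0 := by
          by_contra! hcon
          -- Only index 1 of the path matters here; the zero matrix fills the other indices.
          refine absurd ((rateUpTo_lt_iff.2 ⟨fun k => if hk : k = 1 then hk ▸ Q else
            ⟨0, Matrix.PosSemidef.zero⟩, by simpa using hQ, by simp, ?_⟩).trans ha) (lt_irrefl _)
          simpa using hcon
        rw [measure_univ, ← eexp_zero, eexp_le]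
        have := mul_nonneg (Nat.cast_nonneg (α := ℝ) n) (neg_nonneg.2 ha0)
        linarith
      · refine ⟨{A.inputCov x}ᶜ, isOpen_compl_singleton.mem_nhds hQ,
          Eventually.of_forall fun n => ?_⟩
        rw [Measure.dirac_apply' _ (measurableSet_singleton _).compl]
        simp
    · obtain ⟨q, hq1, hq2, hq3⟩ := rateUpTo_lt_iff.1 ha
      have hQ : A.inputCov x = Q := hq1.symm.trans hq2
      refine Eventually.of_forall fun n => ?_
      rw [Measure.dirac_apply_of_mem (hQ ▸ mem_of_mem_nhds hU), ← eexp_zero, eexp_le]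
      have ha0 : 0 < a := by simpa using hq3
      have := mul_nonneg (Nat.cast_nonneg (α := ℝ) n) ha0.le
      linarith
    · rw [Measure.dirac_apply' _ (measurableSet_singleton _).compl]
      simp
  | succ ℓ ih =>
    have h1 : 1 ≤ ℓ + 1 := by omega
    have hℓ : ℓ + 1 ≤ A.L := by omega
    have hα' := hα (ℓ + 1) h1 hℓ
    have hC' := hC (ℓ + 1) h1 hℓ
    have hp (n : ℕ) := Measure.isProbabilityMeasure_map (μ := A.prior (C n))
      (continuous_condCov (fun μ c => x μ (Fin.cast (hC₀ n) c)) hσ hR ℓ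
        (Nat.lt_of_succ_lt h)).measurable.aemeasurable
    have hκ (n : ℕ) (Q : PSD (A.Idx P (ℓ + 1))) :=
      isProbabilityMeasure_layerKernel hσ hR h1 hℓ (C n (ℓ + 1)) Q
    exact (ih (Nat.lt_of_succ_lt h)).comp_kernel
      (κ := fun n Q => A.layerKernel P (ℓ + 1) (C n (ℓ + 1)) Q)
      (J := fun Q Q' => α (ℓ + 1) * A.condRate (ℓ + 1) Q' Q)
      (fun n V hV => map_condCov_succ _ hσ hR ℓ h hV)
      (fun Q Q' => mul_nonneg (EReal.coe_nonneg.2 hα'.le) (condRate_nonneg _ _ _))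
      (layerKernel_upper hσ hR h1 hℓ hσLip hRLip hα' hC')
      (layerKernel_lower hσ hR h1 hℓ hσLip hRLip hα' hC')
      (layerKernel_tight hσ hR h1 hℓ hσLip hRLip hα' hC')
      (rateUpTo_nonneg hα hℓ) (rateUpTo_succ_le hα hℓ) exists_of_rateUpTo_succ_lt

end CNN

/-! ### The posterior -/

namespace CNN

variable (A : CNN) {C : ℕ → ℕ} {P : ℕ}
  (x : Fin P → Fin (C 0) → EuclideanSpace ℝ (Fin (A.N 0))) (β : ℝ)

/-- The likelihood without its normalizing constant. -/
noncomputable def fit (y : Fin P → Fin (C (A.L + 1)) → EuclideanSpace ℝ (Fin (A.N (A.L + 1))))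
    (W : A.Weights C) : ENNReal :=
  eexp (-(β / 2) * ∑ μ, ∑ c, ‖A.preact W (x μ) A.L (Nat.lt_succ_self _) c - y μ c‖ ^ 2)

/-- The unnormalized law of `K^{(L+1)}` under the posterior. -/
noncomputable def fitLaw (y : Fin P → Fin (C (A.L + 1)) → EuclideanSpace ℝ (Fin (A.N (A.L + 1)))) :
    Measure (PSD (A.Idx P (A.L + 1))) :=
  ((A.prior C).withDensity (A.fit x β y)).map (A.lastCov x)

variable {A} (hσ : Continuous A.σ) (hR : ∀ ℓ, 1 ≤ ℓ → ℓ ≤ A.L → ∀ i, Continuous (A.R ℓ i))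

include hσ hR

lemma measurable_fit (y : Fin P → Fin (C (A.L + 1)) → EuclideanSpace ℝ (Fin (A.N (A.L + 1)))) :
    Measurable (A.fit x β y) := by
  refine Measurable.eexp (Continuous.measurable ?_)
  refine continuous_const.mul (continuous_finsetSum _ fun μ _ => continuous_finsetSum _ fun c _ => ?_)
  exact (((continuous_apply c).comp (continuous_preact hσ hR (x μ) A.L _)).sub
    continuous_const).norm.pow 2

lemma measurable_lastCov : Measurable (A.lastCov x : A.Weights C → _) :=
  (continuous_condCov x hσ hR A.L _).measurable

variable {β}

/-- The Gaussian normalizing factor of the likelihood cancels in Bayes' formula, leaving a density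
bounded by 1. -/
lemma posteriorLaw_eq (hβ : 0 < β)
    (y : Fin P → Fin (C (A.L + 1)) → EuclideanSpace ℝ (Fin (A.N (A.L + 1)))) :
    A.posteriorLaw x β y = (A.fitLaw x β y Set.univ)⁻¹ • A.fitLaw x β y := by
  have hm := measurable_lastCov x hσ hR (C := C)
  have hf := measurable_fit x β hσ hR y
  set r : ℝ := (β / (2 * Real.pi)) ^ (((C (A.L + 1) * A.N (A.L + 1) * P : ℕ) : ℝ) / 2) with hr
  have hr0 : 0 < r := by positivity
  have hlik : (fun W => ENNReal.ofReal (A.likelihood x β y W)) =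
      ENNReal.ofReal r • A.fit x β y := by
    ext W
    rw [likelihood, ENNReal.ofReal_mul hr0.le]
    rfl
  have hu : A.fitLaw x β y Set.univ = ∫⁻ W, A.fit x β y W ∂(A.prior C) := by
    rw [fitLaw, Measure.map_apply hm MeasurableSet.univ, Set.preimage_univ,
      withDensity_apply _ MeasurableSet.univ, Measure.restrict_univ]
  rw [posteriorLaw, posterior, hlik, withDensity_smul _ hf, hu, fitLaw, smul_smul,
    Measure.map_smul]
  congr 1
  change (∫⁻ W, ENNReal.ofReal r * A.fit x β y W ∂(A.prior C))⁻¹ * _ = _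
  rw [lintegral_const_mul _ hf, ENNReal.mul_inv (.inl (ENNReal.ofReal_pos.2 hr0).ne')
    (.inl ENNReal.ofReal_ne_top), mul_right_comm,
    ENNReal.inv_mul_cancel (ENNReal.ofReal_pos.2 hr0).ne' ENNReal.ofReal_ne_top, one_mul]

lemma fitLaw_le (hβ : 0 < β)
    (y : Fin P → Fin (C (A.L + 1)) → EuclideanSpace ℝ (Fin (A.N (A.L + 1)))) :
    A.fitLaw x β y ≤ A.priorLaw x := by
  refine Measure.map_mono ?_ (measurable_lastCov x hσ hR)
  refine (withDensity_mono (ae_of_all _ fun W => ?_)).trans_eq withDensity_one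
  rw [fit, Pi.one_apply, ← eexp_zero, eexp_le, neg_mul]
  exact neg_nonpos.2 (by positivity)

/-- On a compact set of covariances, the posterior is bounded from below by a multiple of the prior
that does not depend on the widths of the hidden layers. -/
lemma exists_const_mul_priorLaw_le (hβ : 0 < β) {P Cout : ℕ}
    (y : Fin P → Fin Cout → EuclideanSpace ℝ (Fin (A.N (A.L + 1))))
    {K : Set (PSD (A.Idx P (A.L + 1)))} (hK : IsCompact K) :
    ∃ c : ENNReal, c ≠ 0 ∧ c ≠ ⊤ ∧ ∀ (C : ℕ → ℕ)
      (x : Fin P → Fin (C 0) → EuclideanSpace ℝ (Fin (A.N 0))) (hCout : C (A.L + 1) = Cout),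
      ∀ V ⊆ K, MeasurableSet V →
        c * A.priorLaw x V ≤ A.fitLaw x β (fun μ c => y μ (Fin.cast hCout c)) V := by
  let E := EuclideanSpace ℝ (A.Idx P (A.L + 1))
  let γ : Measure (Fin Cout → E) := Measure.pi fun _ => stdGaussian E
  let loss (h : Fin Cout → E) : ℝ := ∑ μ, ∑ c, ‖A.sliceCLM P (A.L + 1) μ (h c) - y μ c‖ ^ 2
  have hloss : Continuous loss := by fun_prop
  -- For covariances in `K` and noise in a compact set `T` of positive Gaussian mass, the outputs √Q
  -- z stay in a compact set and the loss is at most `B`. The conditional expectation of the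
  -- likelihood is then at least exp(-βB/2) γ(T), whatever the hidden widths.
  obtain ⟨T, -, hT, hT0⟩ := isOpen_univ.exists_lt_isCompact (μ := γ) (r := 0) (by simp)
  have hsq : Continuous fun p : PSD (A.Idx P (A.L + 1)) × (Fin Cout → E) =>
      loss fun c => PSD.sqrt p.1 (p.2 c) := by
    refine hloss.comp (continuous_pi fun c => ?_)
    exact (PSD.continuous_sqrt.comp continuous_fst).clm_apply
      ((continuous_apply c).comp continuous_snd)
  obtain ⟨B, hB⟩ := (hK.prod hT).bddAbove_image hsq.continuousOn
  refine ⟨eexp (-(β / 2) * B) * γ T, mul_ne_zero (eexp_ne_zero _) hT0.ne',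
    ENNReal.mul_ne_top (eexp_ne_top _) (measure_ne_top _ _), fun C x hCout V hV hVm => ?_⟩
  subst hCout
  have hm := measurable_lastCov x hσ hR (C := C)
  have hF : Measurable fun p : PSD (A.Idx P (A.L + 1)) × (Fin (C (A.L + 1)) → E) =>
      V.indicator 1 p.1 * eexp (-(β / 2) * loss p.2) :=
    ((measurable_one.indicator hVm).comp measurable_fst).mul
      (Measurable.eexp ((hloss.comp continuous_snd).measurable.const_mul _))
  have key := lintegral_condCov_preacts x hσ hR A.L (Nat.lt_succ_self _) hF
  have hfit : A.fitLaw x β (fun μ c => y μ (Fin.cast rfl c)) V =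
      ∫⁻ W, V.indicator 1 (A.condCov W x A.L (Nat.lt_succ_self _)) *
        eexp (-(β / 2) * loss (A.preacts W x A.L (Nat.lt_succ_self _))) ∂(A.prior C) := by
    rw [fitLaw, Measure.map_apply hm hVm, withDensity_apply _ (hm hVm),
      ← lintegral_indicator (hm hVm)]
    refine lintegral_congr fun W => ?_
    by_cases hW : A.condCov W x A.L (Nat.lt_succ_self _) ∈ V
    · rw [Set.indicator_of_mem hW, Set.indicator_of_mem (by exact hW), Pi.one_apply, one_mul]
      rfl
    · rw [Set.indicator_of_notMem hW, Set.indicator_of_notMem (by exact hW), zero_mul]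
  rw [hfit, key, ← setLIntegral_const]
  change _ ≤ ∫⁻ Q, _ ∂(A.priorLaw x)
  rw [← lintegral_indicator hVm]
  refine lintegral_mono fun Q => ?_
  by_cases hQ : Q ∈ V
  · simp only [Set.indicator_of_mem hQ, Pi.one_apply, one_mul]
    rw [← setLIntegral_const]
    refine (setLIntegral_mono_ae' hT.measurableSet (ae_of_all _ fun z hz => ?_)).trans
      (setLIntegral_le_lintegral T _)
    rw [eexp_le]
    exact mul_le_mul_of_nonpos_left (hB ⟨(Q, z), ⟨hV hQ, hz⟩, rfl⟩) (by linarith)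
  · simp [hQ]

end CNN

theorem mainTheorem5 (A : CNN) (hL : 1 ≤ A.L) (hlam : ∀ ℓ ≤ A.L, 0 < A.lam ℓ)
    (hσ : Continuous A.σ)
    (hσLip : ∃ ρ : ℝ → ℝ, LocallyBdd ρ ∧ AsympLipschitz A.σ ρ)
    (hR : ∀ ℓ, 1 ≤ ℓ → ℓ ≤ A.L → ∀ i, Continuous (A.R ℓ i))
    (hRLip : ∀ ℓ, 1 ≤ ℓ → ℓ ≤ A.L → ∀ i, ∃ ρ, AsympLipschitz (A.R ℓ i) ρ)
    (P C₀ Cout : ℕ) (x : Fin P → Fin C₀ → EuclideanSpace ℝ (Fin (A.N 0)))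
    (C : ℕ → ℕ → ℕ) (hC₀ : ∀ n, C n 0 = C₀) (hCout : ∀ n, C n (A.L + 1) = Cout)
    (α : ℕ → ℝ) (hα : ∀ ℓ, 1 ≤ ℓ → ℓ ≤ A.L → 0 < α ℓ)
    (hC : ∀ ℓ, 1 ≤ ℓ → ℓ ≤ A.L →
      Tendsto (fun n : ℕ => (C n ℓ : ℝ) / n) atTop (𝓝 (α ℓ))) :
    SatisfiesLDP
      (fun n => A.priorLaw (C := C n) (fun μ c => x μ (Fin.cast (hC₀ n) c)))
      (A.lastRate α x) ∧
    ∀ (β : ℝ), 0 < β → ∀ y : Fin P → Fin Cout → EuclideanSpace ℝ (Fin (A.N (A.L + 1))),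
      SatisfiesLDP
        (fun n => A.posteriorLaw (C := C n) (fun μ c => x μ (Fin.cast (hC₀ n) c)) β
          (fun μ c => y μ (Fin.cast (hCout n) c)))
        (A.lastRate α x) := by
  obtain ⟨ρ, -, hρ⟩ := hσLip
  -- `lastRate` unfolds to `rateUpTo` at ℓ = L, and `priorLaw` to the law of the covariance there.
  have h : LocalLDP (fun n => A.priorLaw (C := C n) (fun μ c => x μ (Fin.cast (hC₀ n) c)))
      (A.lastRate α x) :=
    CNN.localLDP_condCov hσ ⟨ρ, hρ⟩ hR hRLip hC₀ hα hC A.L (Nat.lt_succ_self _)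
  refine ⟨h.satisfiesLDP, fun β hβ y => ?_⟩
  have hp (n : ℕ) : IsProbabilityMeasure
      (A.priorLaw (C := C n) (fun μ c => x μ (Fin.cast (hC₀ n) c))) :=
    Measure.isProbabilityMeasure_map (CNN.measurable_lastCov _ hσ hR).aemeasurable
  simp_rw [fun n => CNN.posteriorLaw_eq (C := C n) (fun μ c => x μ (Fin.cast (hC₀ n) c)) hσ hR hβ
    (fun μ c => y μ (Fin.cast (hCout n) c))]
  refine (h.tilt (fun n => CNN.fitLaw_le _ hσ hR hβ _) fun K hK => ?_).satisfiesLDP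
  obtain ⟨c, hc0, hct, hc⟩ := CNN.exists_const_mul_priorLaw_le hσ hR hβ y hK
  exact ⟨c, hc0, hct, fun n => hc (C n) _ (hCout n)⟩
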